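/- **Theorem ($\mathsf{RCA}_0$).** Cousin's lemma for Baire 1 functions, $\mathsf{CL}_{\mathrm{B1}}$, implies the sequential completeness $\mathsf{SC}$ of the reals in $[0,1]$, and implies $\mathsf{ACA}_0$. That is, every model $M$ of $\mathsf{RCA}_0$ (an arbitrary, possibly nonstandard, structure for the two-sorted language of second-order arithmetic satisfying the basic axioms, $\Sigma^0_1$ induction and $\Delta^0_1$ comprehension) in which $\mathsf{CL}_{\mathrm{B1}}$ holds satisfies $\mathsf{SC}$ and is a model of $\mathsf{ACA}_0$. Here all notions are interpreted inside $M$, as follows. A pair of numbers is coded by $(m,n)=(m+n)^2+m$; integers are coded by least pairs representing differences, and rationals by least pairs representing fractions. A *real number* is a sequence of rationals $(q_i)$ with $|q_m-q_n|\le 2^{-m}$ for all $m\le n$; further $(q_i)\le(q_i')$ means $q_k\le q_k'+2^{-k+1}$ for all $k$, and $x<y$ means $\neg(y\le x)$. A *(total) continuous function* $f\colon[0,1]\to\mathbb R$ is a set of pairs $(U,V)$, where $U$ is a nonempty interval $(p,q)\cap[0,1]$ and $V$ an open interval, both with rational endpoints (read: $f(U)\subseteq V$), such that any two $V,V'$ paired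 with the same $U$ intersect, the set is closed under shrinking $U$ and enlarging $V$, and for every real $x\in[0,1]$ and rational $\varepsilon>0$ it contains a pair $(U,V)$ with $x\in U$ and $V$ of length at most $\varepsilon$; $f(x)$ is the real, unique up to equality of reals, lying in the closure of every $V$ with $(U,V)\in f$, $x\in U$. A *Baire 1 function* $f\colon[0,1]\to\mathbb R$ is a sequence $(f_n)$ of total continuous functions that is pointwise Cauchy: for every real $x\in[0,1]$ and rational $\varepsilon>0$, $|f_m(x)-f_n(x)|\le\varepsilon$ for all sufficiently large $m,n$. (The limit need not exist.) Write $f(x)\ge y$ if for every rational $q<y$ one has $f_m(x)>q$ for all sufficiently large $m$; write $f(x)\le y$ if for every rational $q>y$ one has $f_m(x)<q$ for all sufficiently large $m$; and $f(x)>y$ if not $f(x)\le y$. A *Baire 1 gauge* is a Baire 1 function $\delta$ with $\delta(x)>0$ for all $x\in[0,1]$. A *tagged partition* of $[0,1]$ is a finite sequence of reals $\langle x_0,t_0,x_1,\dots,t_{\ell-1},x_\ell\rangle$ with $0=x_0<x_1<\dots<x_\ell=1$ and $x_j\le t_j\le x_{j+1}$ for $j<\ell$. It is *$\delta$-fine*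 if $\delta(t_j)\ge t_j-x_j$ and $\delta(t_j)\ge x_{j+1}-t_j$ for all $j<\ell$. - $\mathsf{CL}_{\mathrm{B1}}$: every Baire 1 gauge on $[0,1]$ has a $\delta$-fine tagged partition. - $\mathsf{SC}$: every Cauchy sequence of reals in $[0,1]$ has a limit in $[0,1]$. - $\mathsf{ACA}_0$: the basic axioms, the induction axiom for sets, and comprehension for all arithmetical formulas. -/

import Mathlib

universe u v

namespace SOA

/-! ## Structures and arithmetical formulas of second-order arithmetic -/

/-- A structure for the two-sorted language of second-order arithmetic: an arbitrary (possibly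
nonstandard) number sort with `0, 1, +, ·, <`, and a collection of subsets of the number sort over
which the set variables range. -/
structure L2Structure where
  Num : Type u
  zero : Num
  one : Num
  add : Num → Num → Num
  mul : Num → Num → Num
  lt : Num → Num → Prop
  sets : Set (Set Num)

/-- Numerical terms; variables are de Bruijn indices. -/
inductive NumTerm : Type
  | var (i : ℕ)
  | zero
  | one
  | add (s t : NumTerm)
  | mul (s t : NumTerm)

/-- Renaming `x_i ↦ x_{i+1}`, so that the new variable `x_0` does not occur in the term. -/
def NumTerm.lift : NumTerm → NumTerm
  | .var i => .var (i + 1)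
  | .zero => .zero
  | .one => .one
  | .add s t => .add s.lift t.lift
  | .mul s t => .mul s.lift t.lift

/-- Arithmetical formulas (no set quantifiers) with set parameters from `σ`; the quantifiers `all`
and `ex` bind the variable `0`. -/
inductive ArithFormula (σ : Type v) : Type v
  | eq (s t : NumTerm)
  | lt (s t : NumTerm)
  | mem (s : NumTerm) (X : σ)
  | neg (φ : ArithFormula σ)
  | and (φ ψ : ArithFormula σ)
  | or (φ ψ : ArithFormula σ)
  | imp (φ ψ : ArithFormula σ)
  | iff (φ ψ : ArithFormula σ)
  | all (φ : ArithFormula σ)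
  | ex (φ : ArithFormula σ)

namespace ArithFormula

/-- `Σ⁰₀` formulas: every quantifier is of the form `∀ x < t` or `∃ x < t`, with `x` not in `t`. -/
inductive IsBounded {σ : Type v} : ArithFormula σ → Prop
  | eq (s t : NumTerm) : IsBounded (.eq s t)
  | lt (s t : NumTerm) : IsBounded (.lt s t)
  | mem (s : NumTerm) (X : σ) : IsBounded (.mem s X)
  | neg {φ : ArithFormula σ} : IsBounded φ → IsBounded (.neg φ)
  | and {φ ψ : ArithFormula σ} : IsBounded φ → IsBounded ψ → IsBounded (.and φ ψ)
  | or {φ ψ : ArithFormula σ} : IsBounded φ → IsBounded ψ → IsBounded (.or φ ψ)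
  | imp {φ ψ : ArithFormula σ} : IsBounded φ → IsBounded ψ → IsBounded (.imp φ ψ)
  | iff {φ ψ : ArithFormula σ} : IsBounded φ → IsBounded ψ → IsBounded (.iff φ ψ)
  | ball (t : NumTerm) {φ : ArithFormula σ} :
      IsBounded φ → IsBounded (.all (.imp (.lt (.var 0) t.lift) φ))
  | bex (t : NumTerm) {φ : ArithFormula σ} :
      IsBounded φ → IsBounded (.ex (.and (.lt (.var 0) t.lift) φ))

/-- `Σ⁰₁` formulas: a block of existential number quantifiers before a `Σ⁰₀` formula. -/
inductive IsSigma1 {σ : Type v} : ArithFormula σ → Prop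
  | bounded {φ : ArithFormula σ} : IsBounded φ → IsSigma1 φ
  | ex {φ : ArithFormula σ} : IsSigma1 φ → IsSigma1 (.ex φ)

/-- `Π⁰₁` formulas: a block of universal number quantifiers before a `Σ⁰₀` formula. -/
inductive IsPi1 {σ : Type v} : ArithFormula σ → Prop
  | bounded {φ : ArithFormula σ} : IsBounded φ → IsPi1 φ
  | all {φ : ArithFormula σ} : IsPi1 φ → IsPi1 (.all φ)

end ArithFormula

/-- The assignment `x_0 ↦ a`, `x_{i+1} ↦ e i`. -/
def scons {α : Type u} (a : α) (e : ℕ → α) : ℕ → α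
  | 0 => a
  | i + 1 => e i

namespace L2Structure

instance (M : L2Structure.{u}) : Zero M.Num := ⟨M.zero⟩
instance (M : L2Structure.{u}) : One M.Num := ⟨M.one⟩
instance (M : L2Structure.{u}) : Add M.Num := ⟨M.add⟩
instance (M : L2Structure.{u}) : Mul M.Num := ⟨M.mul⟩
instance (M : L2Structure.{u}) : LT M.Num := ⟨M.lt⟩
instance (M : L2Structure.{u}) : LE M.Num := ⟨fun a b => a < b ∨ a = b⟩

/-- Value of a term under an assignment. -/
def termVal (M : L2Structure.{u}) (e : ℕ → M.Num) : NumTerm → M.Num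
  | .var i => e i
  | .zero => 0
  | .one => 1
  | .add s t => M.termVal e s + M.termVal e t
  | .mul s t => M.termVal e s * M.termVal e t

/-- Truth in `M` of an arithmetical formula with set parameters from `M`. -/
def Holds (M : L2Structure.{u}) : ArithFormula M.sets → (ℕ → M.Num) → Prop
  | .eq s t, e => M.termVal e s = M.termVal e t
  | .lt s t, e => M.termVal e s < M.termVal e t
  | .mem s X, e => M.termVal e s ∈ X.1
  | .neg φ, e => ¬ M.Holds φ e
  | .and φ ψ, e => M.Holds φ e ∧ M.Holds ψ e
  | .or φ ψ, e => M.Holds φ e ∨ M.Holds ψ e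
  | .imp φ ψ, e => M.Holds φ e → M.Holds ψ e
  | .iff φ ψ, e => M.Holds φ e ↔ M.Holds ψ e
  | .all φ, e => ∀ a : M.Num, M.Holds φ (scons a e)
  | .ex φ, e => ∃ a : M.Num, M.Holds φ (scons a e)

/-! ## The systems `RCA₀` and `ACA₀` -/

/-- The basic axioms of second-order arithmetic. -/
structure BasicAxioms (M : L2Structure.{u}) : Prop where
  succ_ne_zero : ∀ n : M.Num, n + 1 ≠ 0
  succ_inj : ∀ m n : M.Num, m + 1 = n + 1 → m = n
  add_zero : ∀ m : M.Num, m + 0 = m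
  add_succ : ∀ m n : M.Num, m + (n + 1) = (m + n) + 1
  mul_zero : ∀ m : M.Num, m * 0 = 0
  mul_succ : ∀ m n : M.Num, m * (n + 1) = m * n + m
  not_lt_zero : ∀ m : M.Num, ¬ m < 0
  lt_succ : ∀ m n : M.Num, m < n + 1 ↔ (m < n ∨ m = n)

/-- `M` is a model of `RCA₀`: basic axioms, `Σ⁰₁` induction and `Δ⁰₁` comprehension, both with
number and set parameters. -/
structure ModelsRCA0 (M : L2Structure.{u}) : Prop where
  basic : M.BasicAxioms
  sigma1_induction : ∀ φ : ArithFormula M.sets, φ.IsSigma1 → ∀ e : ℕ → M.Num,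
    M.Holds φ (scons 0 e) →
    (∀ n : M.Num, M.Holds φ (scons n e) → M.Holds φ (scons (n + 1) e)) →
    ∀ n : M.Num, M.Holds φ (scons n e)
  delta1_comprehension : ∀ φ ψ : ArithFormula M.sets, φ.IsSigma1 → ψ.IsPi1 → ∀ e : ℕ → M.Num,
    (∀ n : M.Num, M.Holds φ (scons n e) ↔ M.Holds ψ (scons n e)) →
    {n : M.Num | M.Holds φ (scons n e)} ∈ M.sets

/-- `M` is a model of `ACA₀`: basic axioms, the induction axiom for sets and comprehension for all
arithmetical formulas with number and set parameters. -/
structure ModelsACA0 (M : L2Structure.{u}) : Prop where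
  basic : M.BasicAxioms
  induction : ∀ X ∈ M.sets, (0 : M.Num) ∈ X → (∀ n ∈ X, n + 1 ∈ X) → ∀ n, n ∈ X
  arith_comprehension : ∀ (φ : ArithFormula M.sets) (e : ℕ → M.Num),
    {n : M.Num | M.Holds φ (scons n e)} ∈ M.sets

/-! ## Coding in `M`: pairs, functions, integers, rationals -/

/-- The code of the pair `(m, n)`. -/
def pair {M : L2Structure.{u}} (m n : M.Num) : M.Num := (m + n) * (m + n) + m

/-- The `n`-th member of the sequence of sets coded by `Z`. -/
def sect {M : L2Structure.{u}} (Z : Set M.Num) (n : M.Num) : Set M.Num := {m | pair m n ∈ Z}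

/-- `F` is (the graph of) a function `X → Y`. -/
def IsFunction {M : L2Structure.{u}} (F X Y : Set M.Num) : Prop :=
  (∀ c ∈ F, ∃ x ∈ X, ∃ y ∈ Y, c = pair x y) ∧ ∀ x ∈ X, ∃! y, y ∈ Y ∧ pair x y ∈ F

/-- `v = 2 ^ m`: the function `n ↦ 2 ^ n`, given by its recursion equations, sends `m` to `v`. -/
def IsPow2 {M : L2Structure.{u}} (m v : M.Num) : Prop :=
  ∃ E ∈ M.sets, IsFunction E Set.univ Set.univ ∧ pair 0 1 ∈ E ∧
    (∀ n y : M.Num, pair n y ∈ E → pair (n + 1) (y + y) ∈ E) ∧ pair m v ∈ E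

/-- A formal difference `pos - neg`, in no normal form. -/
@[ext]
structure PreInt (M : L2Structure.{u}) where
  pos : M.Num
  neg : M.Num

namespace PreInt

variable {M : L2Structure.{u}}

def code (z : PreInt M) : M.Num := pair z.pos z.neg
def ofNum (n : M.Num) : PreInt M := ⟨n, 0⟩
def add (z w : PreInt M) : PreInt M := ⟨z.pos + w.pos, z.neg + w.neg⟩
def opp (z : PreInt M) : PreInt M := ⟨z.neg, z.pos⟩
def mul (z w : PreInt M) : PreInt M :=
  ⟨z.pos * w.pos + z.neg * w.neg, z.pos * w.neg + z.neg * w.pos⟩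
def Equiv (z w : PreInt M) : Prop := z.pos + w.neg = z.neg + w.pos
def Lt (z w : PreInt M) : Prop := z.pos + w.neg < w.pos + z.neg

/-- `z` is an integer: the pair with the least code in its class. -/
def IsInt (z : PreInt M) : Prop := ∀ w : PreInt M, w.Equiv z → z.code ≤ w.code

end PreInt

/-- A formal fraction, in no normal form. The operations and relations below are meant for fractions
with positive denominator, the only ones that occur. -/
@[ext]
structure PreRat (M : L2Structure.{u}) where
  num : PreInt M
  den : PreInt M

namespace PreRat

variable {M : L2Structure.{u}}

def code (q : PreRat M) : M.Num := pair q.num.code q.den.code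
/-- The fraction `a / b` of two numbers. -/
def ofNums (a b : M.Num) : PreRat M := ⟨.ofNum a, .ofNum b⟩
def add (q r : PreRat M) : PreRat M := ⟨(q.num.mul r.den).add (r.num.mul q.den), q.den.mul r.den⟩
def opp (q : PreRat M) : PreRat M := ⟨q.num.opp, q.den⟩
def sub (q r : PreRat M) : PreRat M := q.add r.opp
def Equiv (q r : PreRat M) : Prop := (q.num.mul r.den).Equiv (q.den.mul r.num)
def Lt (q r : PreRat M) : Prop := (q.num.mul r.den).Lt (r.num.mul q.den)
def Le (q r : PreRat M) : Prop := ¬ r.Lt q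
open Classical in
noncomputable def abs (q : PreRat M) : PreRat M := if q.Lt (ofNums 0 1) then q.opp else q

/-- A fraction of integers with positive denominator. -/
def IsFrac (q : PreRat M) : Prop := q.num.IsInt ∧ q.den.IsInt ∧ (PreInt.ofNum 0).Lt q.den

/-- `q` is a rational number: the fraction with the least code in its class. -/
def IsRat (q : PreRat M) : Prop :=
  q.IsFrac ∧ ∀ r : PreRat M, r.IsFrac → r.Equiv q → q.code ≤ r.code

end PreRat

/-- The rational numbers of `M`. -/
abbrev Rat (M : L2Structure.{u}) := {q : PreRat M // q.IsRat}

/-- The set of codes of rational numbers of `M`. -/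
def ratCodes (M : L2Structure.{u}) : Set M.Num := {c | ∃ q : M.Rat, c = q.1.code}

/-! ## Real numbers of `M` -/

section Reals

variable {M : L2Structure.{u}}

/-- The `k`-th term of the sequence of rationals `A` is `q`. -/
def At (A : Set M.Num) (k : M.Num) (q : M.Rat) : Prop := pair k q.1.code ∈ A

/-- `A` is a real number of `M`: a sequence of rationals with `|q_m - q_n| ≤ 2 ^ (-m)` for
`m ≤ n`. -/
def IsReal (A : Set M.Num) : Prop :=
  A ∈ M.sets ∧ IsFunction A Set.univ M.ratCodes ∧
    ∀ (m n : M.Num) (a b : M.Rat), m ≤ n → At A m a → At A n b →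
      ∃ v, IsPow2 m v ∧ (a.1.sub b.1).abs.Le (.ofNums 1 v)

/-- `A =_ℝ B`: `|a_k - b_k| ≤ 2 ^ (-k+1)` for all `k`. -/
def RealEq (A B : Set M.Num) : Prop :=
  ∀ (k : M.Num) (a b : M.Rat), At A k a → At B k b →
    ∃ v, IsPow2 k v ∧ (a.1.sub b.1).abs.Le (.ofNums (1 + 1) v)

/-- `A ≤_ℝ B`: `a_k ≤ b_k + 2 ^ (-k+1)` for all `k`. -/
def RealLe (A B : Set M.Num) : Prop :=
  ∀ (k : M.Num) (a b : M.Rat), At A k a → At B k b →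
    ∃ v, IsPow2 k v ∧ a.1.Le (b.1.add (.ofNums (1 + 1) v))

def RealLt (A B : Set M.Num) : Prop := ¬ RealLe B A

/-- A rational as a constant sequence. -/
def constReal (q : PreRat M) : Set M.Num :=
  {c | ∃ (k : M.Num) (a : M.Rat), a.1.Equiv q ∧ c = pair k a.1.code}

/-- Subtraction of reals; the terms are taken at `k + 1` to keep the rate of convergence. -/
def realSub (A B : Set M.Num) : Set M.Num :=
  {c | ∃ (k : M.Num) (a b d : M.Rat), At A (k + 1) a ∧ At B (k + 1) b ∧
    d.1.Equiv (a.1.sub b.1) ∧ c = pair k d.1.code}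

def realAbs (A : Set M.Num) : Set M.Num :=
  {c | ∃ (k : M.Num) (a d : M.Rat), At A k a ∧ d.1.Equiv a.1.abs ∧ c = pair k d.1.code}

/-- `|A - B| ≤ ε` for reals `A, B` and a rational `ε`. -/
def DistLe (A B : Set M.Num) (ε : M.Rat) : Prop :=
  RealLe (realAbs (realSub A B)) (constReal ε.1)

def RatPos (ε : M.Rat) : Prop := (PreRat.ofNums 0 1).Lt ε.1

/-- `A` is a real number of `M` in `[0,1]`. -/
def InUnit (A : Set M.Num) : Prop :=
  IsReal A ∧ RealLe (constReal (.ofNums 0 1)) A ∧ RealLe A (constReal (.ofNums 1 1))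

/-! ## Codes of continuous functions on `[0,1]` -/

/-- `(p, q)` codes a nonempty interval `U = (p,q) ∩ [0,1]`: `max p 0 < min q 1`. -/
def UnitInterval (p q : M.Rat) : Prop :=
  p.1.Lt q.1 ∧ p.1.Lt (.ofNums 1 1) ∧ (PreRat.ofNums 0 1).Lt q.1

/-- `(p',q') ∩ [0,1] ⊆ (p,q) ∩ [0,1]`. -/
def UnitIntervalSub (p' q' p q : M.Rat) : Prop :=
  (p.1.Lt (.ofNums 0 1) ∨ p.1.Le p'.1) ∧ ((PreRat.ofNums 1 1).Lt q.1 ∨ q'.1.Le q.1)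

/-- `x ∈ (p,q) ∩ [0,1]`. -/
def InInterval (x : Set M.Num) (p q : M.Rat) : Prop :=
  InUnit x ∧ RealLt (constReal p.1) x ∧ RealLt x (constReal q.1)

/-- Code of the pair `(U, V)` with `U = (p,q) ∩ [0,1]` and `V = (r,s)`. -/
def boxCode (p q r s : M.Rat) : M.Num :=
  pair (pair p.1.code q.1.code) (pair r.1.code s.1.code)

/-- `F` codes a partial continuous function `[0,1] → ℝ`: a set of pairs `(U, V)`, to be read as
`f(U) ⊆ V`, such that all `V` for one `U` meet, and closed under shrinking `U` and enlarging `V`. -/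
structure IsContinuous (F : Set M.Num) : Prop where
  mem_sets : F ∈ M.sets
  codes : ∀ c ∈ F, ∃ p q r s : M.Rat, UnitInterval p q ∧ r.1.Lt s.1 ∧ c = boxCode p q r s
  consistent : ∀ p q r s r' s' : M.Rat, boxCode p q r s ∈ F → boxCode p q r' s' ∈ F →
    r.1.Lt s'.1 ∧ r'.1.Lt s.1
  shrink : ∀ p q r s p' q' : M.Rat, boxCode p q r s ∈ F → UnitInterval p' q' →
    UnitIntervalSub p' q' p q → boxCode p' q' r s ∈ F
  enlarge : ∀ p q r s r' s' : M.Rat, boxCode p q r s ∈ F → r'.1.Lt s'.1 →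
    r'.1.Le r.1 → s.1.Le s'.1 → boxCode p q r' s' ∈ F

/-- Every real of `M` in `[0,1]` is in the domain of `F`. -/
def IsTotal (F : Set M.Num) : Prop :=
  ∀ x : Set M.Num, InUnit x → ∀ ε : M.Rat, RatPos ε →
    ∃ p q r s : M.Rat, boxCode p q r s ∈ F ∧ InInterval x p q ∧ (s.1.sub r.1).Le ε.1

/-- `y = f(x)`, where `f` is coded by `F`: the real `y` lies in the closure of every `V` with
`(U, V) ∈ F` and `x ∈ U`. For `x` in the domain this determines `y` up to `=_ℝ`. -/
def IsValue (F x y : Set M.Num) : Prop :=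
  IsReal y ∧ ∀ p q r s : M.Rat, boxCode p q r s ∈ F → InInterval x p q →
    RealLe (constReal r.1) y ∧ RealLe y (constReal s.1)

/-! ## Baire 1 functions, gauges and partitions -/

/-- `D` codes a Baire 1 function: a sequence of total continuous functions that is pointwise
Cauchy. -/
structure IsBaire1 (D : Set M.Num) : Prop where
  mem_sets : D ∈ M.sets
  continuous : ∀ n : M.Num, IsContinuous (sect D n)
  total : ∀ n : M.Num, IsTotal (sect D n)
  cauchy : ∀ x : Set M.Num, InUnit x → ∀ ε : M.Rat, RatPos ε →
    ∃ N : M.Num, ∀ m n : M.Num, N ≤ m → N ≤ n →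
      ∃ y z : Set M.Num, IsValue (sect D m) x y ∧ IsValue (sect D n) x z ∧ DistLe y z ε

/-- `f(x) ≥ y`: for every rational `q < y`, `f_m(x) > q` for all sufficiently large `m`. -/
def Baire1Ge (D x y : Set M.Num) : Prop :=
  ∀ q : M.Rat, RealLt (constReal q.1) y → ∃ N : M.Num, ∀ m : M.Num, N ≤ m →
    ∃ w : Set M.Num, IsValue (sect D m) x w ∧ RealLt (constReal q.1) w

/-- `f(x) ≤ y`: for every rational `q > y`, `f_m(x) < q` for all sufficiently large `m`. -/
def Baire1Le (D x y : Set M.Num) : Prop :=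
  ∀ q : M.Rat, RealLt y (constReal q.1) → ∃ N : M.Num, ∀ m : M.Num, N ≤ m →
    ∃ w : Set M.Num, IsValue (sect D m) x w ∧ RealLt w (constReal q.1)

/-- `f(x) > 0`, that is, not `f(x) ≤ 0`, for all `x ∈ [0,1]`. -/
def IsGauge (D : Set M.Num) : Prop :=
  ∀ x : Set M.Num, InUnit x → ¬ Baire1Le D x (constReal (.ofNums 0 1))

/-- The partition point `x_j` of the finite sequence of reals `x_0, t_0, x_1, …, t_{ℓ-1}, x_ℓ`
coded by `P`. -/
def node (P : Set M.Num) (j : M.Num) : Set M.Num := sect P (j + j)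

/-- The tag `t_j` of the finite sequence of reals coded by `P`. -/
def tag (P : Set M.Num) (j : M.Num) : Set M.Num := sect P (j + j + 1)

/-- `P` codes a tagged partition of `[0,1]` of size `ℓ` (a number of `M`): reals with
`0 = x_0 < x_1 < ⋯ < x_ℓ = 1` and `x_j ≤ t_j ≤ x_{j+1}`. -/
structure IsTaggedPartition (P : Set M.Num) (ℓ : M.Num) : Prop where
  mem_sets : P ∈ M.sets
  real : ∀ i : M.Num, i ≤ ℓ + ℓ → IsReal (sect P i)
  first : RealEq (node P 0) (constReal (.ofNums 0 1))
  last : RealEq (node P ℓ) (constReal (.ofNums 1 1))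
  lt : ∀ j : M.Num, j < ℓ → RealLt (node P j) (node P (j + 1))
  le_tag : ∀ j : M.Num, j < ℓ → RealLe (node P j) (tag P j)
  tag_le : ∀ j : M.Num, j < ℓ → RealLe (tag P j) (node P (j + 1))

/-- The partition is `δ`-fine: `δ(t_j) ≥ t_j - x_j` and `δ(t_j) ≥ x_{j+1} - t_j` for all
`j < ℓ`. -/
def IsFine (D P : Set M.Num) (ℓ : M.Num) : Prop :=
  ∀ j : M.Num, j < ℓ →
    Baire1Ge D (tag P j) (realSub (tag P j) (node P j)) ∧
    Baire1Ge D (tag P j) (realSub (node P (j + 1)) (tag P j))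

end Reals

/-! ## The two principles -/

/-- `M` satisfies Cousin's lemma for Baire 1 functions. -/
def CousinBaire1 (M : L2Structure.{u}) : Prop :=
  ∀ D : Set M.Num, IsBaire1 D → IsGauge D →
    ∃ (P : Set M.Num) (ℓ : M.Num), IsTaggedPartition P ℓ ∧ IsFine D P ℓ

/-- `M` satisfies sequential completeness: every Cauchy sequence of reals in `[0,1]` has a limit
in `[0,1]`. -/
def SeqComplete (M : L2Structure.{u}) : Prop :=
  ∀ Z ∈ M.sets, (∀ n : M.Num, InUnit (sect Z n)) →
    (∀ ε : M.Rat, RatPos ε → ∃ N : M.Num, ∀ m n : M.Num, N ≤ m → N ≤ n →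
      DistLe (sect Z m) (sect Z n) ε) →
    ∃ z : Set M.Num, InUnit z ∧ ∀ ε : M.Rat, RatPos ε → ∃ N : M.Num, ∀ n : M.Num, N ≤ n →
      DistLe (sect Z n) z ε

end L2Structure

end SOA

set_option linter.unusedSectionVars false

namespace SOA

/-! ## Renaming of variables -/

/-! Everything reduces to one claim, `isSet_range`: for each set Θ of the model, the range A = {k |
∃ m, (k, m) ∈ Θ} is again a set of the model. Every Σ⁰₁ class is such a range, so Σ⁰₁ comprehension
follows. Arithmetical formulas then become Σ⁰₁ in set parameters by induction on the formula, and a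
Cauchy sequence of reals acquires a modulus of convergence, from which its limit is computed.

For the claim, let a_n be the n-digit binary fraction whose digit at place k is 1 when k is
enumerated by Θ before stage n. These fractions increase and stay below 1. They form a Cauchy
sequence, because too many increments of size ε would lead past 1 (`exists_forall_apx_le`). If k ≤ n
is enumerated only after stage n, then some later a_m is at least a_n + 2^(-k-1) (`apx_add_eps_le`).
Hence a real limit of a_n would compute A (`isSet_range_of_limit`), but such a limit need not exist
in the model.

Put δ_n(x) = |x - a_n| / 2. These functions are continuous and pointwise Cauchy, so they form a
Baire 1 function δ. If δ(x) ≤ 0 for some x, then a_n converges to x and A exists. Suppose that A is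
not a set. Then δ is a gauge, and Cousin's lemma gives a δ-fine partition. The factor 1/2 makes a
subinterval with tag t too short to reach from t past the virtual limit of a_n. More precisely,
suppose that some a_n exceeds x_j but none exceeds x_{j+1}. Fineness says that t - x_j and x_{j+1} -
t are both at most |t - a_m| / 2, up to an error that vanishes for large m. If t ≥ a_m, the first
bound contradicts a_m > x_j. If t < a_m, the second one forces a_m - t to be tiny, and then the
first one contradicts a_m > x_j again. So "some a_n exceeds x_j" passes from j to j + 1
(`exists_node_succ_lt_apx`). It holds at x_0 = 0, since otherwise all a_n vanish and converge to
x_0. By Σ⁰₁ induction it holds at x_ℓ = 1, contradicting a_n < 1.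

The model may be nonstandard, so its arithmetic is developed inside it. Its numbers embed in an
ordered field `Fr M`, where estimates are ordinary linear arithmetic; powers of two come from coded
computations. Whether a predicate is Σ⁰₀ or Σ⁰₁ is found by instance search over `DefTerm`, `DefBdd`
and `DefSig`. -/

/-- The renaming `ρ` under a quantifier. -/
def upRen (ρ : ℕ → ℕ) : ℕ → ℕ
  | 0 => 0
  | i + 1 => ρ i + 1

def NumTerm.rename (ρ : ℕ → ℕ) : NumTerm → NumTerm
  | .var i => .var (ρ i)
  | .zero => .zero
  | .one => .one
  | .add s t => .add (s.rename ρ) (t.rename ρ)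
  | .mul s t => .mul (s.rename ρ) (t.rename ρ)

/-- Needed because `IsBounded` asks for bounds of the syntactic form `t.lift`; renaming under the
quantifier preserves that form. -/
theorem NumTerm.rename_lift (ρ : ℕ → ℕ) (t : NumTerm) :
    t.lift.rename (upRen ρ) = (t.rename ρ).lift := by
  induction t <;> simp_all [NumTerm.lift, NumTerm.rename, upRen]

namespace ArithFormula

variable {σ : Type v}

def rename : (ℕ → ℕ) → ArithFormula σ → ArithFormula σ
  | ρ, .eq s t => .eq (s.rename ρ) (t.rename ρ)
  | ρ, .lt s t => .lt (s.rename ρ) (t.rename ρ)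
  | ρ, .mem s X => .mem (s.rename ρ) X
  | ρ, .neg φ => .neg (φ.rename ρ)
  | ρ, .and φ ψ => .and (φ.rename ρ) (ψ.rename ρ)
  | ρ, .or φ ψ => .or (φ.rename ρ) (ψ.rename ρ)
  | ρ, .imp φ ψ => .imp (φ.rename ρ) (ψ.rename ρ)
  | ρ, .iff φ ψ => .iff (φ.rename ρ) (ψ.rename ρ)
  | ρ, .all φ => .all (φ.rename (upRen ρ))
  | ρ, .ex φ => .ex (φ.rename (upRen ρ))

theorem IsBounded.rename {φ : ArithFormula σ} (h : φ.IsBounded) (ρ : ℕ → ℕ) :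
    (φ.rename ρ).IsBounded := by
  induction h generalizing ρ with
  | eq s t => exact .eq _ _
  | lt s t => exact .lt _ _
  | mem s X => exact .mem _ _
  | neg _ ih => exact .neg (ih ρ)
  | and _ _ ih₁ ih₂ => exact .and (ih₁ ρ) (ih₂ ρ)
  | or _ _ ih₁ ih₂ => exact .or (ih₁ ρ) (ih₂ ρ)
  | imp _ _ ih₁ ih₂ => exact .imp (ih₁ ρ) (ih₂ ρ)
  | iff _ _ ih₁ ih₂ => exact .iff (ih₁ ρ) (ih₂ ρ)
  | ball t _ ih =>
    simp only [ArithFormula.rename, NumTerm.rename_lift]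
    exact .ball _ (ih _)
  | bex t _ ih =>
    simp only [ArithFormula.rename, NumTerm.rename_lift]
    exact .bex _ (ih _)

theorem IsSigma1.rename {φ : ArithFormula σ} (h : φ.IsSigma1) (ρ : ℕ → ℕ) :
    (φ.rename ρ).IsSigma1 := by
  induction h generalizing ρ with
  | bounded h => exact .bounded (h.rename ρ)
  | ex _ ih => exact .ex (ih _)

end ArithFormula

namespace L2Structure

variable {M : L2Structure.{u}}

theorem termVal_rename (ρ : ℕ → ℕ) (t : NumTerm) (e : ℕ → M.Num) :
    M.termVal e (t.rename ρ) = M.termVal (e ∘ ρ) t := by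
  induction t <;> simp_all [NumTerm.rename, termVal]

theorem termVal_lift (t : NumTerm) (a : M.Num) (e : ℕ → M.Num) :
    M.termVal (scons a e) t.lift = M.termVal e t := by
  induction t <;> simp_all [NumTerm.lift, termVal, scons]

theorem scons_comp_upRen (ρ : ℕ → ℕ) (a : M.Num) (e : ℕ → M.Num) :
    scons a e ∘ upRen ρ = scons a (e ∘ ρ) := by
  funext i
  cases i <;> rfl

theorem holds_rename (ρ : ℕ → ℕ) (φ : ArithFormula M.sets) (e : ℕ → M.Num) :
    M.Holds (φ.rename ρ) e ↔ M.Holds φ (e ∘ ρ) := by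
  induction φ generalizing ρ e <;>
    simp_all [ArithFormula.rename, Holds, termVal_rename, scons_comp_upRen]

theorem holds_rename_succ (φ : ArithFormula M.sets) (a : M.Num) (e : ℕ → M.Num) :
    M.Holds (φ.rename Nat.succ) (scons a e) ↔ M.Holds φ e :=
  holds_rename _ _ _

/-- Prenex form: the existential block of one conjunct is pulled out first, then that of the other,
renaming the passive conjunct each time. -/
theorem exists_sigma1_and {φ ψ : ArithFormula M.sets} (hφ : φ.IsSigma1) (hψ : ψ.IsSigma1) :
    ∃ χ : ArithFormula M.sets, χ.IsSigma1 ∧ ∀ e, M.Holds χ e ↔ M.Holds φ e ∧ M.Holds ψ e := by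
  induction hφ generalizing ψ with
  | bounded hφ =>
    rename_i φ
    induction hψ generalizing φ with
    | bounded hψ => exact ⟨_, .bounded (.and hφ hψ), fun e => Iff.rfl⟩
    | ex hψ ih =>
      obtain ⟨χ, hχ, h⟩ := ih (hφ.rename Nat.succ)
      exact ⟨_, .ex hχ, fun e => by simp [Holds, h, holds_rename_succ]⟩
  | ex hφ ih =>
    obtain ⟨χ, hχ, h⟩ := ih (hψ.rename Nat.succ)
    exact ⟨_, .ex hχ, fun e => by simp [Holds, h, holds_rename_succ]⟩

theorem exists_sigma1_or {φ ψ : ArithFormula M.sets} (hφ : φ.IsSigma1) (hψ : ψ.IsSigma1) :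
    ∃ χ : ArithFormula M.sets, χ.IsSigma1 ∧ ∀ e, M.Holds χ e ↔ M.Holds φ e ∨ M.Holds ψ e := by
  -- Moving `∃` across a disjunct without the bound variable requires a nonempty domain.
  have : Nonempty M.Num := ⟨0⟩
  induction hφ generalizing ψ with
  | bounded hφ =>
    rename_i φ
    induction hψ generalizing φ with
    | bounded hψ => exact ⟨_, .bounded (.or hφ hψ), fun e => Iff.rfl⟩
    | ex hψ ih =>
      obtain ⟨χ, hχ, h⟩ := ih (hφ.rename Nat.succ)
      exact ⟨_, .ex hχ, fun e => by simp [Holds, h, holds_rename_succ, exists_or]⟩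
  | ex hφ ih =>
    obtain ⟨χ, hχ, h⟩ := ih (hψ.rename Nat.succ)
    exact ⟨_, .ex hχ, fun e => by simp [Holds, h, holds_rename_succ, exists_or]⟩

theorem exists_pi1_neg {φ : ArithFormula M.sets} (hφ : φ.IsSigma1) :
    ∃ χ : ArithFormula M.sets, χ.IsPi1 ∧ ∀ e, M.Holds χ e ↔ ¬ M.Holds φ e := by
  induction hφ with
  | bounded hφ => exact ⟨_, .bounded (.neg hφ), fun e => Iff.rfl⟩
  | ex hφ ih =>
    obtain ⟨χ, hχ, h⟩ := ih
    exact ⟨_, .all hχ, fun e => by simp [Holds, h]⟩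

/-! ## Definability with parameters -/

/-- The assignment which interleaves the variables `e` and the parameters `p`. -/
def mix (e p : ℕ → M.Num) : ℕ → M.Num := Sum.elim e p ∘ Equiv.natSumNatEquivNat.symm

/-- Two formulas with separate parameter lists can be read over one list, by interleaving the lists
and renaming. All binary closure properties of definability use this. -/
theorem exists_mix_comp_eq (p₁ p₂ : ℕ → M.Num) : ∃ (p : ℕ → M.Num) (ρ₁ ρ₂ : ℕ → ℕ),
    ∀ e, mix e p ∘ ρ₁ = mix e p₁ ∧ mix e p ∘ ρ₂ = mix e p₂ := by
  let q := Equiv.natSumNatEquivNat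
  refine ⟨mix p₁ p₂, q ∘ Sum.map id (q ∘ Sum.inl) ∘ q.symm, q ∘ Sum.map id (q ∘ Sum.inr) ∘ q.symm,
    fun e => ⟨?_, ?_⟩⟩ <;> funext i <;> obtain ⟨j | j, rfl⟩ := q.surjective i <;>
    simp only [mix, Function.comp_apply, q, Equiv.symm_apply_apply, Sum.map_inl, Sum.map_inr,
      Sum.elim_inl, Sum.elim_inr, id]

/-- Used under a quantifier: the bound variable has to enter the variable half of the assignment and
leave the parameter half alone. -/
theorem exists_scons_mix_comp_eq : ∃ ρ : ℕ → ℕ, ∀ (a : M.Num) (e p : ℕ → M.Num),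
    scons a (mix e p) ∘ ρ = mix (scons a e) p := by
  let q := Equiv.natSumNatEquivNat
  refine ⟨Sum.elim (upRen (q ∘ Sum.inl)) (fun j => q (.inr j) + 1) ∘ q.symm, fun a e p => ?_⟩
  funext i
  obtain ⟨j | j, rfl⟩ := q.surjective i
  · cases j <;> simp [mix, q, upRen, scons]
  · simp [mix, q, scons]

theorem exists_mix_comp_eq_comp (ρ : ℕ → ℕ) : ∃ ρ' : ℕ → ℕ, ∀ e p : ℕ → M.Num,
    mix e p ∘ ρ' = mix (e ∘ ρ) p := by
  let q := Equiv.natSumNatEquivNat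
  refine ⟨q ∘ Sum.map ρ id ∘ q.symm, fun e p => ?_⟩
  funext i
  obtain ⟨j | j, rfl⟩ := q.surjective i <;> simp [mix, q]

/-- `t` is the value of a term with number parameters. -/
class DefTerm (t : (ℕ → M.Num) → M.Num) : Prop where
  out : ∃ (s : NumTerm) (p : ℕ → M.Num), ∀ e, M.termVal (mix e p) s = t e

/-- `P` is defined by a `Σ⁰₀` formula with parameters. -/
class DefBdd (P : (ℕ → M.Num) → Prop) : Prop where
  out : ∃ φ : ArithFormula M.sets, φ.IsBounded ∧ ∃ p : ℕ → M.Num, ∀ e, M.Holds φ (mix e p) ↔ P e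

/-- `P` is defined by a `Σ⁰₁` formula with parameters. -/
class DefSig (P : (ℕ → M.Num) → Prop) : Prop where
  out : ∃ φ : ArithFormula M.sets, φ.IsSigma1 ∧ ∃ p : ℕ → M.Num, ∀ e, M.Holds φ (mix e p) ↔ P e

/-- `X` is a set of the structure. -/
class IsSet (X : Set M.Num) : Prop where
  mem : X ∈ M.sets

namespace DefTerm

instance var (i : ℕ) : DefTerm (fun e : ℕ → M.Num => e i) :=
  ⟨.var (Equiv.natSumNatEquivNat (.inl i)), fun _ => 0, fun e => by simp [termVal, mix]⟩

instance const (a : M.Num) : DefTerm (fun _ : ℕ → M.Num => a) :=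
  ⟨.var (Equiv.natSumNatEquivNat (.inr 0)), fun _ => a, fun e => by simp [termVal, mix]⟩

theorem exists_common (t s : (ℕ → M.Num) → M.Num) [ht : DefTerm t] [hs : DefTerm s] :
    ∃ (t' s' : NumTerm) (p : ℕ → M.Num), ∀ e,
      M.termVal (mix e p) t' = t e ∧ M.termVal (mix e p) s' = s e := by
  obtain ⟨⟨t', p₁, h₁⟩⟩ := ht
  obtain ⟨⟨s', p₂, h₂⟩⟩ := hs
  obtain ⟨p, ρ₁, ρ₂, h⟩ := exists_mix_comp_eq p₁ p₂
  exact ⟨t'.rename ρ₁, s'.rename ρ₂, p, fun e => by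
    simp [termVal_rename, (h e).1, (h e).2, h₁, h₂]⟩

instance add (t s : (ℕ → M.Num) → M.Num) [DefTerm t] [DefTerm s] :
    DefTerm (fun e => t e + s e) := by
  obtain ⟨t', s', p, h⟩ := exists_common t s
  exact ⟨.add t' s', p, fun e => by simp [termVal, h]⟩

instance mul (t s : (ℕ → M.Num) → M.Num) [DefTerm t] [DefTerm s] :
    DefTerm (fun e => t e * s e) := by
  obtain ⟨t', s', p, h⟩ := exists_common t s
  exact ⟨.mul t' s', p, fun e => by simp [termVal, h]⟩

instance pair (t s : (ℕ → M.Num) → M.Num) [DefTerm t] [DefTerm s] :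
    DefTerm (fun e => pair (t e) (s e)) :=
  inferInstanceAs (DefTerm (fun e => (t e + s e) * (t e + s e) + t e))

/-- Serves the shifts `fun i => e (i + 1)` that the quantifier instances create. -/
instance (priority := 900) rename (t : (ℕ → M.Num) → M.Num) [ht : DefTerm t] (ρ : ℕ → ℕ) :
    DefTerm (fun e => t (fun i => e (ρ i))) := by
  obtain ⟨⟨t', p, h⟩⟩ := ht
  obtain ⟨ρ', h'⟩ := exists_mix_comp_eq_comp (M := M) ρ
  exact ⟨t'.rename ρ', p, fun e => by rw [termVal_rename, h', h]; rfl⟩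

end DefTerm

namespace DefBdd

theorem exists_common (P Q : (ℕ → M.Num) → Prop) [hP : DefBdd P] [hQ : DefBdd Q] :
    ∃ φ ψ : ArithFormula M.sets, φ.IsBounded ∧ ψ.IsBounded ∧ ∃ p : ℕ → M.Num, ∀ e,
      (M.Holds φ (mix e p) ↔ P e) ∧ (M.Holds ψ (mix e p) ↔ Q e) := by
  obtain ⟨⟨φ, hφ, p₁, h₁⟩⟩ := hP
  obtain ⟨⟨ψ, hψ, p₂, h₂⟩⟩ := hQ
  obtain ⟨p, ρ₁, ρ₂, h⟩ := exists_mix_comp_eq p₁ p₂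
  exact ⟨φ.rename ρ₁, ψ.rename ρ₂, hφ.rename _, hψ.rename _, p, fun e => by
    simp [holds_rename, (h e).1, (h e).2, h₁, h₂]⟩

variable (P Q : (ℕ → M.Num) → Prop) (t s : (ℕ → M.Num) → M.Num)

instance eq [DefTerm t] [DefTerm s] : DefBdd (fun e => t e = s e) := by
  obtain ⟨t', s', p, h⟩ := DefTerm.exists_common t s
  exact ⟨.eq t' s', .eq _ _, p, fun e => by simp [Holds, h]⟩

instance lt [DefTerm t] [DefTerm s] : DefBdd (fun e => t e < s e) := by
  obtain ⟨t', s', p, h⟩ := DefTerm.exists_common t s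
  exact ⟨.lt t' s', .lt _ _, p, fun e => by simp [Holds, h]⟩

instance mem (X : Set M.Num) [hX : IsSet X] [ht : DefTerm t] : DefBdd (fun e => t e ∈ X) := by
  obtain ⟨⟨t', p, h⟩⟩ := ht
  exact ⟨.mem t' ⟨X, hX.mem⟩, .mem _ _, p, fun e => by simp [Holds, h]⟩

instance and [DefBdd P] [DefBdd Q] : DefBdd (fun e => P e ∧ Q e) := by
  obtain ⟨φ, ψ, hφ, hψ, p, h⟩ := exists_common P Q
  exact ⟨_, .and hφ hψ, p, fun e => by simp [Holds, h]⟩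

instance or [DefBdd P] [DefBdd Q] : DefBdd (fun e => P e ∨ Q e) := by
  obtain ⟨φ, ψ, hφ, hψ, p, h⟩ := exists_common P Q
  exact ⟨_, .or hφ hψ, p, fun e => by simp [Holds, h]⟩

instance imp [DefBdd P] [DefBdd Q] : DefBdd (fun e => P e → Q e) := by
  obtain ⟨φ, ψ, hφ, hψ, p, h⟩ := exists_common P Q
  exact ⟨_, .imp hφ hψ, p, fun e => by simp [Holds, h]⟩

instance iff [DefBdd P] [DefBdd Q] : DefBdd (fun e => P e ↔ Q e) := by
  obtain ⟨φ, ψ, hφ, hψ, p, h⟩ := exists_common P Q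
  exact ⟨_, .iff hφ hψ, p, fun e => by simp [Holds, h]⟩

instance le [DefTerm t] [DefTerm s] : DefBdd (fun e => t e ≤ s e) :=
  inferInstanceAs (DefBdd (fun e => t e < s e ∨ t e = s e))

instance (priority := 900) const (p : Prop) : DefBdd (fun _ : ℕ → M.Num => p) := by
  by_cases hp : p
  · refine ⟨.eq .zero .zero, .eq _ _, fun _ => 0, fun e => by simp [Holds, hp]⟩
  · refine ⟨.neg (.eq .zero .zero), .neg (.eq _ _), fun _ => 0, fun e => by simp [Holds, hp]⟩

instance ball [ht : DefTerm t] (R : M.Num → (ℕ → M.Num) → Prop)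
    [hR : DefBdd (fun e => R (e 0) (fun i => e (i + 1)))] :
    DefBdd (fun e => ∀ a, a < t e → R a e) := by
  obtain ⟨ρ, hρ⟩ := exists_scons_mix_comp_eq (M := M)
  obtain ⟨⟨φ, hφ, p₁, h₁⟩⟩ := hR
  obtain ⟨⟨t', p₂, h₂⟩⟩ := ht
  obtain ⟨p, ρ₁, ρ₂, h⟩ := exists_mix_comp_eq p₁ p₂
  refine ⟨.all (.imp (.lt (.var 0) (t'.rename ρ₂).lift) ((φ.rename ρ₁).rename ρ)),
    .ball _ ((hφ.rename _).rename _), p, fun e => ?_⟩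
  simp only [Holds, termVal, holds_rename, termVal_lift, termVal_rename, hρ, (h _).1, (h _).2, h₁,
    h₂, scons]

instance bex [ht : DefTerm t] (R : M.Num → (ℕ → M.Num) → Prop)
    [hR : DefBdd (fun e => R (e 0) (fun i => e (i + 1)))] :
    DefBdd (fun e => ∃ a, a < t e ∧ R a e) := by
  obtain ⟨ρ, hρ⟩ := exists_scons_mix_comp_eq (M := M)
  obtain ⟨⟨φ, hφ, p₁, h₁⟩⟩ := hR
  obtain ⟨⟨t', p₂, h₂⟩⟩ := ht
  obtain ⟨p, ρ₁, ρ₂, h⟩ := exists_mix_comp_eq p₁ p₂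
  refine ⟨.ex (.and (.lt (.var 0) (t'.rename ρ₂).lift) ((φ.rename ρ₁).rename ρ)),
    .bex _ ((hφ.rename _).rename _), p, fun e => ?_⟩
  simp only [Holds, termVal, holds_rename, termVal_lift, termVal_rename, hρ, (h _).1, (h _).2, h₁,
    h₂, scons]

instance (priority := 400) rename (P : (ℕ → M.Num) → Prop) [hP : DefBdd P] (ρ : ℕ → ℕ) :
    DefBdd (fun e => P (fun i => e (ρ i))) := by
  obtain ⟨⟨φ, hφ, p, h⟩⟩ := hP
  obtain ⟨ρ', h'⟩ := exists_mix_comp_eq_comp (M := M) ρ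
  exact ⟨φ.rename ρ', hφ.rename _, p, fun e => by rw [holds_rename, h', h]; rfl⟩

theorem of_iff {P Q : (ℕ → M.Num) → Prop} [hQ : DefBdd Q] (h : ∀ e, P e ↔ Q e) : DefBdd P := by
  rwa [funext fun e => propext (h e)]

end DefBdd

namespace DefSig

variable (P Q : (ℕ → M.Num) → Prop)

instance (priority := 500) of_bdd [hP : DefBdd P] : DefSig P := by
  obtain ⟨⟨φ, hφ, h⟩⟩ := hP
  exact ⟨φ, .bounded hφ, h⟩

theorem exists_common [hP : DefSig P] [hQ : DefSig Q] :
    ∃ φ ψ : ArithFormula M.sets, φ.IsSigma1 ∧ ψ.IsSigma1 ∧ ∃ p : ℕ → M.Num, ∀ e,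
      (M.Holds φ (mix e p) ↔ P e) ∧ (M.Holds ψ (mix e p) ↔ Q e) := by
  obtain ⟨⟨φ, hφ, p₁, h₁⟩⟩ := hP
  obtain ⟨⟨ψ, hψ, p₂, h₂⟩⟩ := hQ
  obtain ⟨p, ρ₁, ρ₂, h⟩ := exists_mix_comp_eq p₁ p₂
  exact ⟨φ.rename ρ₁, ψ.rename ρ₂, hφ.rename _, hψ.rename _, p, fun e => by
    simp [holds_rename, (h e).1, (h e).2, h₁, h₂]⟩

instance and [DefSig P] [DefSig Q] : DefSig (fun e => P e ∧ Q e) := by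
  obtain ⟨φ, ψ, hφ, hψ, p, h⟩ := exists_common P Q
  obtain ⟨χ, hχ, h'⟩ := exists_sigma1_and hφ hψ
  exact ⟨χ, hχ, p, fun e => by simp [h', h]⟩

instance or [DefSig P] [DefSig Q] : DefSig (fun e => P e ∨ Q e) := by
  obtain ⟨φ, ψ, hφ, hψ, p, h⟩ := exists_common P Q
  obtain ⟨χ, hχ, h'⟩ := exists_sigma1_or hφ hψ
  exact ⟨χ, hχ, p, fun e => by simp [h', h]⟩

instance ex (R : M.Num → (ℕ → M.Num) → Prop)
    [hR : DefSig (fun e => R (e 0) (fun i => e (i + 1)))] : DefSig (fun e => ∃ a, R a e) := by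
  obtain ⟨ρ, hρ⟩ := exists_scons_mix_comp_eq (M := M)
  obtain ⟨⟨φ, hφ, p, h⟩⟩ := hR
  exact ⟨.ex (φ.rename ρ), .ex (hφ.rename _), p, fun e => by
    simp [Holds, holds_rename, hρ, h, scons]⟩

theorem of_iff {P Q : (ℕ → M.Num) → Prop} [hQ : DefSig Q] (h : ∀ e, P e ↔ Q e) : DefSig P := by
  rwa [funext fun e => propext (h e)]

theorem rename (P : (ℕ → M.Num) → Prop) [hP : DefSig P] (ρ : ℕ → ℕ) :
    DefSig (fun e => P (fun i => e (ρ i))) := by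
  obtain ⟨⟨φ, hφ, p, h⟩⟩ := hP
  obtain ⟨ρ', h'⟩ := exists_mix_comp_eq_comp (M := M) ρ
  exact ⟨φ.rename ρ', hφ.rename _, p, fun e => by rw [holds_rename, h', h]; rfl⟩

end DefSig

/-! ## Induction and comprehension for definable predicates -/

theorem exists_holds_scons (P : M.Num → Prop) [hP : DefSig (fun e => P (e 0))] :
    ∃ φ : ArithFormula M.sets, φ.IsSigma1 ∧ ∃ e : ℕ → M.Num, ∀ n, M.Holds φ (scons n e) ↔ P n := by
  obtain ⟨ρ, hρ⟩ := exists_scons_mix_comp_eq (M := M)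
  obtain ⟨⟨φ, hφ, p, h⟩⟩ := hP
  exact ⟨φ.rename ρ, hφ.rename _, mix (fun _ => 0) p, fun n => by
    simp [holds_rename, hρ, h, scons]⟩

variable [hM : Fact M.ModelsRCA0]

/-- The form of Σ⁰₁ induction used throughout. The motive has to be phrased so that instance search
recognizes it as Σ⁰₁, which explains the shape of many later induction hypotheses. -/
theorem induction_on (P : M.Num → Prop) [DefSig (fun e => P (e 0))] (n : M.Num) (zero : P 0)
    (succ : ∀ n, P n → P (n + 1)) : P n := by
  obtain ⟨φ, hφ, e, h⟩ := exists_holds_scons P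
  exact (h n).1 (hM.out.sigma1_induction φ hφ e ((h 0).2 zero)
    (fun n hn => (h _).2 (succ n ((h n).1 hn))) n)

/-- Δ⁰₁ comprehension, with the Π⁰₁ side supplied as a Σ⁰₁ definition of the complement. -/
theorem isSet_setOf (P : M.Num → Prop) [DefSig (fun e => P (e 0))]
    [DefSig (fun e => ¬ P (e 0))] : IsSet {n | P n} := by
  obtain ⟨ρ, hρ⟩ := exists_scons_mix_comp_eq (M := M)
  obtain ⟨φ, ψ, hφ, hψ, p, h⟩ := DefSig.exists_common (fun e => P (e 0)) (fun e => ¬ P (e 0))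
  obtain ⟨χ, hχ, h'⟩ := exists_pi1_neg (hψ.rename ρ)
  have := hM.out.delta1_comprehension (φ.rename ρ) χ (hφ.rename ρ) hχ (mix (fun _ => 0) p)
    (fun n => by simp [h', holds_rename, hρ, h, scons])
  simp only [holds_rename, hρ, h, scons] at this
  exact ⟨this⟩

/-! ## The numbers of a model form a discretely ordered commutative semiring -/

namespace Arith

theorem add_zero (n : M.Num) : n + 0 = n := hM.out.basic.add_zero n
theorem add_succ (m n : M.Num) : m + (n + 1) = m + n + 1 := hM.out.basic.add_succ m n
theorem mul_zero (n : M.Num) : n * 0 = 0 := hM.out.basic.mul_zero n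
theorem mul_succ (m n : M.Num) : m * (n + 1) = m * n + m := hM.out.basic.mul_succ m n

theorem zero_add (n : M.Num) : 0 + n = n :=
  induction_on (fun n => 0 + n = n) n (add_zero _) fun n h => by rw [add_succ, h]

theorem succ_add (m n : M.Num) : m + 1 + n = m + n + 1 :=
  induction_on (fun n => m + 1 + n = m + n + 1) n (by simp only [add_zero]) fun n h => by
    simp only [add_succ, h]

theorem add_comm (m n : M.Num) : m + n = n + m :=
  induction_on (fun n => m + n = n + m) n (by simp only [add_zero, zero_add]) fun n h => by
    simp only [add_succ, succ_add, h]

theorem add_assoc (m n k : M.Num) : m + n + k = m + (n + k) :=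
  induction_on (fun k => m + n + k = m + (n + k)) k (by simp only [add_zero]) fun k h => by
    simp only [add_succ, h]

theorem zero_mul (n : M.Num) : 0 * n = 0 :=
  induction_on (fun n => 0 * n = 0) n (mul_zero _) fun n h => by simp only [mul_succ, h, add_zero]

theorem succ_mul (m n : M.Num) : (m + 1) * n = m * n + n :=
  induction_on (fun n => (m + 1) * n = m * n + n) n (by simp only [mul_zero, add_zero])
    fun n h => by
      rw [mul_succ, mul_succ, h, add_assoc, add_assoc, add_comm n, succ_add, add_succ m n]

theorem mul_comm (m n : M.Num) : m * n = n * m :=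
  induction_on (fun n => m * n = n * m) n (by simp only [mul_zero, zero_mul]) fun n h => by
    simp only [mul_succ, succ_mul, h]

theorem mul_add (m n k : M.Num) : m * (n + k) = m * n + m * k :=
  induction_on (fun k => m * (n + k) = m * n + m * k) k (by simp only [mul_zero, add_zero])
    fun k h => by rw [add_succ, mul_succ, h, mul_succ, add_assoc]

theorem mul_assoc (m n k : M.Num) : m * n * k = m * (n * k) :=
  induction_on (fun k => m * n * k = m * (n * k)) k (by simp only [mul_zero]) fun k h => by
    rw [mul_succ, h, mul_succ, mul_add]

theorem mul_one (n : M.Num) : n * 1 = n := by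
  rw [← zero_add (1 : M.Num), mul_succ, mul_zero, zero_add]

theorem add_right_cancel {a b n : M.Num} : a + n = b + n → a = b :=
  induction_on (fun n => a + n = b + n → a = b) n (by simp only [add_zero, imp_self])
    fun n h h' => h (hM.out.basic.succ_inj _ _ (by rwa [add_succ, add_succ] at h'))

theorem eq_zero_or_succ (n : M.Num) : n = 0 ∨ ∃ m, n = m + 1 :=
  induction_on (fun n => n = 0 ∨ ∃ m, n = m + 1) n (.inl rfl) fun n _ => .inr ⟨n, rfl⟩

theorem lt_iff {a b : M.Num} : a < b ↔ ∃ c, a + (c + 1) = b := by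
  constructor
  · intro h
    -- The implication is written as a disjunction so that the motive is Σ⁰₁ despite the unbounded
    -- `∃ c`.
    refine (induction_on (fun b => ¬ a < b ∨ ∃ c, a + (c + 1) = b) b
      (.inl (hM.out.basic.not_lt_zero _)) fun b ih => ?_).resolve_left (not_not.2 h)
    rw [hM.out.basic.lt_succ]
    by_cases hab : a = b
    · exact .inr ⟨0, by rw [hab, zero_add]⟩
    · rcases ih with ih | ⟨c, hc⟩
      · exact .inl (by tauto)
      · exact .inr ⟨c + 1, by rw [← hc, add_succ a (c + 1)]⟩
  · rintro ⟨c, rfl⟩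
    refine induction_on (fun c => a < a + (c + 1)) c ?_ fun c ih => ?_
    · rw [zero_add, hM.out.basic.lt_succ]; exact .inr rfl
    · rw [add_succ, hM.out.basic.lt_succ]; exact .inl ih

theorem le_iff {a b : M.Num} : a ≤ b ↔ ∃ c, b = a + c := by
  change a < b ∨ a = b ↔ _
  rw [lt_iff]
  constructor
  · rintro (⟨c, rfl⟩ | rfl)
    exacts [⟨_, rfl⟩, ⟨0, (add_zero _).symm⟩]
  · rintro ⟨c, rfl⟩
    rcases eq_zero_or_succ c with rfl | ⟨c, rfl⟩
    exacts [.inr (add_zero _).symm, .inl ⟨c, rfl⟩]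

theorem lt_irrefl (a : M.Num) : ¬ a < a := fun h => by
  obtain ⟨c, hc⟩ := lt_iff.1 h
  rw [add_comm] at hc
  exact hM.out.basic.succ_ne_zero c (add_right_cancel (hc.trans (zero_add a).symm))

theorem le_total (a b : M.Num) : a ≤ b ∨ b ≤ a := by
  refine induction_on (fun b => a ≤ b ∨ b ≤ a) b (.inr (le_iff.2 ⟨a, (zero_add a).symm⟩))
    fun b ih => ?_
  rcases ih with h | h
  · obtain ⟨c, rfl⟩ := le_iff.1 h
    exact .inl (le_iff.2 ⟨c + 1, (add_succ _ _).symm⟩)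
  · obtain ⟨c, rfl⟩ := le_iff.1 h
    rcases eq_zero_or_succ c with rfl | ⟨c, rfl⟩
    · exact .inl (le_iff.2 ⟨1, by rw [add_zero]⟩)
    · exact .inr (le_iff.2 ⟨c, by rw [add_succ, succ_add]⟩)

theorem le_antisymm {a b : M.Num} (h : a ≤ b) (h' : b ≤ a) : a = b := by
  obtain ⟨c, rfl⟩ := le_iff.1 h
  rcases eq_zero_or_succ c with rfl | ⟨c, rfl⟩
  · rw [add_zero]
  · obtain ⟨d, hd⟩ := le_iff.1 h'
    exact absurd (lt_iff.2 ⟨c + d, by rw [← succ_add, ← add_assoc]; exact hd.symm⟩)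
      (lt_irrefl a)

end Arith

open Arith (eq_zero_or_succ)

instance : CommSemiring M.Num where
  add_assoc := Arith.add_assoc
  zero_add := Arith.zero_add
  add_zero := Arith.add_zero
  add_comm := Arith.add_comm
  mul_assoc := Arith.mul_assoc
  mul_comm := Arith.mul_comm
  one_mul n := (Arith.mul_comm _ _).trans (Arith.mul_one n)
  mul_one := Arith.mul_one
  zero_mul := Arith.zero_mul
  mul_zero := Arith.mul_zero
  left_distrib := Arith.mul_add
  right_distrib a b c := by rw [Arith.mul_comm, Arith.mul_add, Arith.mul_comm c, Arith.mul_comm c]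
  nsmul := nsmulRec
  npow := npowRec

noncomputable instance : LinearOrder M.Num where
  le := (· ≤ ·)
  lt := (· < ·)
  le_refl _ := .inr rfl
  le_trans a b c h h' := by
    obtain ⟨d, rfl⟩ := Arith.le_iff.1 h
    obtain ⟨k, rfl⟩ := Arith.le_iff.1 h'
    exact Arith.le_iff.2 ⟨d + k, Arith.add_assoc _ _ _⟩
  le_antisymm _ _ := Arith.le_antisymm
  le_total := Arith.le_total
  lt_iff_le_not_ge a b := by
    refine ⟨fun h => ⟨.inl h, ?_⟩, fun ⟨h, h'⟩ => h.resolve_right fun h'' => h' (.inr h''.symm)⟩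
    rintro h'
    have := Arith.le_antisymm (.inl h) h'
    exact Arith.lt_irrefl a (this ▸ h)
  toDecidableLE := Classical.decRel _

instance : IsOrderedCancelAddMonoid M.Num where
  add_le_add_left _ _ h _ := by
    obtain ⟨d, rfl⟩ := Arith.le_iff.1 h
    exact Arith.le_iff.2 ⟨d, by ring⟩
  le_of_add_le_add_left a b c h := by
    obtain ⟨d, h⟩ := Arith.le_iff.1 h
    exact Arith.le_iff.2 ⟨d, Arith.add_right_cancel (n := a)
      (by rw [add_comm c, h, add_assoc, add_comm a])⟩

instance : CanonicallyOrderedAdd M.Num where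
  le_add_self _ b := Arith.le_iff.2 ⟨b, _root_.add_comm _ _⟩
  le_self_add _ b := Arith.le_iff.2 ⟨b, rfl⟩
  exists_add_of_le h := Arith.le_iff.1 h

instance : Nontrivial M.Num := ⟨0, 1, fun h => hM.out.basic.succ_ne_zero 0 (by rw [zero_add, ← h])⟩

theorem lt_succ_iff {a b : M.Num} : a < b + 1 ↔ a ≤ b := hM.out.basic.lt_succ a b

theorem succ_le_iff {a b : M.Num} : a + 1 ≤ b ↔ a < b := by
  rw [← not_lt, lt_succ_iff, not_le]

instance : IsStrictOrderedRing M.Num where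
  zero_le_one := zero_le
  mul_lt_mul_of_pos_left a ha _ _ hbc := by
    obtain ⟨d, rfl⟩ := Arith.lt_iff.1 hbc
    obtain ⟨k, hk⟩ := Arith.lt_iff.1 ha
    refine Arith.lt_iff.2 ⟨k * d + k + d, ?_⟩
    rw [← hk]
    ring
  mul_lt_mul_of_pos_right a ha _ _ hbc := by
    obtain ⟨d, rfl⟩ := Arith.lt_iff.1 hbc
    obtain ⟨k, hk⟩ := Arith.lt_iff.1 ha
    refine Arith.lt_iff.2 ⟨k * d + k + d, ?_⟩
    rw [← hk]
    ring

theorem one_le_of_pos {a : M.Num} (h : 0 < a) : 1 ≤ a := by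
  have := succ_le_iff.2 h
  rwa [zero_add] at this

/-- Least number principle. -/
theorem exists_least (P : M.Num → Prop) [DefBdd (fun e => P (e 0))] (h : ∃ n, P n) :
    ∃ n, P n ∧ ∀ m < n, ¬ P m := by
  by_contra! hc
  obtain ⟨n, hn⟩ := h
  have : DefBdd (fun e : ℕ → M.Num => ∀ m, m < e 0 → ¬ P m) :=
    DefBdd.ball _ (fun m e => ¬ P m)
  have key : ∀ k, ∀ m, m < k → ¬ P m := fun k =>
    induction_on (fun k => ∀ m, m < k → ¬ P m) k (fun m h => absurd h not_lt_zero)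
      fun k ih m hm hP => by
        rcases (lt_succ_iff.1 hm).lt_or_eq with h | rfl
        · exact ih m h hP
        · obtain ⟨l, hl, hl'⟩ := hc m hP
          exact ih l hl hl'
  exact key (n + 1) n (lt_succ_iff.2 le_rfl) hn

/-- Greatest number principle. -/
theorem exists_greatest (P : M.Num → Prop) [DefBdd (fun e => P (e 0))] (b : M.Num) (h : ∃ n, P n)
    (hb : ∀ n, P n → n ≤ b) : ∃ n, P n ∧ ∀ m, P m → m ≤ n := by
  have : DefBdd (fun e : ℕ → M.Num => ∀ m, m < b + 1 → P m → m ≤ e 0) := by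
    have h : DefBdd (fun e : ℕ → M.Num => P (e 0) → e 0 ≤ e 1) := inferInstance
    exact DefBdd.ball (fun _ => b + 1) (fun m e => P m → m ≤ e 0)
  -- The witness is the least upper bound of `P`. If it failed `P`, its predecessor would already be
  -- an upper bound.
  obtain ⟨n, hn, hn'⟩ := exists_least (fun n => ∀ m, m < b + 1 → P m → m ≤ n)
    ⟨b, fun m hm _ => lt_succ_iff.1 hm⟩
  refine ⟨n, ?_, fun m hm => hn m (lt_succ_iff.2 (hb m hm)) hm⟩
  by_contra hP
  rcases eq_zero_or_succ n with rfl | ⟨k, rfl⟩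
  · obtain ⟨m, hm⟩ := h
    have := hn m (lt_succ_iff.2 (hb m hm)) hm
    rw [le_zero_iff] at this
    exact hP (this ▸ hm)
  · refine hn' k (lt_succ_iff.2 le_rfl) fun m hm hPm => lt_succ_iff.1 ?_
    exact (hn m hm hPm).lt_of_ne fun h => hP (h ▸ hPm)

/-- Induction for the negation of a `Σ⁰₁` predicate. -/
theorem induction_on_not (P : M.Num → Prop) [DefSig (fun e => P (e 0))] (n : M.Num) (zero : ¬ P 0)
    (succ : ∀ n, ¬ P n → ¬ P (n + 1)) : ¬ P n := by
  intro hn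
  -- Descend from `n`: if `P n` holds, then `P (n - i)` holds for every `i ≤ n`, and this is a Σ⁰₁
  -- statement about `i`.
  have := induction_on (fun i => n < i ∨ ∃ j, j + i = n ∧ P j) n (.inr ⟨n, add_zero n, hn⟩)
    fun i ih => by
      rcases ih with h | ⟨j, rfl, hj⟩
      · exact .inl (h.trans (lt_succ_iff.2 le_rfl))
      · rcases eq_zero_or_succ j with rfl | ⟨j, rfl⟩
        · exact absurd hj zero
        · exact .inr ⟨j, by ring, not_imp_not.1 (succ j) hj⟩
  rcases this with h | ⟨j, h, hj⟩
  · exact lt_irrefl _ h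
  · exact zero (by rwa [(add_eq_right (a := j)).1 h] at hj)

open scoped TensorProduct

variable (M)

/-! ## The field of fractions of a model -/

/-- The ring of differences of numbers. -/
def Diff := ℤ ⊗[ℕ] M.Num

noncomputable instance : CommRing (Diff M) := inferInstanceAs (CommRing (ℤ ⊗[ℕ] M.Num))

variable {M}

/-- The inclusion of the numbers into the ring of differences. -/
def toDiff : M.Num →+* Diff M :=
  (Algebra.TensorProduct.includeRight : M.Num →ₐ[ℕ] ℤ ⊗[ℕ] M.Num).toRingHom

/-- The tensor product maps to the Grothendieck group by `z ⊗ n ↦ z • [n]`, and numbers embed in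
that group because addition is cancellative. -/
theorem toDiff_injective : Function.Injective (toDiff (M := M)) := by
  let G := Algebra.GrothendieckAddGroup M.Num
  let f : ℤ →ₗ[ℕ] M.Num →ₗ[ℕ] G :=
    LinearMap.mk₂ ℕ (fun z n => z • Algebra.GrothendieckAddGroup.of n)
      (fun a b n => add_smul a b _) (fun c a n => by simp [mul_smul])
      (fun a m n => by simp) (fun c a n => by simp only [map_nsmul]; exact smul_comm _ _ _)
  intro a b h
  have h' := congrArg (TensorProduct.lift f) h
  have hf : ∀ n : M.Num, TensorProduct.lift f (toDiff n) = Algebra.GrothendieckAddGroup.of n :=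
    fun n => by
      change TensorProduct.lift f ((1 : ℤ) ⊗ₜ[ℕ] n) = _
      simp [f]
  rw [hf, hf] at h'
  exact Algebra.GrothendieckAddGroup.of_injective h'

theorem exists_toDiff_sub (x : Diff M) : ∃ a b : M.Num, x = toDiff a - toDiff b := by
  induction x using TensorProduct.induction_on with
  | zero => exact ⟨0, 0, (sub_self _).symm⟩
  | tmul z n =>
    have h : ∀ k : ℕ, (k : ℤ) ⊗ₜ[ℕ] n = toDiff (k • n) := fun k => by
      change _ = (1 : ℤ) ⊗ₜ[ℕ] (k • n)
      rw [← nsmul_one]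
      exact TensorProduct.smul_tmul _ _ _
    obtain ⟨k, rfl | rfl⟩ := z.eq_nat_or_neg
    · exact ⟨k • n, 0, by rw [h]; simp⟩
    · exact ⟨0, k • n, by rw [map_zero, zero_sub, ← h]; exact TensorProduct.neg_tmul _ _⟩
  | add x y hx hy =>
    obtain ⟨a, b, hx⟩ := hx
    obtain ⟨c, d, hy⟩ := hy
    refine ⟨a + c, b + d, (congrArg₂ (fun x y : Diff M => x + y) hx hy).trans ?_⟩
    simp only [map_add]
    ring

/-- Totality of the order makes one term of a difference absorb the other. The absence of zero
divisors and the linear order on fractions both rest on this. -/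
theorem exists_eq_or_neg_toDiff (x : Diff M) : ∃ a : M.Num, x = toDiff a ∨ x = -toDiff a := by
  obtain ⟨a, b, rfl⟩ := exists_toDiff_sub x
  rcases le_total a b with h | h <;> obtain ⟨c, rfl⟩ := exists_add_of_le h
  · exact ⟨c, .inr (by simp)⟩
  · exact ⟨c, .inl (by simp)⟩

instance : IsDomain (Diff M) := by
  have : Nontrivial (Diff M) := toDiff_injective.nontrivial
  have : NoZeroDivisors (Diff M) := ⟨fun {x y} h => by
    obtain ⟨a, ha⟩ := exists_eq_or_neg_toDiff x
    obtain ⟨b, hb⟩ := exists_eq_or_neg_toDiff y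
    have : toDiff (a * b) = 0 := by
      rw [map_mul]
      rcases ha with rfl | rfl <;> rcases hb with rfl | rfl <;>
        simpa only [neg_mul, mul_neg, neg_neg, neg_eq_zero] using h
    rw [map_eq_zero_iff _ toDiff_injective, mul_eq_zero] at this
    rcases this with rfl | rfl
    · left; simpa using ha
    · right; simpa using hb⟩
  exact NoZeroDivisors.to_isDomain _

variable (M) in
/-- The field of fractions of a model. -/
def Fr := FractionRing (Diff M)

noncomputable instance : Field (Fr M) := inferInstanceAs (Field (FractionRing (Diff M)))

/-- The inclusion of the numbers into the field of fractions. -/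
noncomputable def toFr : M.Num →+* Fr M := (algebraMap (Diff M) (FractionRing (Diff M))).comp toDiff

theorem toFr_injective : Function.Injective (toFr (M := M)) :=
  (IsFractionRing.injective (Diff M) (FractionRing (Diff M))).comp toDiff_injective

theorem exists_eq_or_neg_div (x : Fr M) :
    ∃ a b : M.Num, b ≠ 0 ∧ (x = toFr a / toFr b ∨ x = -(toFr a / toFr b)) := by
  obtain ⟨y, z, hz, rfl⟩ := IsFractionRing.div_surjective (A := Diff M) (K := FractionRing (Diff M)) x
  obtain ⟨a, ha⟩ := exists_eq_or_neg_toDiff y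
  obtain ⟨b, hb⟩ := exists_eq_or_neg_toDiff z
  refine ⟨a, b, ?_, ?_⟩
  · rintro rfl
    exact nonZeroDivisors.ne_zero hz (by simpa using hb)
  · let f := algebraMap (Diff M) (FractionRing (Diff M))
    change f y / f z = f (toDiff a) / f (toDiff b) ∨ f y / f z = -(f (toDiff a) / f (toDiff b))
    rcases ha with rfl | rfl <;> rcases hb with rfl | rfl <;> simp [neg_div, div_neg]

variable (M) in
/-- The cone of nonnegative fractions. -/
def nonnegCone : RingCone (Fr M) where
  carrier := {x | ∃ a b : M.Num, b ≠ 0 ∧ x = toFr a / toFr b}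
  mul_mem' := by
    rintro _ _ ⟨a, b, hb, rfl⟩ ⟨c, d, hd, rfl⟩
    exact ⟨a * c, b * d, mul_ne_zero hb hd, by simp [div_mul_div_comm]⟩
  one_mem' := ⟨1, 1, one_ne_zero, by simp⟩
  add_mem' := by
    rintro _ _ ⟨a, b, hb, rfl⟩ ⟨c, d, hd, rfl⟩
    refine ⟨a * d + b * c, b * d, mul_ne_zero hb hd, ?_⟩
    rw [div_add_div _ _ (by simpa using toFr_injective.ne hb) (by simpa using toFr_injective.ne hd)]
    simp
  zero_mem' := ⟨0, 1, one_ne_zero, by simp⟩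
  eq_zero_of_mem_of_neg_mem' := by
    rintro _ ⟨a, b, hb, rfl⟩ ⟨c, d, hd, h⟩
    have hb' : toFr b ≠ 0 := by simpa using toFr_injective.ne hb
    have hd' : toFr d ≠ 0 := by simpa using toFr_injective.ne hd
    rw [← neg_div, div_eq_div_iff hb' hd', neg_mul, neg_eq_iff_add_eq_zero, ← map_mul, ← map_mul,
      ← map_add, map_eq_zero_iff _ toFr_injective, add_eq_zero] at h
    have ha : a = 0 := by simpa [hd] using h.1
    simp [ha]

instance : HasMemOrNegMem (nonnegCone M) where
  mem_or_neg_mem x := by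
    obtain ⟨a, b, hb, h⟩ := exists_eq_or_neg_div x
    exact h.imp (fun h => ⟨a, b, hb, h⟩) fun h => ⟨a, b, hb, by simp [h]⟩

variable (M) in
open Classical in
/-- The order with nonnegative cone `nonnegCone`. -/
noncomputable def linearOrderFr : LinearOrder (Fr M) := LinearOrder.mkOfAddGroupCone (nonnegCone M)

noncomputable instance : LinearOrder (Fr M) := linearOrderFr M

instance : IsOrderedRing (Fr M) := IsOrderedRing.mkOfCone (nonnegCone M)

instance : IsStrictOrderedRing (Fr M) := IsOrderedRing.toIsStrictOrderedRing _

theorem toFr_nonneg (a : M.Num) : 0 ≤ toFr a :=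
  show toFr a - 0 ∈ nonnegCone M from ⟨a, 1, one_ne_zero, by simp⟩

theorem toFr_strictMono : StrictMono (toFr (M := M)) := by
  refine Monotone.strictMono_of_injective (fun a b h => ?_) toFr_injective
  obtain ⟨c, rfl⟩ := exists_add_of_le h
  rw [map_add]
  exact le_add_of_nonneg_right (toFr_nonneg c)

@[simp] theorem toFr_le {a b : M.Num} : toFr a ≤ toFr b ↔ a ≤ b := toFr_strictMono.le_iff_le
@[simp] theorem toFr_lt {a b : M.Num} : toFr a < toFr b ↔ a < b := toFr_strictMono.lt_iff_lt
@[simp] theorem toFr_inj {a b : M.Num} : toFr a = toFr b ↔ a = b := toFr_injective.eq_iff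
@[simp] theorem toFr_pos {a : M.Num} : 0 < toFr a ↔ 0 < a := by rw [← toFr_lt, map_zero]

/-- The field is Archimedean over the numbers of the model, though in general not over ℕ: a positive
`a / b` is at least `1 / b`. -/
theorem exists_inv_lt {ε : Fr M} (hε : 0 < ε) : ∃ u : M.Num, 0 < u ∧ 1 / toFr u < ε := by
  obtain ⟨a, b, hb, h⟩ := exists_eq_or_neg_div ε
  have hb' : 0 < toFr b := toFr_pos.2 (pos_iff_ne_zero.2 hb)
  have h0 : 0 ≤ toFr a / toFr b := div_nonneg (toFr_nonneg _) hb'.le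
  have hε' : ε = toFr a / toFr b := h.resolve_right (by rintro rfl; linarith)
  have ha : 1 ≤ toFr a := by
    have : 0 < toFr a := by
      by_contra hc
      have : toFr a = 0 := le_antisymm (not_lt.1 hc) (toFr_nonneg a)
      rw [hε', this, zero_div] at hε
      exact lt_irrefl _ hε
    have := one_le_of_pos (toFr_pos.1 this)
    rwa [← toFr_le, map_one] at this
  refine ⟨b + 1, by positivity, ?_⟩
  rw [hε', map_add, map_one, div_lt_div_iff₀ (by positivity) hb']
  nlinarith

/-! ## Pairs -/

/-- With `s = m + n`, the code satisfies `s² ≤ pair m n ≤ s² + s < (s + 1)²`, so the sum of the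
components is read off first. -/
theorem pair_lt_of_add_lt {m n m' n' : M.Num} (h : m + n < m' + n') : pair m n < pair m' n' := by
  obtain ⟨d, hd⟩ := exists_add_of_le (succ_le_iff.2 h)
  have : pair m' n' = pair m n + (m + n + n + 1 + (d + d) * (m + n + 1) + d * d + m') := by
    simp only [pair, hd]
    ring
  rw [this]
  exact lt_add_of_pos_right _ (by positivity)

theorem pair_inj {m n m' n' : M.Num} : pair m n = pair m' n' ↔ m = m' ∧ n = n' := by
  refine ⟨fun h => ?_, fun ⟨h, h'⟩ => h ▸ h' ▸ rfl⟩
  rcases lt_trichotomy (m + n) (m' + n') with h' | h' | h'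
  · exact absurd h (pair_lt_of_add_lt h').ne
  · have hm : m = m' := by simpa only [pair, h', add_right_inj] using h
    subst hm
    exact ⟨rfl, by simpa using h'⟩
  · exact absurd h (pair_lt_of_add_lt h').ne'

theorem pair_mono {m n m' n' : M.Num} (h : m ≤ m') (h' : n ≤ n') : pair m n ≤ pair m' n' := by
  unfold pair
  gcongr

theorem left_le_pair (m n : M.Num) : m ≤ pair m n := le_add_self

theorem right_le_pair (m n : M.Num) : n ≤ pair m n := by
  rcases Arith.eq_zero_or_succ n with rfl | ⟨k, rfl⟩
  · exact zero_le
  · have : pair m (k + 1) = k + 1 + (m * m + (m + m) * (k + 1) + k * k + k + m) := by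
      unfold pair
      ring
    rw [this]
    exact le_self_add

/-! ## Values of formal differences and fractions -/

namespace PreInt

noncomputable def val (z : PreInt M) : Fr M := toFr z.pos - toFr z.neg

@[simp] theorem val_ofNum (n : M.Num) : (ofNum n).val = toFr n := by simp [val, ofNum]
@[simp] theorem val_add (z w : PreInt M) : (z.add w).val = z.val + w.val := by
  simp only [val, add, map_add]; ring
@[simp] theorem val_opp (z : PreInt M) : z.opp.val = -z.val := by simp [val, opp]
@[simp] theorem val_mul (z w : PreInt M) : (z.mul w).val = z.val * w.val := by
  simp only [val, mul, map_add, map_mul]; ring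

theorem equiv_iff {z w : PreInt M} : z.Equiv w ↔ z.val = w.val := by
  unfold Equiv val
  rw [← toFr_inj, map_add, map_add, sub_eq_sub_iff_add_eq_add, add_comm (toFr w.pos)]

theorem lt_iff {z w : PreInt M} : z.Lt w ↔ z.val < w.val := by
  unfold Lt val
  rw [← toFr_lt, map_add, map_add, sub_lt_sub_iff]

/-- Lowering both components by one keeps the class and decreases the code, so a minimal pair has a
zero component. The universal quantifier in `IsInt` is thereby eliminated. -/
theorem isInt_iff {z : PreInt M} : z.IsInt ↔ z.pos = 0 ∨ z.neg = 0 := by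
  obtain ⟨a, b⟩ := z
  constructor
  · intro h
    rcases Arith.eq_zero_or_succ a with rfl | ⟨a, rfl⟩
    · exact .inl rfl
    rcases Arith.eq_zero_or_succ b with rfl | ⟨b, rfl⟩
    · exact .inr rfl
    refine absurd (h ⟨a, b⟩ ?_) (not_le.2 (pair_lt_of_add_lt ?_))
    · change a + (b + 1) = b + (a + 1)
      ring
    · exact add_lt_add (lt_succ_iff.2 le_rfl) (lt_succ_iff.2 le_rfl)
  · rintro (rfl | rfl) ⟨c, d⟩ hw
    · replace hw : c + b = d + 0 := hw
      exact pair_mono zero_le (by rw [add_zero] at hw; exact hw ▸ le_add_self)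
    · replace hw : c + 0 = d + a := hw
      exact pair_mono (by rw [add_zero] at hw; exact hw ▸ le_add_self) zero_le

theorem code_injective : Function.Injective (code (M := M)) := fun z w h => by
  have := pair_inj.1 h
  exact PreInt.ext this.1 this.2

end PreInt

namespace PreRat

noncomputable def val (q : PreRat M) : Fr M := q.num.val / q.den.val

/-- The denominator is positive. -/
def DenPos (q : PreRat M) : Prop := 0 < q.den.val

theorem code_injective : Function.Injective (code (M := M)) := fun q r h => by
  have := pair_inj.1 h
  exact PreRat.ext (PreInt.code_injective this.1) (PreInt.code_injective this.2)

theorem IsFrac.denPos {q : PreRat M} (h : q.IsFrac) : q.DenPos := by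
  simpa [DenPos, PreInt.lt_iff] using h.2.2

theorem IsRat.denPos {q : PreRat M} (h : q.IsRat) : q.DenPos := h.1.denPos

theorem denPos_ofNums {a b : M.Num} (hb : 0 < b) : (ofNums a b).DenPos := by
  simpa [DenPos, ofNums] using hb

theorem DenPos.add {q r : PreRat M} (hq : q.DenPos) (hr : r.DenPos) : (q.add r).DenPos := by
  simpa [DenPos, PreRat.add] using mul_pos hq hr

theorem DenPos.opp {q : PreRat M} (hq : q.DenPos) : q.opp.DenPos := hq

theorem DenPos.sub {q r : PreRat M} (hq : q.DenPos) (hr : r.DenPos) : (q.sub r).DenPos :=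
  hq.add hr.opp

theorem DenPos.abs {q : PreRat M} (hq : q.DenPos) : q.abs.DenPos := by
  unfold PreRat.abs
  split_ifs
  exacts [hq.opp, hq]

@[simp] theorem val_ofNums (a b : M.Num) : (ofNums a b).val = toFr a / toFr b := by
  simp [val, ofNums]

theorem val_add {q r : PreRat M} (hq : q.DenPos) (hr : r.DenPos) :
    (q.add r).val = q.val + r.val := by
  simp only [val, add, PreInt.val_add, PreInt.val_mul, div_add_div _ _ hq.ne' hr.ne']
  ring

@[simp] theorem val_opp (q : PreRat M) : q.opp.val = -q.val := by
  simp [val, opp, neg_div]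

theorem val_sub {q r : PreRat M} (hq : q.DenPos) (hr : r.DenPos) :
    (q.sub r).val = q.val - r.val := by
  rw [sub, val_add hq hr.opp, val_opp, sub_eq_add_neg]

theorem lt_iff {q r : PreRat M} (hq : q.DenPos) (hr : r.DenPos) : q.Lt r ↔ q.val < r.val := by
  rw [Lt, PreInt.lt_iff, PreInt.val_mul, PreInt.val_mul, val, val, div_lt_div_iff₀ hq hr]

theorem le_iff {q r : PreRat M} (hq : q.DenPos) (hr : r.DenPos) : q.Le r ↔ q.val ≤ r.val := by
  rw [Le, lt_iff hr hq, not_lt]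

theorem equiv_iff {q r : PreRat M} (hq : q.DenPos) (hr : r.DenPos) :
    q.Equiv r ↔ q.val = r.val := by
  rw [Equiv, PreInt.equiv_iff, PreInt.val_mul, PreInt.val_mul, val, val,
    div_eq_div_iff hq.ne' hr.ne', mul_comm q.den.val]

theorem val_abs {q : PreRat M} (hq : q.DenPos) : q.abs.val = |q.val| := by
  unfold PreRat.abs
  have h : q.Lt (ofNums 0 1) ↔ q.val < 0 := by simp [lt_iff hq (denPos_ofNums zero_lt_one)]
  split_ifs with h'
  · rw [val_opp, abs_of_neg (h.1 h')]
  · rw [abs_of_nonneg (not_lt.1 (h.not.1 h'))]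

theorem exists_isFrac (x : Fr M) : ∃ q : PreRat M, q.IsFrac ∧ q.val = x := by
  obtain ⟨a, b, hb, h | h⟩ := exists_eq_or_neg_div x
  · exact ⟨ofNums a b, ⟨PreInt.isInt_iff.2 (.inr rfl), PreInt.isInt_iff.2 (.inr rfl),
      PreInt.lt_iff.2 (by simpa [ofNums] using pos_iff_ne_zero.2 hb)⟩, by simp [h]⟩
  · exact ⟨(ofNums a b).opp, ⟨PreInt.isInt_iff.2 (.inl rfl), PreInt.isInt_iff.2 (.inr rfl),
      PreInt.lt_iff.2 (by simpa [ofNums, opp] using pos_iff_ne_zero.2 hb)⟩, by simp [h]⟩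

/-- A competitor that refutes minimality has a smaller code, so being a rational is a Σ⁰₀ condition.
-/
theorem isRat_iff {q : PreRat M} : q.IsRat ↔
    ((q.num.pos = 0 ∨ q.num.neg = 0) ∧ (q.den.pos = 0 ∨ q.den.neg = 0) ∧
      (PreInt.ofNum 0).Lt q.den) ∧
    ¬ ∃ r : PreRat M, r.code < q.code ∧ ((r.num.pos = 0 ∨ r.num.neg = 0) ∧
      (r.den.pos = 0 ∨ r.den.neg = 0) ∧ (PreInt.ofNum 0).Lt r.den) ∧ r.Equiv q := by
  simp only [IsRat, IsFrac, PreInt.isInt_iff]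
  refine and_congr_right fun _ => ?_
  push Not
  exact forall_congr' fun r => ⟨fun h h' h'' h3 => absurd (h h'' h3) (not_le.2 h'),
    fun h h' h'' => not_lt.1 fun h3 => h h3 h' h''⟩

end PreRat

/-! ## Definability for formal differences and fractions -/

/-- Both components are given by terms. -/
class DefInt (z : (ℕ → M.Num) → PreInt M) : Prop where
  pos : DefTerm (fun e => (z e).pos)
  neg : DefTerm (fun e => (z e).neg)

attribute [instance] DefInt.pos DefInt.neg

/-- Numerator and denominator are given by terms. -/
class DefRat (q : (ℕ → M.Num) → PreRat M) : Prop where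
  num : DefInt (fun e => (q e).num)
  den : DefInt (fun e => (q e).den)

attribute [instance] DefRat.num DefRat.den

namespace DefInt

variable (z w : (ℕ → M.Num) → PreInt M) (t s : (ℕ → M.Num) → M.Num)

instance ofPair [DefTerm t] [DefTerm s] : DefInt (fun e => ⟨t e, s e⟩) :=
  ⟨inferInstanceAs (DefTerm t), inferInstanceAs (DefTerm s)⟩
instance const (z : PreInt M) : DefInt (fun _ => z) := ⟨.const _, .const _⟩
instance ofNum [DefTerm t] : DefInt (fun e => PreInt.ofNum (t e)) := ofPair t (fun _ => 0)
instance opp [DefInt z] : DefInt (fun e => (z e).opp) :=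
  ofPair (fun e => (z e).neg) (fun e => (z e).pos)
instance add [DefInt z] [DefInt w] : DefInt (fun e => (z e).add (w e)) :=
  ofPair (fun e => (z e).pos + (w e).pos) (fun e => (z e).neg + (w e).neg)
instance mul [DefInt z] [DefInt w] : DefInt (fun e => (z e).mul (w e)) :=
  ofPair (fun e => (z e).pos * (w e).pos + (z e).neg * (w e).neg)
    (fun e => (z e).pos * (w e).neg + (z e).neg * (w e).pos)
instance code [DefInt z] : DefTerm (fun e => (z e).code) :=
  inferInstanceAs (DefTerm (fun e => L2Structure.pair (z e).pos (z e).neg))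
instance equiv [DefInt z] [DefInt w] : DefBdd (fun e => (z e).Equiv (w e)) :=
  inferInstanceAs (DefBdd (fun e => (z e).pos + (w e).neg = (z e).neg + (w e).pos))
instance lt [DefInt z] [DefInt w] : DefBdd (fun e => (z e).Lt (w e)) :=
  inferInstanceAs (DefBdd (fun e => (z e).pos + (w e).neg < (w e).pos + (z e).neg))
instance (priority := 900) rename [hz : DefInt z] (ρ : ℕ → ℕ) :
    DefInt (fun e => z (fun i => e (ρ i))) :=
  ⟨DefTerm.rename (fun e => (z e).pos) _, DefTerm.rename (fun e => (z e).neg) _⟩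

end DefInt

namespace DefRat

variable (q r : (ℕ → M.Num) → PreRat M)

instance ofPair (z w : (ℕ → M.Num) → PreInt M) [DefInt z] [DefInt w] : DefRat (fun e => ⟨z e, w e⟩) :=
  ⟨inferInstanceAs (DefInt z), inferInstanceAs (DefInt w)⟩
instance const (q : PreRat M) : DefRat (fun _ => q) := ⟨.const _, .const _⟩
instance ofNums (t s : (ℕ → M.Num) → M.Num) [DefTerm t] [DefTerm s] :
    DefRat (fun e => PreRat.ofNums (t e) (s e)) :=
  ofPair (fun e => PreInt.ofNum (t e)) (fun e => PreInt.ofNum (s e))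
instance opp [DefRat q] : DefRat (fun e => (q e).opp) :=
  ofPair (fun e => (q e).num.opp) (fun e => (q e).den)
instance add [DefRat q] [DefRat r] : DefRat (fun e => (q e).add (r e)) :=
  ofPair (fun e => ((q e).num.mul (r e).den).add ((r e).num.mul (q e).den))
    (fun e => (q e).den.mul (r e).den)
instance sub [DefRat q] [DefRat r] : DefRat (fun e => (q e).sub (r e)) :=
  add q (fun e => (r e).opp)
instance code [DefRat q] : DefTerm (fun e => (q e).code) :=
  inferInstanceAs (DefTerm (fun e => L2Structure.pair (q e).num.code (q e).den.code))
instance equiv [DefRat q] [DefRat r] : DefBdd (fun e => (q e).Equiv (r e)) :=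
  inferInstanceAs (DefBdd (fun e => ((q e).num.mul (r e).den).Equiv ((q e).den.mul (r e).num)))
instance lt [DefRat q] [DefRat r] : DefBdd (fun e => (q e).Lt (r e)) :=
  inferInstanceAs (DefBdd (fun e => ((q e).num.mul (r e).den).Lt ((r e).num.mul (q e).den)))
instance le [DefRat q] [DefRat r] : DefBdd (fun e => (q e).Le (r e)) :=
  inferInstanceAs (DefBdd (fun e => ¬ (r e).Lt (q e)))
instance (priority := 900) rename [hq : DefRat q] (ρ : ℕ → ℕ) :
    DefRat (fun e => q (fun i => e (ρ i))) :=
  ⟨DefInt.rename (fun e => (q e).num) ρ, DefInt.rename (fun e => (q e).den) ρ⟩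

/-- Quantification over fractions with bounded code. -/
instance bex (t : (ℕ → M.Num) → M.Num) [DefTerm t] (R : PreRat M → (ℕ → M.Num) → Prop)
    [DefBdd (fun e => R ⟨⟨e 3, e 2⟩, ⟨e 1, e 0⟩⟩ (fun i => e (i + 4)))] :
    DefBdd (fun e => ∃ q : PreRat M, q.code < t e ∧ R q e) := by
  -- Each of the four components is at most the code of the fraction, so the bound on the code
  -- bounds them all.
  refine DefBdd.of_iff (Q := fun e => ∃ a, a < t e ∧ ∃ b, b < t e ∧ ∃ c, c < t e ∧ ∃ d, d < t e ∧
    (PreRat.code ⟨⟨a, b⟩, ⟨c, d⟩⟩ < t e ∧ R ⟨⟨a, b⟩, ⟨c, d⟩⟩ e)) fun e => ⟨?_, ?_⟩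
  · rintro ⟨⟨⟨a, b⟩, ⟨c, d⟩⟩, h, h'⟩
    exact ⟨a, ((left_le_pair _ _).trans (left_le_pair _ _)).trans_lt h,
      b, ((right_le_pair _ _).trans (left_le_pair _ _)).trans_lt h,
      c, ((left_le_pair _ _).trans (right_le_pair _ _)).trans_lt h,
      d, ((right_le_pair _ _).trans (right_le_pair _ _)).trans_lt h, h, h'⟩
  · rintro ⟨a, _, b, _, c, _, d, _, h, h'⟩
    exact ⟨_, h, h'⟩

/-- Unbounded quantification over fractions. -/
instance ex (R : PreRat M → (ℕ → M.Num) → Prop)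
    [DefSig (fun e => R ⟨⟨e 3, e 2⟩, ⟨e 1, e 0⟩⟩ (fun i => e (i + 4)))] :
    DefSig (fun e => ∃ q : PreRat M, R q e) :=
  DefSig.of_iff (Q := fun e => ∃ a b c d, R ⟨⟨a, b⟩, ⟨c, d⟩⟩ e) fun _ =>
    ⟨fun ⟨⟨⟨a, b⟩, ⟨c, d⟩⟩, h⟩ => ⟨a, b, c, d, h⟩, fun ⟨_, _, _, _, h⟩ => ⟨_, h⟩⟩

instance isRat [DefRat q] : DefBdd (fun e => (q e).IsRat) :=
  DefBdd.of_iff fun e => PreRat.isRat_iff (q := q e)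

end DefRat

theorem exists_rat (x : Fr M) : ∃ q : M.Rat, q.1.val = x := by
  obtain ⟨q₀, hq₀, rfl⟩ := PreRat.exists_isFrac x
  obtain ⟨c, ⟨q, hc, hq, h⟩, hmin⟩ := exists_least
    -- The bound on `q.code` is implied by `c = q.code`; it is there to make the predicate Σ⁰₀ for
    -- the least number principle.
    (fun c => ∃ q : PreRat M, q.code < c + 1 ∧ c = q.code ∧
      ((q.num.pos = 0 ∨ q.num.neg = 0) ∧ (q.den.pos = 0 ∨ q.den.neg = 0) ∧
      (PreInt.ofNum 0).Lt q.den) ∧ q.Equiv q₀)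
    ⟨q₀.code, q₀, lt_succ_iff.2 le_rfl, rfl, by simpa only [PreRat.IsFrac, PreInt.isInt_iff] using hq₀,
      (PreRat.equiv_iff hq₀.denPos hq₀.denPos).2 rfl⟩
  have hq' : q.IsFrac := by simpa only [PreRat.IsFrac, PreInt.isInt_iff] using h.1
  have h' := (PreRat.equiv_iff hq'.denPos hq₀.denPos).1 h.2
  refine ⟨⟨q, hq', fun r hr hrq => not_lt.1 fun hlt => hmin r.code (hq ▸ hlt)
    ⟨r, lt_succ_iff.2 le_rfl, rfl, by simpa only [PreRat.IsFrac, PreInt.isInt_iff] using hr, ?_⟩⟩, h'⟩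
  rw [PreRat.equiv_iff hr.denPos hq₀.denPos, ← h']
  exact (PreRat.equiv_iff hr.denPos hq'.denPos).1 hrq

theorem rat_denPos (q : M.Rat) : q.1.DenPos := q.2.denPos

theorem rat_val_injective {q r : M.Rat} (h : q.1.val = r.1.val) : q = r :=
  Subtype.ext (PreRat.code_injective (_root_.le_antisymm
    (q.2.2 _ r.2.1 ((PreRat.equiv_iff (rat_denPos r) (rat_denPos q)).2 h.symm))
    (r.2.2 _ q.2.1 ((PreRat.equiv_iff (rat_denPos q) (rat_denPos r)).2 h))))

theorem rat_code_inj {q r : M.Rat} : q.1.code = r.1.code ↔ q = r :=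
  ⟨fun h => Subtype.ext (PreRat.code_injective h), fun h => h ▸ rfl⟩

/-! ## Codes of finite sets -/

instance DefBdd.dvd (t s : (ℕ → M.Num) → M.Num) [DefTerm t] [DefTerm s] :
    DefBdd (fun e => t e ∣ s e) := by
  refine DefBdd.of_iff (Q := fun e => ∃ c, c < s e + 1 ∧ s e = t e * c) fun e => ⟨?_, ?_⟩
  · rintro ⟨c, hc⟩
    -- A quotient is bounded by the dividend unless the divisor is 0, when 0 serves as quotient.
    rcases eq_or_ne (t e) 0 with h | h
    · exact ⟨0, zero_lt_one.trans_le le_add_self, by rw [hc, h, zero_mul, zero_mul]⟩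
    · refine ⟨c, lt_succ_iff.2 ?_, hc⟩
      rw [hc]
      exact le_mul_of_one_le_left zero_le (one_le_of_pos (pos_iff_ne_zero.2 h))
  · rintro ⟨c, _, hc⟩
    exact ⟨c, hc⟩

/-- A quotient in the ring of differences is a number or the negative of one; the second case forces
`b = 0`. -/
theorem dvd_of_toDiff_dvd {a b : M.Num} (h : toDiff a ∣ toDiff b) : a ∣ b := by
  obtain ⟨x, hx⟩ := h
  obtain ⟨c, rfl | rfl⟩ := exists_eq_or_neg_toDiff x
  · rw [← map_mul] at hx
    exact ⟨c, toDiff_injective hx⟩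
  · have : toDiff (b + a * c) = toDiff 0 := by
      rw [map_add, hx, map_mul, map_zero]
      ring
    rw [(add_eq_zero.1 (toDiff_injective this)).1]
    exact dvd_zero a

/-- The modulus for membership of `i` in a coded finite set. -/
def modulus (b i : M.Num) : M.Num := (i + 1) * b + 1

instance DefTerm.modulus (t s : (ℕ → M.Num) → M.Num) [DefTerm t] [DefTerm s] :
    DefTerm (fun e => modulus (t e) (s e)) := by
  unfold L2Structure.modulus
  infer_instance

theorem isCoprime_modulus {b i j d : M.Num} (hd : d ∣ b) (hij : i + d = j) :
    IsCoprime (toDiff (modulus b i)) (toDiff (modulus b j)) := by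
  obtain ⟨c, hc⟩ := hd
  have h1 : toDiff b = toDiff d * toDiff c := by rw [hc, map_mul]
  subst hij
  set B := toDiff b
  set I := toDiff i
  set D := toDiff d
  set C := toDiff c
  have hi : toDiff (modulus b i) = (I + 1) * B + 1 := by simp [modulus, I, B]
  have hj : toDiff (modulus b (i + d)) = (I + D + 1) * B + 1 := by simp [modulus, I, B, D]
  rw [hi, hj]
  -- With `x = (I + 1) * B`, the first modulus `1 + x` divides `1 - x²`. The two moduli differ by `D
  -- * B`, and `B = D * C` gives `x² = (I + 1)² * C * (D * B)`. Adding the two gives 1.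
  refine ⟨1 - (I + 1) * B - (I + 1) ^ 2 * C, (I + 1) ^ 2 * C, ?_⟩
  linear_combination ((I + 1) ^ 2 * B) * (-h1)

/-- Differences of indices below `N` divide `b`, so the moduli are pairwise coprime, as in Gödel's
β-function. Explicit Bézout coefficients replace any appeal to prime factors. -/
theorem dvd_of_modulus_dvd_mul {b i j N z : M.Num} (hb : ∀ d, d < N → 0 < d → d ∣ b) (hi : i < N)
    (hj : j < N) (hij : i ≠ j) (h : modulus b i ∣ z * modulus b j) : modulus b i ∣ z := by
  have hc : IsCoprime (toDiff (modulus b i)) (toDiff (modulus b j)) := by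
    rcases lt_or_gt_of_ne hij with h' | h' <;> obtain ⟨d, rfl⟩ := exists_add_of_le h'.le
    · exact isCoprime_modulus (hb d (le_add_self.trans_lt hj)
        (pos_iff_ne_zero.2 fun hd => hij (by rw [hd, add_zero]))) rfl
    · exact (isCoprime_modulus (hb d (le_add_self.trans_lt hi)
        (pos_iff_ne_zero.2 fun hd => hij (by rw [hd, add_zero]))) rfl).symm
  exact dvd_of_toDiff_dvd (hc.dvd_of_dvd_mul_right (by
    rw [← map_mul]
    exact map_dvd toDiff h))

theorem exists_forall_dvd (N : M.Num) : ∃ b, 0 < b ∧ ∀ d, d < N → 0 < d → d ∣ b := by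
  refine induction_on (fun N => ∃ b, 0 < b ∧ ∀ d, d < N → 0 < d → d ∣ b) N
    ⟨1, zero_lt_one, fun d hd => absurd hd not_lt_zero⟩ ?_
  rintro N ⟨b, hb, h⟩
  rcases eq_or_ne N 0 with rfl | hN
  · exact ⟨1, zero_lt_one, fun d hd hd' => absurd (hd'.trans_le (lt_succ_iff.1 hd)) (lt_irrefl 0)⟩
  · refine ⟨b * N, mul_pos hb (pos_iff_ne_zero.2 hN), fun d hd hd' => ?_⟩
    rcases (lt_succ_iff.1 hd).lt_or_eq with hlt | rfl
    · exact (h d hlt hd').mul_right N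
    · exact dvd_mul_left d b

/-- Finite sets defined by `Σ⁰₀` formulas have codes. -/
theorem exists_code (P : M.Num → Prop) [hP : DefBdd (fun e => P (e 0))] (N : M.Num) :
    ∃ b z, ∀ j, j < N → (modulus b j ∣ z ↔ P j) := by
  obtain ⟨b, hb, hdvd⟩ := exists_forall_dvd N
  -- Here `z` is the product of the moduli of the members below `i`. It starts as the empty product
  -- 1, which no modulus divides.
  have key : ∀ i, ∃ z, ∀ j, j < N → (modulus b j ∣ z ↔ j < i ∧ P j) := fun i => by
    refine induction_on (fun i => ∃ z, ∀ j, j < N → (modulus b j ∣ z ↔ j < i ∧ P j)) i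
      ⟨1, fun j _ => ⟨fun h => ?_, fun h => absurd h.1 not_lt_zero⟩⟩ ?_
    · obtain ⟨c, hc⟩ := h
      have : (1 : M.Num) < modulus b j * c := by
        have h1 : 1 < modulus b j := lt_add_of_pos_left _ (by positivity)
        have h2 : 0 < c := pos_iff_ne_zero.2 fun h => one_ne_zero (by rw [hc, h, mul_zero])
        exact h1.trans_le (le_mul_of_one_le_right zero_le (one_le_of_pos h2))
      exact absurd hc this.ne
    · rintro i ⟨z, hz⟩
      by_cases hPi : P i ∧ i < N
      · refine ⟨z * modulus b i, fun j hj => ?_⟩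
        rcases eq_or_ne j i with rfl | hji
        · exact ⟨fun _ => ⟨lt_succ_iff.2 le_rfl, hPi.1⟩, fun _ => dvd_mul_left _ _⟩
        · have h1 : modulus b j ∣ z * modulus b i ↔ modulus b j ∣ z :=
            ⟨dvd_of_modulus_dvd_mul hdvd hj hPi.2 hji, fun h => h.mul_right _⟩
          rw [h1, hz j hj, lt_succ_iff, le_iff_lt_or_eq, or_iff_left hji]
      · refine ⟨z, fun j hj => (hz j hj).trans (and_congr_left fun hPj => ?_)⟩
        rw [lt_succ_iff, le_iff_lt_or_eq, or_iff_left]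
        rintro rfl
        exact hPi ⟨hPj, hj⟩
  obtain ⟨z, hz⟩ := key N
  exact ⟨b, z, fun j hj => (hz j hj).trans (and_iff_right hj)⟩

/-! ## Existence of the exponential function -/

/-- `(b, z)` codes a set of pairs, closed under predecessors below `(n, y)`, for the recursion
`2 ^ 0 = 1`, `2 ^ (i + 1) = 2 ^ i + 2 ^ i`. -/
def PowClosed (b z n y : M.Num) : Prop :=
  ∀ i, i < n + 1 → ∀ u, u < y + 1 → modulus b (pair i u) ∣ z →
    (i = 0 ∧ u = 1) ∨ ∃ j, j < i ∧ ∃ w, w < u + 1 ∧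
      (i = j + 1 ∧ u = w + w ∧ modulus b (pair j w) ∣ z)

/-- `y = 2 ^ n`, witnessed by a coded computation. -/
def PowGraph (n y : M.Num) : Prop :=
  ∃ b z, modulus b (pair n y) ∣ z ∧ PowClosed b z n y

instance DefSig.powGraph (t s : (ℕ → M.Num) → M.Num) [DefTerm t] [DefTerm s] :
    DefSig (fun e => PowGraph (t e) (s e)) := by
  unfold PowGraph PowClosed
  infer_instance

theorem PowGraph.unique {n y y' : M.Num} (h : PowGraph n y) (h' : PowGraph n y') : y = y' := by
  obtain ⟨b, z, hm, hc⟩ := h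
  obtain ⟨b', z', hm', hc'⟩ := h'
  -- The values at `i` in the two computations are compared, with `u` and `u'` bounded so that the
  -- motive stays Σ⁰₀.
  have key := induction_on (fun i => i < n + 1 → ∀ u, u < y + 1 → ∀ u', u' < y' + 1 →
    modulus b (pair i u) ∣ z → modulus b' (pair i u') ∣ z' → u = u') n ?_ ?_
  · exact key (lt_succ_iff.2 le_rfl) y (lt_succ_iff.2 le_rfl) y' (lt_succ_iff.2 le_rfl) hm hm'
  · intro h0 u hu u' hu' hz hz'
    rcases hc 0 h0 u hu hz with ⟨-, rfl⟩ | ⟨j, hj, _⟩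
    · rcases hc' 0 h0 u' hu' hz' with ⟨-, rfl⟩ | ⟨j, hj, _⟩
      · rfl
      · exact absurd hj not_lt_zero
    · exact absurd hj not_lt_zero
  · intro i ih hi u hu u' hu' hz hz'
    rcases hc _ hi u hu hz with ⟨h0, -⟩ | ⟨j, _, w, hw, hj, rfl, hwz⟩
    · exact absurd h0 (hM.out.basic.succ_ne_zero i)
    · rcases hc' _ hi u' hu' hz' with ⟨h0, -⟩ | ⟨j', _, w', hw', hj', rfl, hwz'⟩
      · exact absurd h0 (hM.out.basic.succ_ne_zero i)
      · obtain rfl := add_right_cancel hj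
        obtain rfl := add_right_cancel hj'
        rw [ih (lt_of_le_of_lt le_self_add hi) w
          (lt_of_le_of_lt (lt_succ_iff.1 hw) hu) w' (lt_of_le_of_lt (lt_succ_iff.1 hw') hu') hwz
          hwz']

theorem powGraph_zero : PowGraph (0 : M.Num) 1 := by
  obtain ⟨b, z, h⟩ := exists_code (fun w : M.Num => w = pair 0 1) (pair 0 1 + 1)
  refine ⟨b, z, (h _ (lt_succ_iff.2 le_rfl)).2 rfl, fun i hi u hu hz => .inl ?_⟩
  have := (h (pair i u) (lt_succ_iff.2 (pair_mono (lt_succ_iff.1 hi) (lt_succ_iff.1 hu)))).1 hz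
  exact pair_inj.1 this

/-- The old code cannot be reused, since beyond its bounds it may contain junk. A fresh code keeps
only the pairs within the old bounds and adds the new value. -/
theorem PowGraph.succ {n y : M.Num} (h : PowGraph n y) : PowGraph (n + 1) (y + y) := by
  obtain ⟨b, z, hm, hc⟩ := h
  obtain ⟨b', z', h⟩ := exists_code (fun w : M.Num => w = pair (n + 1) (y + y) ∨
    ∃ i, i < n + 1 ∧ ∃ u, u < y + 1 ∧ (w = pair i u ∧ modulus b w ∣ z))
    (pair (n + 1) (y + y) + 1)
  have key : ∀ i u, i < n + 1 → u < y + 1 → modulus b (pair i u) ∣ z →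
      modulus b' (pair i u) ∣ z' := fun i u hi hu hz =>
    (h _ (lt_succ_iff.2 (pair_mono hi.le ((lt_succ_iff.1 hu).trans le_self_add)))).2
      (.inr ⟨i, hi, u, hu, rfl, hz⟩)
  refine ⟨b', z', (h _ (lt_succ_iff.2 le_rfl)).2 (.inl rfl), fun i hi u hu hz => ?_⟩
  rcases (h _ (lt_succ_iff.2 (pair_mono (lt_succ_iff.1 hi) (lt_succ_iff.1 hu)))).1 hz with
    h' | ⟨i', hi', u', hu', h', hz'⟩
  · obtain ⟨rfl, rfl⟩ := pair_inj.1 h'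
    exact .inr ⟨n, lt_succ_iff.2 le_rfl, y, lt_succ_iff.2 le_self_add, rfl, rfl,
      key _ _ (lt_succ_iff.2 le_rfl) (lt_succ_iff.2 le_rfl) hm⟩
  · obtain ⟨rfl, rfl⟩ := pair_inj.1 h'
    refine (hc i hi' u hu' hz').imp_right ?_
    rintro ⟨j, hj, w, hw, rfl, rfl, hwz⟩
    exact ⟨j, hj, w, hw, rfl, rfl, key _ _ (hj.trans hi')
      (lt_of_le_of_lt (lt_succ_iff.1 hw) hu') hwz⟩

theorem exists_powGraph (n : M.Num) : ∃ y, PowGraph n y :=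
  induction_on (fun n => ∃ y, PowGraph n y) n ⟨1, powGraph_zero⟩ fun _ ⟨y, h⟩ => ⟨y + y, h.succ⟩

/-- `E` is the graph of `n ↦ 2 ^ n`. -/
structure IsExp (E : Set M.Num) : Prop where
  mem_sets : E ∈ M.sets
  isFunction : IsFunction E Set.univ Set.univ
  zero : pair 0 1 ∈ E
  succ : ∀ n y : M.Num, pair n y ∈ E → pair (n + 1) (y + y) ∈ E

-- The graph is Σ⁰₁, and since it is total and single-valued its complement is Σ⁰₁ too: the true
-- value differs from the proposed one.
variable (M) in
theorem exists_isExp : ∃ E : Set M.Num, IsExp E := by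
  have hneg : DefSig (fun e : ℕ → M.Num => ¬ ∃ n y, e 0 = pair n y ∧ PowGraph n y) := by
    refine DefSig.of_iff (Q := fun e => (¬ ∃ n, n < e 0 + 1 ∧ ∃ y, y < e 0 + 1 ∧ e 0 = pair n y) ∨
      ∃ n y y' : M.Num, (e 0 = pair n y ∧ y ≠ y') ∧ PowGraph n y') fun e => ⟨fun h => ?_, ?_⟩
    · by_cases hp : ∃ n y, e 0 = pair n y
      · obtain ⟨n, y, hw⟩ := hp
        obtain ⟨y', hy'⟩ := exists_powGraph n
        exact .inr ⟨n, y, y', ⟨hw, fun hy => h ⟨n, y, hw, hy ▸ hy'⟩⟩, hy'⟩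
      · exact .inl fun ⟨n, _, y, _, hw⟩ => hp ⟨n, y, hw⟩
    · rintro (h | ⟨n, y, y', ⟨hw, hne⟩, h⟩) ⟨n', y'', hw', h'⟩
      · exact h ⟨n', by rw [hw']; exact lt_succ_iff.2 (left_le_pair _ _), y'',
          by rw [hw']; exact lt_succ_iff.2 (right_le_pair _ _), hw'⟩
      · obtain ⟨rfl, rfl⟩ := pair_inj.1 (hw.symm.trans hw')
        exact hne (h'.unique h)
  have hmem : ∀ {n y : M.Num}, pair n y ∈ {w : M.Num | ∃ n y, w = pair n y ∧ PowGraph n y} ↔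
      PowGraph n y := fun {n y} => by
    constructor
    · rintro ⟨n', y', hw, h⟩
      obtain ⟨rfl, rfl⟩ := pair_inj.1 hw
      exact h
    · exact fun h => ⟨n, y, rfl, h⟩
  refine ⟨_, (isSet_setOf (fun w : M.Num => ∃ n y, w = pair n y ∧ PowGraph n y)).mem,
    ⟨fun w ⟨n, y, hw, _⟩ => ⟨n, trivial, y, trivial, hw⟩, fun n _ => ?_⟩, hmem.2 powGraph_zero,
    fun n y h => hmem.2 (hmem.1 h).succ⟩
  obtain ⟨y, hy⟩ := exists_powGraph n
  exact ⟨y, ⟨trivial, hmem.2 hy⟩, fun y' h => (hmem.1 h.2).unique hy⟩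

/-! ## Sequences of fractions coded by sets -/

theorem val_two_div (v : M.Num) : (PreRat.ofNums (1 + 1) v).val = 2 * (1 / toFr v) := by
  rw [PreRat.val_ofNums, map_add, map_one, one_add_one_eq_two]
  ring

/-- `A` codes the sequence `a`. -/
def Repr (A : Set M.Num) (a : M.Num → Fr M) : Prop := ∀ k (q : M.Rat), At A k q ↔ q.1.val = a k

open Classical in
/-- The sequence of fractions coded by `A`. -/
noncomputable def rseq (A : Set M.Num) (k : M.Num) : Fr M :=
  if h : ∃ q : M.Rat, At A k q then h.choose.1.val else 0

theorem IsReal.exists_at {A : Set M.Num} (hA : IsReal A) (k : M.Num) : ∃ q : M.Rat, At A k q := by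
  obtain ⟨_, ⟨⟨q, rfl⟩, hq⟩, _⟩ := hA.2.1.2 k trivial
  exact ⟨q, hq⟩

theorem IsReal.repr {A : Set M.Num} (hA : IsReal A) : Repr A (rseq A) := by
  intro k q
  have h := hA.exists_at k
  have h' : At A k h.choose := h.choose_spec
  have hr : rseq A k = h.choose.1.val := dif_pos h
  rw [hr]
  refine ⟨fun hq => ?_, fun hq => rat_val_injective hq ▸ h'⟩
  have := (hA.2.1.2 k trivial).unique ⟨⟨q, rfl⟩, hq⟩ ⟨⟨_, rfl⟩, h'⟩
  rw [rat_code_inj.1 this]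

/-- `Repr` does not ask the coding set to belong to the model; inequalities of reals only inspect
terms, so derived codes need no comprehension. -/
theorem Repr.constReal {q : PreRat M} (hq : q.DenPos) : Repr (constReal q) fun _ => q.val := by
  intro k r
  constructor
  · rintro ⟨k', a, h, hc⟩
    obtain ⟨rfl, hc'⟩ := pair_inj.1 hc
    rw [rat_code_inj.1 hc']
    exact (PreRat.equiv_iff (rat_denPos a) hq).1 h
  · exact fun h => ⟨k, r, (PreRat.equiv_iff (rat_denPos r) hq).2 h, rfl⟩

theorem Repr.realSub {A B : Set M.Num} {a b : M.Num → Fr M} (hA : Repr A a) (hB : Repr B b) :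
    Repr (realSub A B) fun k => a (k + 1) - b (k + 1) := by
  intro k r
  constructor
  · rintro ⟨k', q, q', d, hq, hq', h, hc⟩
    obtain ⟨rfl, hc'⟩ := pair_inj.1 hc
    change _ = a (k + 1) - b (k + 1)
    rw [rat_code_inj.1 hc', ← (hA _ _).1 hq, ← (hB _ _).1 hq',
      ← PreRat.val_sub (rat_denPos q) (rat_denPos q')]
    exact (PreRat.equiv_iff (rat_denPos d) ((rat_denPos q).sub (rat_denPos q'))).1 h
  · intro h
    obtain ⟨q, hq⟩ := exists_rat (a (k + 1))
    obtain ⟨q', hq'⟩ := exists_rat (b (k + 1))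
    refine ⟨k, q, q', r, (hA _ _).2 hq, (hB _ _).2 hq', ?_, rfl⟩
    rw [PreRat.equiv_iff (rat_denPos r) ((rat_denPos q).sub (rat_denPos q')), h,
      PreRat.val_sub (rat_denPos q) (rat_denPos q'), hq, hq']

theorem Repr.realAbs {A : Set M.Num} {a : M.Num → Fr M} (hA : Repr A a) :
    Repr (realAbs A) fun k => |a k| := by
  intro k r
  constructor
  · rintro ⟨k', q, d, hq, h, hc⟩
    obtain ⟨rfl, hc'⟩ := pair_inj.1 hc
    change _ = |a k|
    rw [rat_code_inj.1 hc', ← (hA _ _).1 hq, ← PreRat.val_abs (rat_denPos q)]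
    exact (PreRat.equiv_iff (rat_denPos d) (rat_denPos q).abs).1 h
  · intro h
    obtain ⟨q, hq⟩ := exists_rat (a k)
    refine ⟨k, q, r, (hA _ _).2 hq, ?_, rfl⟩
    rw [PreRat.equiv_iff (rat_denPos r) (rat_denPos q).abs, h, PreRat.val_abs (rat_denPos q), hq]

theorem ratPos_iff {ε : M.Rat} : RatPos ε ↔ 0 < ε.1.val := by
  rw [RatPos, PreRat.lt_iff (PreRat.denPos_ofNums zero_lt_one) (rat_denPos ε)]
  simp

theorem repr_zero : Repr (constReal (.ofNums (0 : M.Num) 1)) fun _ => 0 := by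
  simpa using Repr.constReal (PreRat.denPos_ofNums (a := (0 : M.Num)) zero_lt_one)

theorem repr_one : Repr (constReal (.ofNums (1 : M.Num) 1)) fun _ => 1 := by
  simpa using Repr.constReal (PreRat.denPos_ofNums (a := (1 : M.Num)) zero_lt_one)

theorem Repr.eq {A : Set M.Num} {a b : M.Num → Fr M} (ha : Repr A a) (hb : Repr A b) : a = b := by
  funext k
  obtain ⟨q, hq⟩ := exists_rat (a k)
  rw [← hq]
  exact (hb k q).1 ((ha k q).2 hq)

/-! ## Powers of two -/

/-- Makes the existential quantifier over sets in `IsPow2` harmless: any exponential set may be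
replaced by the fixed `expSet M`. -/
theorem IsExp.eq_of_mem {E E' : Set M.Num} (hE : IsExp E) (hE' : IsExp E') {n y y' : M.Num}
    (h : pair n y ∈ E) (h' : pair n y' ∈ E') : y = y' := by
  have := IsSet.mk hE.mem_sets
  have := IsSet.mk hE'.mem_sets
  obtain ⟨v, hv, hv'⟩ := induction_on (fun n => ∃ v, pair n v ∈ E ∧ pair n v ∈ E') n
    ⟨1, hE.zero, hE'.zero⟩ fun n ⟨v, hv, hv'⟩ => ⟨v + v, hE.succ _ _ hv, hE'.succ _ _ hv'⟩
  rw [(hE.isFunction.2 n trivial).unique ⟨trivial, h⟩ ⟨trivial, hv⟩,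
    (hE'.isFunction.2 n trivial).unique ⟨trivial, h'⟩ ⟨trivial, hv'⟩]

variable (M) in
/-- The graph of `n ↦ 2 ^ n`. -/
def expSet : Set M.Num := (exists_isExp M).choose

theorem isExp_expSet : IsExp (expSet M) := (exists_isExp M).choose_spec

instance : IsSet (expSet M) := ⟨isExp_expSet.mem_sets⟩

/-- `2 ^ n`. -/
noncomputable def pow2 (n : M.Num) : M.Num := (isExp_expSet.isFunction.2 n trivial).choose

theorem pair_mem_expSet {n v : M.Num} : pair n v ∈ expSet M ↔ v = pow2 n := by
  have h := (isExp_expSet.isFunction.2 n trivial).choose_spec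
  exact ⟨fun h' => h.2 v ⟨trivial, h'⟩, fun h' => h' ▸ h.1.2⟩

theorem pow2_zero : pow2 (0 : M.Num) = 1 := (pair_mem_expSet.1 isExp_expSet.zero).symm

theorem pow2_succ (n : M.Num) : pow2 (n + 1) = pow2 n + pow2 n :=
  (pair_mem_expSet.1 (isExp_expSet.succ _ _ (pair_mem_expSet.2 rfl))).symm

theorem isPow2_iff {m v : M.Num} : IsPow2 m v ↔ v = pow2 m := by
  constructor
  · rintro ⟨E, h₁, h₂, h₃, h₄, h₅⟩
    exact IsExp.eq_of_mem ⟨h₁, h₂, h₃, h₄⟩ isExp_expSet h₅ (pair_mem_expSet.2 rfl)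
  · rintro rfl
    exact ⟨expSet M, isExp_expSet.1, isExp_expSet.2, isExp_expSet.3, isExp_expSet.4,
      pair_mem_expSet.2 rfl⟩

instance DefBdd.eq_pow2 (t s : (ℕ → M.Num) → M.Num) [DefTerm t] [DefTerm s] :
    DefBdd (fun e => s e = pow2 (t e)) :=
  DefBdd.of_iff (Q := fun e => pair (t e) (s e) ∈ expSet M) fun _ => pair_mem_expSet.symm

/-- Since `pow2` is not a term of the language, the induction carries its value as an existential
witness `v`. -/
theorem lt_pow2 (n : M.Num) : n < pow2 n := by
  obtain ⟨v, rfl, h⟩ := induction_on (fun n => ∃ v, v = pow2 n ∧ n < v) n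
    ⟨1, pow2_zero.symm, zero_lt_one⟩ fun n ⟨v, hv, h⟩ => ⟨v + v, by rw [pow2_succ, hv],
      add_lt_add_of_lt_of_le h (one_le_of_pos (zero_le.trans_lt h))⟩
  exact h

theorem pow2_pos (n : M.Num) : 0 < pow2 n := zero_le.trans_lt (lt_pow2 n)

theorem pow2_add (m n : M.Num) : pow2 (m + n) = pow2 m * pow2 n := by
  obtain ⟨v, hv, h⟩ := induction_on
    (fun n => ∃ v, v = pow2 n ∧ pow2 m * v = pow2 (m + n)) n
    ⟨1, pow2_zero.symm, by rw [add_zero, mul_one]⟩ fun n ⟨v, hv, h⟩ => ⟨v + v, by rw [pow2_succ, hv],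
      by rw [← add_assoc, pow2_succ, ← h]; ring⟩
  rw [← h, hv]

theorem pow2_mono {m n : M.Num} (h : m ≤ n) : pow2 m ≤ pow2 n := by
  obtain ⟨d, rfl⟩ := exists_add_of_le h
  rw [pow2_add]
  exact le_mul_of_one_le_right zero_le (one_le_of_pos (pow2_pos d))

/-- `2 ^ (-k)`. -/
noncomputable def eps (k : M.Num) : Fr M := 1 / toFr (pow2 k)

theorem eps_pos (k : M.Num) : 0 < eps k := one_div_pos.2 (toFr_pos.2 (pow2_pos k))

theorem eps_anti {m n : M.Num} (h : m ≤ n) : eps n ≤ eps m :=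
  one_div_le_one_div_of_le (toFr_pos.2 (pow2_pos m)) (toFr_le.2 (pow2_mono h))

theorem eps_succ (n : M.Num) : eps (n + 1) = eps n / 2 := by
  rw [eps, eps, pow2_succ, map_add, ← two_mul, div_div, mul_comm]

theorem exists_eps_lt {ε : Fr M} (hε : 0 < ε) : ∃ k, eps k < ε := by
  obtain ⟨u, hu, h⟩ := exists_inv_lt hε
  exact ⟨u, (one_div_le_one_div_of_le (toFr_pos.2 hu) (toFr_le.2 (lt_pow2 u).le)).trans_lt h⟩

theorem le_of_forall_eps {x y : Fr M} (c : Fr M) (hc : 0 < c) (h : ∀ k, x ≤ y + c * eps k) :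
    x ≤ y := by
  by_contra! hlt
  obtain ⟨k, hk⟩ := exists_eps_lt (div_pos (sub_pos.2 hlt) hc)
  have := h k
  rw [lt_div_iff₀ hc] at hk
  linarith

/-! ## Real numbers as sequences of fractions -/

/-- `a` satisfies the convergence condition of a real number. -/
def Regular (a : M.Num → Fr M) : Prop := ∀ m n, m ≤ n → |a m - a n| ≤ eps m

theorem Regular.abs_sub_le {a : M.Num → Fr M} (ha : Regular a) (m n : M.Num) :
    |a m - a n| ≤ eps m + eps n := by
  rcases le_total m n with h | h
  · exact (ha m n h).trans (le_add_of_nonneg_right (eps_pos _).le)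
  · rw [abs_sub_comm]
    exact (ha n m h).trans (le_add_of_nonneg_left (eps_pos _).le)

theorem Regular.le {a : M.Num → Fr M} (ha : Regular a) (m n : M.Num) :
    a m ≤ a n + eps m + eps n := by
  linarith [le_abs_self (a m - a n), ha.abs_sub_le m n]

theorem IsReal.regular {A : Set M.Num} (hA : IsReal A) : Regular (rseq A) := by
  intro m n hmn
  obtain ⟨q, hq⟩ := hA.exists_at m
  obtain ⟨r, hr⟩ := hA.exists_at n
  obtain ⟨v, hv, h⟩ := hA.2.2 m n q r hmn hq hr
  have hd := (rat_denPos q).sub (rat_denPos r)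
  rw [isPow2_iff] at hv
  subst hv
  rw [PreRat.le_iff hd.abs (PreRat.denPos_ofNums (pow2_pos _)), PreRat.val_abs hd,
    PreRat.val_sub (rat_denPos q) (rat_denPos r), (hA.repr _ _).1 hq, (hA.repr _ _).1 hr] at h
  simpa [eps] using h

theorem isReal_of_repr {A : Set M.Num} {a : M.Num → Fr M} (hA : A ∈ M.sets) (h : Repr A a)
    (hc : ∀ c ∈ A, ∃ k, ∃ q : M.Rat, c = pair k q.1.code) (ha : Regular a) : IsReal A := by
  refine ⟨hA, ⟨fun c hcA => ?_, fun k _ => ?_⟩, fun m n q r hmn hq hr =>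
    ⟨pow2 m, isPow2_iff.2 rfl, ?_⟩⟩
  · obtain ⟨k, q, rfl⟩ := hc c hcA
    exact ⟨k, trivial, _, ⟨q, rfl⟩, rfl⟩
  · obtain ⟨q, hq⟩ := exists_rat (a k)
    refine ⟨q.1.code, ⟨⟨q, rfl⟩, (h k q).2 hq⟩, ?_⟩
    rintro _ ⟨⟨r, rfl⟩, hr⟩
    rw [rat_val_injective (hq.trans ((h k r).1 hr).symm)]
  · have hd := (rat_denPos q).sub (rat_denPos r)
    rw [PreRat.le_iff hd.abs (PreRat.denPos_ofNums (pow2_pos _)), PreRat.val_abs hd,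
      PreRat.val_sub (rat_denPos q) (rat_denPos r), (h _ _).1 hq, (h _ _).1 hr]
    simpa [eps] using ha m n hmn

theorem realLe_iff {A B : Set M.Num} {a b : M.Num → Fr M} (hA : Repr A a) (hB : Repr B b) :
    RealLe A B ↔ ∀ k, a k ≤ b k + 2 * eps k := by
  have key : ∀ (k : M.Num) (q r : M.Rat),
      q.1.Le (r.1.add (.ofNums (1 + 1) (pow2 k))) ↔ q.1.val ≤ r.1.val + 2 * eps k := fun k q r => by
    have hd : (PreRat.ofNums (1 + 1) (pow2 k)).DenPos := PreRat.denPos_ofNums (pow2_pos k)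
    rw [PreRat.le_iff (rat_denPos q) ((rat_denPos r).add hd), PreRat.val_add (rat_denPos r) hd,
      val_two_div]
    rfl
  constructor
  · intro h k
    obtain ⟨q, hq⟩ := exists_rat (a k)
    obtain ⟨r, hr⟩ := exists_rat (b k)
    obtain ⟨v, hv, h⟩ := h k q r ((hA _ _).2 hq) ((hB _ _).2 hr)
    rw [isPow2_iff.1 hv, key, hq, hr] at h
    exact h
  · intro h k q r hq hr
    refine ⟨pow2 k, isPow2_iff.2 rfl, ?_⟩
    rw [key, (hA _ _).1 hq, (hB _ _).1 hr]
    exact h k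

theorem realLt_iff {A B : Set M.Num} {a b : M.Num → Fr M} (hA : Repr A a) (hB : Repr B b) :
    RealLt A B ↔ ∃ k, a k + 2 * eps k < b k := by
  simp [RealLt, realLe_iff hB hA]

theorem distLe_iff {A B : Set M.Num} {a b : M.Num → Fr M} (hA : Repr A a) (hB : Repr B b)
    (ε : M.Rat) : DistLe A B ε ↔ ∀ k, |a (k + 1) - b (k + 1)| ≤ ε.1.val + 2 * eps k :=
  realLe_iff (hA.realSub hB).realAbs (Repr.constReal (rat_denPos ε))

theorem realEq_iff {A B : Set M.Num} {a b : M.Num → Fr M} (hA : Repr A a) (hB : Repr B b) :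
    RealEq A B ↔ ∀ k, |a k - b k| ≤ 2 * eps k := by
  have key : ∀ (k : M.Num) (q r : M.Rat),
      (q.1.sub r.1).abs.Le (.ofNums (1 + 1) (pow2 k)) ↔ |q.1.val - r.1.val| ≤ 2 * eps k :=
    fun k q r => by
      have hd := (rat_denPos q).sub (rat_denPos r)
      rw [PreRat.le_iff hd.abs (PreRat.denPos_ofNums (pow2_pos k)), PreRat.val_abs hd,
        PreRat.val_sub (rat_denPos q) (rat_denPos r), val_two_div]
      rfl
  constructor
  · intro h k
    obtain ⟨q, hq⟩ := exists_rat (a k)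
    obtain ⟨r, hr⟩ := exists_rat (b k)
    obtain ⟨v, hv, h⟩ := h k q r ((hA _ _).2 hq) ((hB _ _).2 hr)
    rw [isPow2_iff.1 hv, key, hq, hr] at h
    exact h
  · intro h k q r hq hr
    refine ⟨pow2 k, isPow2_iff.2 rfl, ?_⟩
    rw [key, (hA _ _).1 hq, (hB _ _).1 hr]
    exact h k

theorem inUnit_iff {A : Set M.Num} : InUnit A ↔
    IsReal A ∧ (∀ k, 0 ≤ rseq A k + 2 * eps k) ∧ ∀ k, rseq A k ≤ 1 + 2 * eps k :=
  and_congr_right fun hA => by rw [realLe_iff repr_zero hA.repr, realLe_iff hA.repr repr_one]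

theorem IsReal.const_lt_iff {A : Set M.Num} (hA : IsReal A) (q : M.Rat) :
    RealLt (constReal q.1) A ↔ ∃ k, q.1.val + 2 * eps k < rseq A k :=
  realLt_iff (Repr.constReal (rat_denPos q)) hA.repr

theorem IsReal.lt_const_iff {A : Set M.Num} (hA : IsReal A) (q : M.Rat) :
    RealLt A (constReal q.1) ↔ ∃ k, rseq A k + 2 * eps k < q.1.val :=
  realLt_iff hA.repr (Repr.constReal (rat_denPos q))

/-- A real number given by a `Σ⁰₁` description of its terms. -/
theorem exists_isReal_of_def (a : M.Num → Fr M) (ha : Regular a) (R : M.Num → PreRat M → Prop)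
    (hdef : ∀ (t : (ℕ → M.Num) → M.Num) (q : (ℕ → M.Num) → PreRat M) [DefTerm t] [DefRat q],
      DefSig (fun e => R (t e) (q e)))
    (hR : ∀ k (q : M.Rat), R k q.1 ↔ q.1.val = a k) : ∃ A : Set M.Num, IsReal A ∧ Repr A a := by
  let P : M.Num → Prop := fun c => ∃ k, ∃ q : PreRat M, q.IsRat ∧ c = pair k q.code ∧ R k q
  have h1 : DefSig (fun e => P (e 0)) := inferInstanceAs
    (DefSig (fun e => ∃ k, ∃ q : PreRat M, q.IsRat ∧ e 0 = pair k q.code ∧ R k q))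
  have h2 : DefSig (fun e => ¬ P (e 0)) := by
    -- A number is outside the set if it is not the code of an index with a rational, or if the
    -- described term at that index is a different rational.
    refine DefSig.of_iff (Q := fun e => (¬ ∃ k, k < e 0 + 1 ∧ ∃ q : PreRat M, q.code < e 0 + 1 ∧
      (q.IsRat ∧ e 0 = pair k q.code)) ∨
      ∃ k, ∃ q r : PreRat M, (q.IsRat ∧ r.IsRat ∧ e 0 = pair k q.code ∧ ¬ q.code = r.code) ∧
        R k r) fun e => ⟨fun h => ?_, ?_⟩
    · by_cases hc : ∃ k, ∃ q : PreRat M, q.IsRat ∧ e 0 = pair k q.code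
      · obtain ⟨k, q, hq, hc⟩ := hc
        obtain ⟨r, hr⟩ := exists_rat (a k)
        refine .inr ⟨k, q, r.1, ⟨hq, r.2, hc, fun hqr => h ⟨k, q, hq, hc, ?_⟩⟩, (hR _ _).2 hr⟩
        rw [PreRat.code_injective hqr]
        exact (hR _ _).2 hr
      · exact .inl fun ⟨k, _, q, _, hq, h'⟩ => hc ⟨k, q, hq, h'⟩
    · rintro (h | ⟨k, q, r, ⟨hq, hr, hc, hne⟩, h⟩) ⟨k', q', hq', hc', h'⟩
      · exact h ⟨k', by rw [hc']; exact lt_succ_iff.2 (left_le_pair _ _), q',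
          by rw [hc']; exact lt_succ_iff.2 (right_le_pair _ _), hq', hc'⟩
      · obtain ⟨rfl, hcc⟩ := pair_inj.1 (hc.symm.trans hc')
        have e1 := (hR k ⟨r, hr⟩).1 h
        have e2 := (hR k ⟨q', hq'⟩).1 h'
        have := congrArg Subtype.val (rat_val_injective (e1.trans e2.symm))
        exact hne (hcc.trans (by rw [show r = q' from this]))
  have hA : Repr {c | P c} a := fun k q => by
    rw [← hR]
    constructor
    · rintro ⟨k', q', hq', hc, h⟩
      obtain ⟨rfl, hc'⟩ := pair_inj.1 hc
      rwa [PreRat.code_injective hc']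
    · exact fun h => ⟨k, q.1, q.2, rfl, h⟩
  exact ⟨_, isReal_of_repr (isSet_setOf P).mem hA
    (fun c ⟨k, q, hq, hc, _⟩ => ⟨k, ⟨q, hq⟩, hc⟩) ha, hA⟩

/-! ## Division and parity -/

theorem exists_div (v c : M.Num) (hv : 0 < v) : ∃ h r, r < v ∧ c = h * v + r := by
  refine induction_on (fun c => ∃ h r, r < v ∧ c = h * v + r) c ⟨0, 0, hv, by ring⟩ ?_
  rintro c ⟨h, r, hr, rfl⟩
  rcases (succ_le_iff.2 hr).lt_or_eq with h' | h'
  · exact ⟨h, r + 1, h', by ring⟩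
  · exact ⟨h + 1, 0, hv, by rw [← h']; ring⟩

theorem mul_add_lt_mul {h h' v r : M.Num} (hr : r < v) (hh : h < h') : h * v + r < h' * v := by
  obtain ⟨d, rfl⟩ := exists_add_of_le (succ_le_iff.2 hh)
  calc h * v + r < h * v + v := by gcongr
    _ ≤ (h + 1 + d) * v := by
      rw [show (h + 1 + d) * v = h * v + v + d * v by ring]
      exact le_self_add

theorem div_unique {h h' v r r' : M.Num} (hr : r < v) (hr' : r' < v)
    (e : h * v + r = h' * v + r') : h = h' := by
  rcases lt_trichotomy h h' with hh | hh | hh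
  · exact absurd e ((mul_add_lt_mul hr hh).trans_le le_self_add).ne
  · exact hh
  · exact absurd e ((mul_add_lt_mul hr' hh).trans_le le_self_add).ne'

theorem odd_ne_even (a b : M.Num) : a + a + 1 ≠ b + b := by
  intro h
  have h2 : a * (1 + 1) + 1 = b * (1 + 1) + 0 := by rw [add_zero, mul_add, mul_one, h]; ring
  have h3 := div_unique (lt_succ_iff.2 le_rfl) (by positivity) h2
  rw [h3] at h2
  exact one_ne_zero (add_left_cancel h2)

theorem even_or_odd (c : M.Num) : ∃ g, c = g + g ∨ c = g + g + 1 := by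
  obtain ⟨h, r, hr, rfl⟩ := exists_div (1 + 1) c (by positivity)
  refine ⟨h, ?_⟩
  rcases (lt_succ_iff.1 hr).lt_or_eq with h' | rfl
  · left
    rw [← zero_add (1 : M.Num), lt_succ_iff, le_zero_iff] at h'
    rw [h']
    ring
  · right
    ring

theorem double_lt_double {a b : M.Num} : a + a < b + b ↔ a < b :=
  ⟨fun h => not_le.1 fun h' => not_le.2 h (add_le_add h' h'), fun h => add_lt_add h h⟩

theorem double_inj {a b : M.Num} (h : a + a = b + b) : a = b := by
  rcases lt_trichotomy a b with h' | h' | h'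
  · exact absurd h (double_lt_double.2 h').ne
  · exact h'
  · exact absurd h (double_lt_double.2 h').ne'

/-! ## Binary digits -/

/-- The digit of weight `2 ^ i` of `c` is `1`. -/
def Bit (i c : M.Num) : Prop :=
  ∃ v, v < c + 1 ∧ (v = pow2 i ∧ ∃ h, h < c + 1 ∧ ∃ r, r < v ∧ c = (h + h + 1) * v + r)

instance DefBdd.bit (t s : (ℕ → M.Num) → M.Num) [DefTerm t] [DefTerm s] :
    DefBdd (fun e => Bit (t e) (s e)) := by
  unfold Bit
  infer_instance

theorem bit_iff {i c : M.Num} : Bit i c ↔ ∃ h r, r < pow2 i ∧ c = (h + h + 1) * pow2 i + r := by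
  constructor
  · rintro ⟨_, _, rfl, h, _, r, hr, hc⟩
    exact ⟨h, r, hr, hc⟩
  · rintro ⟨h, r, hr, rfl⟩
    have h1 : pow2 i ≤ (h + h + 1) * pow2 i + r :=
      (le_mul_of_one_le_left zero_le le_add_self).trans le_self_add
    refine ⟨_, lt_succ_iff.2 h1, rfl, h, lt_succ_iff.2 ?_, r, hr, rfl⟩
    refine le_trans ?_ le_self_add
    exact (le_self_add.trans le_self_add).trans
      (le_mul_of_one_le_right zero_le (one_le_of_pos (pow2_pos i)))

theorem exists_of_not_bit {i c : M.Num} (h : ¬ Bit i c) :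
    ∃ g r, r < pow2 i ∧ c = (g + g) * pow2 i + r := by
  obtain ⟨d, r, hr, rfl⟩ := exists_div (pow2 i) c (pow2_pos i)
  obtain ⟨g, rfl | rfl⟩ := even_or_odd d
  · exact ⟨g, r, hr, rfl⟩
  · exact absurd (bit_iff.2 ⟨g, r, hr, rfl⟩) h

theorem exists_pow2_of_lt {i j : M.Num} (h : i < j) : ∃ d, pow2 j = (d + d) * pow2 i := by
  obtain ⟨k, rfl⟩ := exists_add_of_le (succ_le_iff.2 h)
  exact ⟨pow2 k, by rw [pow2_add, pow2_succ]; ring⟩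

/-- No carry occurs, so filling an empty place `i` changes no other digit. -/
theorem bit_add_pow2 {i j c : M.Num} (h : ¬ Bit i c) (hj : Bit j (c + pow2 i)) :
    j = i ∨ Bit j c := by
  obtain ⟨g, r, hr, hc⟩ := exists_of_not_bit h
  obtain ⟨l, s, hs, hl⟩ := bit_iff.1 hj
  rcases lt_trichotomy j i with hji | hji | hji
  · right
    obtain ⟨d, hd⟩ := exists_pow2_of_lt hji
    -- Below place `i`, the summand `pow2 i` is an even multiple of `pow2 j`; it affects only the
    -- quotient, from which it can be subtracted.
    have hdl : d ≤ l := by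
      by_contra! hlt
      have h1 : (l + l + 1) * pow2 j + s < (d + d) * pow2 j := by
        refine mul_add_lt_mul hs ?_
        calc l + l + 1 < l + 1 + (l + 1) := by
              rw [show l + 1 + (l + 1) = l + l + 1 + 1 by ring]
              exact lt_succ_iff.2 le_rfl
          _ ≤ d + d := add_le_add (succ_le_iff.2 hlt) (succ_le_iff.2 hlt)
      rw [← hl, ← hd] at h1
      exact absurd h1 (not_lt.2 le_add_self)
    obtain ⟨k, rfl⟩ := exists_add_of_le hdl
    refine bit_iff.2 ⟨k, s, hs, add_right_cancel (b := pow2 i) ?_⟩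
    rw [hl, hd]
    ring
  · exact .inl hji
  · right
    obtain ⟨d, hd⟩ := exists_pow2_of_lt hji
    -- Above place `i`, the summand lies inside the remainder `s`. Otherwise the quotient by `pow2
    -- i` would be both odd (digit `i` was just set) and even.
    have hle : pow2 i ≤ s := by
      by_contra! hlt
      have := div_unique (h := g + g + 1) (h' := (l + l + 1) * (d + d)) hr hlt (by
        rw [mul_assoc, ← hd, ← hl, hc]
        ring)
      exact odd_ne_even g ((l + l + 1) * d) (by rw [this]; ring)
    obtain ⟨k, rfl⟩ := exists_add_of_le hle
    refine bit_iff.2 ⟨l, k, lt_of_le_of_lt le_add_self hs, add_right_cancel (b := pow2 i) ?_⟩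
    rw [hl]
    ring

theorem add_pow2_lt {i n c : M.Num} (h : ¬ Bit i c) (hi : i < n) (hc : c < pow2 n) :
    c + pow2 i < pow2 n := by
  obtain ⟨g, r, hr, rfl⟩ := exists_of_not_bit h
  obtain ⟨d, hd⟩ := exists_pow2_of_lt hi
  have hgd : g < d := by
    by_contra! hle
    refine absurd hc (not_lt.2 ?_)
    rw [hd]
    refine le_trans ?_ le_self_add
    gcongr
  rw [hd, show (g + g) * pow2 i + r + pow2 i = (g + g + 1) * pow2 i + r by ring]
  refine mul_add_lt_mul hr ?_
  calc g + g + 1 < g + 1 + (g + 1) := by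
        rw [show g + 1 + (g + 1) = g + g + 1 + 1 by ring]
        exact lt_succ_iff.2 le_rfl
    _ ≤ d + d := add_le_add (succ_le_iff.2 hgd) (succ_le_iff.2 hgd)

theorem not_bit_zero_double (c : M.Num) : ¬ Bit 0 (c + c) := by
  intro h
  obtain ⟨h, r, hr, hc⟩ := bit_iff.1 h
  rw [pow2_zero, ← zero_add (1 : M.Num), lt_succ_iff, le_zero_iff] at hr
  rw [hr, pow2_zero, mul_one, add_zero] at hc
  exact odd_ne_even h c hc.symm

theorem bit_of_bit_succ_double {i c : M.Num} (h : Bit (i + 1) (c + c)) : Bit i c := by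
  obtain ⟨h, r, hr, hc⟩ := bit_iff.1 h
  rw [pow2_succ] at hr hc
  obtain ⟨s, rfl | rfl⟩ := even_or_odd r
  · refine bit_iff.2 ⟨h, s, double_lt_double.1 hr, double_inj ?_⟩
    rw [hc]
    ring
  · refine absurd ?_ (odd_ne_even ((h + h + 1) * pow2 i + s) c)
    rw [hc]
    ring

/-! ## Approximations to the characteristic number of a range -/

section Approx

variable (Θ : Set M.Num)

/-- `k` has been enumerated before stage `n`. -/
def Stage (n k : M.Num) : Prop := ∃ m, m < n ∧ pair k m ∈ Θ

theorem Stage.mono {Θ : Set M.Num} {n n' k : M.Num} (h : Stage Θ n k) (hn : n ≤ n') : Stage Θ n' k :=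
  let ⟨m, hm, h⟩ := h
  ⟨m, hm.trans_le hn, h⟩

/-- Every nonzero digit of `c`, written with `n` binary digits, is at a place which is enumerated
before stage `n`. -/
def Admissible (n c : M.Num) : Prop :=
  ∀ k, k < n → ∀ i, i < n → (k + i + 1 = n ∧ Bit i c) → Stage Θ n k

variable [IsSet Θ]

instance DefBdd.stage (t s : (ℕ → M.Num) → M.Num) [DefTerm t] [DefTerm s] :
    DefBdd (fun e => Stage Θ (t e) (s e)) := by
  unfold Stage
  infer_instance

instance DefBdd.admissible (t s : (ℕ → M.Num) → M.Num) [DefTerm t] [DefTerm s] :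
    DefBdd (fun e => Admissible Θ (t e) (s e)) := by
  unfold Admissible
  infer_instance

/-- Defining the approximation as a maximum avoids summing powers of two by recursion: admissibility
is Σ⁰₀, and monotonicity and jumps follow from maximality. -/
theorem exists_approx (n : M.Num) : ∃ c, (c < pow2 n ∧ Admissible Θ n c) ∧
    ∀ c', (c' < pow2 n ∧ Admissible Θ n c') → c' ≤ c := by
  refine exists_greatest (fun c => c < pow2 n ∧ Admissible Θ n c) (pow2 n)
    ⟨0, pow2_pos n, fun k _ i _ ⟨_, h⟩ => ?_⟩ fun c hc => hc.1.le
  rw [← add_zero (0 : M.Num)] at h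
  rcases Arith.eq_zero_or_succ i with rfl | ⟨i, rfl⟩
  · exact absurd h (not_bit_zero_double 0)
  · obtain ⟨h, r, hr, hc⟩ := bit_iff.1 h
    rw [add_zero] at hc
    refine absurd hc.symm (ne_of_gt ?_)
    exact (mul_pos (by positivity) (pow2_pos _)).trans_le le_self_add

/-- The largest admissible number with `n` digits. -/
noncomputable def approx (n : M.Num) : M.Num := (exists_approx Θ n).choose

theorem approx_lt (n : M.Num) : approx Θ n < pow2 n := (exists_approx Θ n).choose_spec.1.1

theorem approx_admissible (n : M.Num) : Admissible Θ n (approx Θ n) :=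
  (exists_approx Θ n).choose_spec.1.2

theorem le_approx {n c : M.Num} (h : c < pow2 n) (hc : Admissible Θ n c) : c ≤ approx Θ n :=
  (exists_approx Θ n).choose_spec.2 c ⟨h, hc⟩

instance DefSig.eq_approx (t s : (ℕ → M.Num) → M.Num) [DefTerm t] [DefTerm s] :
    DefSig (fun e => s e = approx Θ (t e)) := by
  refine DefSig.of_iff (Q := fun e => ∃ v, v = pow2 (t e) ∧ (s e < v ∧ Admissible Θ (t e) (s e) ∧
    ∀ c, c < v → Admissible Θ (t e) c → c ≤ s e)) fun e => ⟨?_, ?_⟩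
  · intro h
    rw [h]
    exact ⟨_, rfl, approx_lt Θ _, approx_admissible Θ _, fun c hc h => le_approx Θ hc h⟩
  · rintro ⟨_, rfl, h, h', h''⟩
    exact _root_.le_antisymm (le_approx Θ h h') (h'' _ (approx_lt Θ _) (approx_admissible Θ _))

variable {Θ}

/-- Doubling moves the weights by one while the number of digits grows by one, so place `k`, counted
from the top, keeps its digit and the new last place is 0. -/
theorem Admissible.double {n c : M.Num} (h : Admissible Θ n c) : Admissible Θ (n + 1) (c + c) := by
  rintro k _ i _ ⟨hki, hi⟩
  rcases Arith.eq_zero_or_succ i with rfl | ⟨i, rfl⟩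
  · exact absurd hi (not_bit_zero_double c)
  · have hn : k + i + 1 = n := by
      have := add_right_cancel hki
      rwa [← add_assoc] at this
    refine (h k ?_ i ?_ ⟨hn, bit_of_bit_succ_double hi⟩).mono (lt_succ_iff.2 le_rfl).le
    · rw [← hn, lt_succ_iff]; exact le_self_add
    · rw [← hn, lt_succ_iff]; exact le_add_self

theorem approx_double_le (n : M.Num) : approx Θ n + approx Θ n ≤ approx Θ (n + 1) :=
  le_approx Θ (by rw [pow2_succ]; exact double_lt_double.2 (approx_lt Θ n))
    (approx_admissible Θ n).double

/-- When `k` is enumerated exactly at stage `n`, place `k` among `n + 1` digits has weight `pow2 (n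
- k)`. It is still empty in the doubled approximation and may now be filled. -/
theorem approx_jump {n k i : M.Num} (hn : k + i = n) (h : ¬ Stage Θ n k) (h' : Stage Θ (n + 1) k) :
    approx Θ n + approx Θ n + pow2 i ≤ approx Θ (n + 1) := by
  have hbit : ¬ Bit i (approx Θ n + approx Θ n) := by
    intro hi
    rcases Arith.eq_zero_or_succ i with rfl | ⟨i, rfl⟩
    · exact not_bit_zero_double _ hi
    · rw [← add_assoc] at hn
      refine h (approx_admissible Θ n k ?_ i ?_ ⟨hn, bit_of_bit_succ_double hi⟩)
      · rw [← hn, lt_succ_iff]; exact le_self_add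
      · rw [← hn, lt_succ_iff]; exact le_add_self
  refine le_approx Θ (add_pow2_lt hbit ?_ ?_) ?_
  · rw [← hn, lt_succ_iff]; exact le_add_self
  · rw [pow2_succ]; exact double_lt_double.2 (approx_lt Θ n)
  · rintro l hl j hj ⟨hlj, hb⟩
    rcases bit_add_pow2 hbit hb with rfl | hb
    · rw [← hn] at hlj
      rwa [add_right_cancel (add_right_cancel hlj)]
    · exact (approx_admissible Θ n).double l hl j hj ⟨hlj, hb⟩

variable (Θ) in
/-- The approximation at stage `n` as a fraction. -/
noncomputable def apx (n : M.Num) : Fr M := toFr (approx Θ n) * eps n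

theorem apx_nonneg (n : M.Num) : 0 ≤ apx Θ n := mul_nonneg (toFr_nonneg _) (eps_pos n).le

theorem apx_lt_one (n : M.Num) : apx Θ n < 1 := by
  rw [apx, eps, mul_one_div, div_lt_one (toFr_pos.2 (pow2_pos n)), toFr_lt]
  exact approx_lt Θ n

theorem val_approx (n : M.Num) : (PreRat.ofNums (approx Θ n) (pow2 n)).val = apx Θ n := by
  rw [PreRat.val_ofNums, apx, eps, mul_one_div]

theorem apx_mono {m n : M.Num} (h : m ≤ n) : apx Θ m ≤ apx Θ n := by
  obtain ⟨d, rfl⟩ := exists_add_of_le h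
  obtain ⟨_, _, rfl, rfl, hd⟩ := induction_on
    (fun d => ∃ c v, c = approx Θ (m + d) ∧ (v = pow2 d ∧ approx Θ m * v ≤ c)) d
    ⟨_, _, rfl, rfl, by rw [add_zero, pow2_zero, mul_one]⟩ fun d ⟨c, v, hc, hv, h⟩ =>
      ⟨_, _, rfl, rfl, by
        rw [← add_assoc, pow2_succ, mul_add, ← hv]
        exact (add_le_add (h.trans_eq hc) (h.trans_eq hc)).trans (approx_double_le _)⟩
  rw [apx, apx, eps, eps, mul_one_div, mul_one_div,
    div_le_div_iff₀ (toFr_pos.2 (pow2_pos _)) (toFr_pos.2 (pow2_pos _)), ← map_mul, ← map_mul,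
    toFr_le, pow2_add]
  calc _ = approx Θ m * pow2 d * pow2 m := by ring
    _ ≤ _ := by gcongr

theorem apx_jump {n k : M.Num} (hn : k ≤ n) (h : ¬ Stage Θ n k) (h' : Stage Θ (n + 1) k) :
    apx Θ n + eps (k + 1) ≤ apx Θ (n + 1) := by
  obtain ⟨i, rfl⟩ := exists_add_of_le hn
  have h1 := toFr_le.2 (approx_jump rfl h h')
  have hp : ∀ k : M.Num, 0 < toFr (pow2 k) := fun k => toFr_pos.2 (pow2_pos k)
  rw [map_add, map_add] at h1
  rw [apx, apx, eps_succ, eps_succ]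
  have h2 : toFr (pow2 i) * eps (k + i) = eps k := by
    rw [eps, eps, pow2_add, map_mul]
    field_simp [(hp k).ne', (hp i).ne']
  have := mul_le_mul_of_nonneg_right h1 (eps_pos (k + i)).le
  linarith

/-- The decoding principle: once `n ≥ k` and later approximations stay within less than `2 ^ (-k-1)`
of stage `n`, a `k` not enumerated before stage `n` never is. The jump occurs at the least stage `l`
that contains `k`. -/
theorem apx_add_eps_le {n m k : M.Num} (hn : k ≤ n) (h : ¬ Stage Θ n k) (h' : Stage Θ m k) :
    apx Θ n + eps (k + 1) ≤ apx Θ m := by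
  obtain ⟨l, hl, hmin⟩ := exists_least (fun l => Stage Θ l k) ⟨m, h'⟩
  have hlm : l ≤ m := not_lt.1 fun hlt => hmin m hlt h'
  have hnl : n < l := not_le.1 fun hle => h (hl.mono hle)
  obtain ⟨l, rfl⟩ : ∃ l', l = l' + 1 :=
    (Arith.eq_zero_or_succ l).resolve_left (zero_le.trans_lt hnl).ne'
  rw [lt_succ_iff] at hnl
  have h1 := apx_jump (hn.trans hnl) (hmin l (lt_succ_iff.2 le_rfl)) hl
  linarith [apx_mono (Θ := Θ) hnl, apx_mono (Θ := Θ) hlm]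

/-- Bounded increasing sequences are Cauchy even without a limit: if `1 / u < ε`, then `u + 1`
increments larger than `ε` would exceed 1. The number `j` of increments is the induction variable,
with denominators cleared to keep the motive Σ⁰₁. -/
theorem exists_forall_apx_le {ε : Fr M} (hε : 0 < ε) :
    ∃ N, ∀ n, N ≤ n → apx Θ n ≤ apx Θ N + ε := by
  by_contra! hc
  obtain ⟨u, hu, huε⟩ := exists_inv_lt hε
  have hu' : 0 < toFr u := toFr_pos.2 hu
  have key : ∀ (j n : M.Num),
      j * pow2 n ≤ approx Θ n * u ↔ toFr j * (1 / toFr u) ≤ apx Θ n := fun j n => by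
    rw [apx, eps, mul_one_div, mul_one_div, div_le_div_iff₀ hu' (toFr_pos.2 (pow2_pos n)),
      ← map_mul, ← map_mul, toFr_le]
  obtain ⟨n, _, _, rfl, rfl, h⟩ := induction_on
    (fun j => ∃ n c v, c = approx Θ n ∧ (v = pow2 n ∧ j * v ≤ c * u)) (u + 1)
    ⟨0, _, _, rfl, rfl, by rw [zero_mul]; exact zero_le⟩ fun j ⟨N, c, v, hc', hv, h⟩ => by
      obtain ⟨n, _, hn⟩ := hc N
      refine ⟨n, _, _, rfl, rfl, (key _ _).2 ?_⟩
      rw [hc', hv, key] at h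
      rw [map_add, map_one, add_mul, one_mul]
      linarith
  rw [key, map_add, map_one, add_mul, mul_one_div_cancel hu'.ne'] at h
  have := one_div_pos.2 hu'
  linarith [apx_lt_one (Θ := Θ) n]

set_option synthInstance.maxSize 4096 in
/-- If the approximations converge, then the range exists. -/
theorem isSet_range_of_limit {x : Set M.Num} (hx : IsReal x) (C : M.Num)
    (hlim : ∀ ε : Fr M, 0 < ε → ∃ N, ∀ m, N ≤ m → ∀ i,
      |rseq x i - apx Θ m| ≤ ε + toFr C * eps i) :
    IsSet {k | ∃ m, pair k m ∈ Θ} := by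
  have := IsSet.mk hx.1
  have hneg : DefSig (fun e : ℕ → M.Num => ¬ ∃ m, pair (e 0) m ∈ Θ) := by
    -- To certify that `k` is never enumerated, exhibit a stage `n ≥ k` without `k` and a term of
    -- `x` showing that the limit lies below the value forced by a later jump. The slack `C * 2 ^
    -- (-i)` covers the error of that term.
    refine DefSig.of_iff (Q := fun e => ∃ n i, ∃ q : PreRat M, ∃ c v w u : M.Num, c = approx Θ n ∧
      (q.IsRat ∧ v = pow2 n ∧ w = pow2 i ∧ u = pow2 (e 0 + 1) ∧ e 0 ≤ n ∧ ¬ Stage Θ n (e 0) ∧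
        pair i q.code ∈ x ∧
        (q.add (.ofNums C w)).Lt ((PreRat.ofNums c v).add (.ofNums 1 u)))) fun e => ?_
    generalize e 0 = k
    have key : ∀ (n i : M.Num) (q : M.Rat), (q.1.add (.ofNums C (pow2 i))).Lt
        ((PreRat.ofNums (approx Θ n) (pow2 n)).add (.ofNums 1 (pow2 (k + 1)))) ↔
        q.1.val + toFr C * eps i < apx Θ n + eps (k + 1) := fun n i q => by
      have hp : ∀ c k : M.Num, (PreRat.ofNums c (pow2 k)).DenPos := fun c k =>
        PreRat.denPos_ofNums (pow2_pos k)
      rw [PreRat.lt_iff ((rat_denPos q).add (hp _ _)) ((hp _ _).add (hp _ _)),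
        PreRat.val_add (rat_denPos q) (hp _ _), PreRat.val_add (hp _ _) (hp _ _), val_approx,
        PreRat.val_ofNums, PreRat.val_ofNums, map_one, eps, eps, mul_one_div]
    constructor
    · intro hk
      obtain ⟨N, hN⟩ := hlim (eps (k + 1) / 4) (by linarith [eps_pos (k + 1)])
      have hC : 0 < 4 * (toFr C + 1) := by linarith [toFr_nonneg C]
      obtain ⟨i, hi⟩ := exists_eps_lt (div_pos (eps_pos (k + 1)) hC)
      rw [lt_div_iff₀ hC] at hi
      obtain ⟨q, hq⟩ := exists_rat (rseq x i)
      refine ⟨max N k, i, q.1, _, _, _, _, rfl, q.2, rfl, rfl, rfl, le_max_right _ _,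
        fun ⟨m, _, hm⟩ => hk ⟨m, hm⟩, (hx.repr i q).2 hq, (key _ _ _).2 ?_⟩
      have := (abs_le.1 (hN _ (le_max_left N k) i)).2
      rw [hq]
      linarith [eps_pos i, eps_pos (k + 1)]
    · rintro ⟨n, i, q, _, _, _, _, rfl, hq, rfl, rfl, rfl, hkn, hst, hqx, hlt⟩ ⟨m, hm⟩
      rw [key n i ⟨q, hq⟩, (hx.repr i ⟨q, hq⟩).1 hqx] at hlt
      have hm' : Stage Θ (m + 1) k := ⟨m, lt_succ_iff.2 le_rfl, hm⟩
      have h1 := apx_add_eps_le hkn hst hm'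
      obtain ⟨N, hN⟩ := hlim _ (half_pos (sub_pos.2 (hlt.trans_le h1)))
      have h2 := (abs_le.1 (hN _ (le_max_left N (m + 1)) i)).1
      have h3 := apx_mono (Θ := Θ) (le_max_right N (m + 1))
      linarith
  exact isSet_setOf (fun k => ∃ m, pair k m ∈ Θ)

end Approx

/-! ## The continuous functions `x ↦ |x - a| / 2` -/

/-- `(r, s)` bounds `|x - a| / 2` for `x` in `(p, q) ∩ [0, 1]`. -/
def DistBox (p q r s a : PreRat M) : Prop :=
  (p.Lt q ∧ p.Lt (.ofNums 1 1) ∧ (PreRat.ofNums 0 1).Lt q) ∧ r.Lt s ∧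
  (r.Lt (.ofNums 0 1) ∨ (r.add r).Le (p.sub a) ∨ (r.add r).Le (a.sub q)) ∧
  ((q.sub a).Le (s.add s) ∨ ((PreRat.ofNums 1 1).sub a).Le (s.add s)) ∧
  ((a.sub p).Le (s.add s) ∨ a.Le (s.add s))

/-- `DistBox` on the level of values. -/
def DistBoxVal (p q r s a : Fr M) : Prop :=
  (p < q ∧ p < 1 ∧ 0 < q) ∧ r < s ∧ (r < 0 ∨ r + r ≤ p - a ∨ r + r ≤ a - q) ∧
  (q - a ≤ s + s ∨ 1 - a ≤ s + s) ∧ (a - p ≤ s + s ∨ a ≤ s + s)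

theorem distBox_iff {p q r s a : PreRat M} (hp : p.DenPos) (hq : q.DenPos) (hr : r.DenPos)
    (hs : s.DenPos) (ha : a.DenPos) :
    DistBox p q r s a ↔ DistBoxVal p.val q.val r.val s.val a.val := by
  have h0 : (PreRat.ofNums (0 : M.Num) 1).DenPos := PreRat.denPos_ofNums zero_lt_one
  have h1 : (PreRat.ofNums (1 : M.Num) 1).DenPos := PreRat.denPos_ofNums zero_lt_one
  simp only [DistBox, DistBoxVal, PreRat.lt_iff hp hq, PreRat.lt_iff hp h1, PreRat.lt_iff h0 hq,
    PreRat.lt_iff hr hs, PreRat.lt_iff hr h0, PreRat.le_iff (hr.add hr) (hp.sub ha),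
    PreRat.le_iff (hr.add hr) (ha.sub hq), PreRat.le_iff (hq.sub ha) (hs.add hs),
    PreRat.le_iff (h1.sub ha) (hs.add hs), PreRat.le_iff (ha.sub hp) (hs.add hs),
    PreRat.le_iff ha (hs.add hs), PreRat.val_add hr hr, PreRat.val_add hs hs,
    PreRat.val_sub hp ha, PreRat.val_sub ha hq, PreRat.val_sub hq ha, PreRat.val_sub h1 ha,
    PreRat.val_sub ha hp, PreRat.val_ofNums, map_zero, map_one, div_one]

instance DefBdd.distBox (p q r s a : (ℕ → M.Num) → PreRat M) [DefRat p] [DefRat q] [DefRat r]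
    [DefRat s] [DefRat a] : DefBdd (fun e => DistBox (p e) (q e) (r e) (s e) (a e)) := by
  unfold DistBox
  infer_instance

/-- `b` codes a pair of intervals as in `DistBox`, with rational endpoints. -/
def IsDistBox (b : M.Num) (a : PreRat M) : Prop :=
  ∃ p : PreRat M, p.code < b + 1 ∧ ∃ q : PreRat M, q.code < b + 1 ∧ ∃ r : PreRat M,
    r.code < b + 1 ∧ ∃ s : PreRat M, s.code < b + 1 ∧ (p.IsRat ∧ q.IsRat ∧ r.IsRat ∧ s.IsRat ∧
      b = pair (pair p.code q.code) (pair r.code s.code) ∧ DistBox p q r s a)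

set_option synthInstance.maxSize 4096 in
instance DefBdd.isDistBox (b : (ℕ → M.Num) → M.Num) (a : (ℕ → M.Num) → PreRat M) [DefTerm b]
    [DefRat a] : DefBdd (fun e => IsDistBox (b e) (a e)) := by
  unfold IsDistBox
  infer_instance

theorem isDistBox_iff {b : M.Num} {a : PreRat M} (ha : a.DenPos) : IsDistBox b a ↔
    ∃ p q r s : M.Rat, b = boxCode p q r s ∧
      DistBoxVal p.1.val q.1.val r.1.val s.1.val a.val := by
  constructor
  · rintro ⟨p, _, q, _, r, _, s, _, hp, hq, hr, hs, hb, h⟩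
    exact ⟨⟨p, hp⟩, ⟨q, hq⟩, ⟨r, hr⟩, ⟨s, hs⟩, hb,
      (distBox_iff hp.denPos hq.denPos hr.denPos hs.denPos ha).1 h⟩
  · rintro ⟨p, q, r, s, rfl, h⟩
    refine ⟨p.1, ?_, q.1, ?_, r.1, ?_, s.1, ?_, p.2, q.2, r.2, s.2, rfl,
      (distBox_iff (rat_denPos p) (rat_denPos q) (rat_denPos r) (rat_denPos s) ha).2 h⟩ <;>
      refine lt_succ_iff.2 ?_
    · exact (left_le_pair _ _).trans (left_le_pair _ _)
    · exact (right_le_pair _ _).trans (left_le_pair _ _)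
    · exact (left_le_pair _ _).trans (right_le_pair _ _)
    · exact (right_le_pair _ _).trans (right_le_pair _ _)

theorem boxCode_inj {p q r s p' q' r' s' : M.Rat} :
    boxCode p q r s = boxCode p' q' r' s' ↔ (p = p' ∧ q = q') ∧ r = r' ∧ s = s' := by
  simp only [boxCode, pair_inj, rat_code_inj]

theorem unitInterval_iff {p q : M.Rat} :
    UnitInterval p q ↔ p.1.val < q.1.val ∧ p.1.val < 1 ∧ 0 < q.1.val := by
  have h0 : (PreRat.ofNums (0 : M.Num) 1).DenPos := PreRat.denPos_ofNums zero_lt_one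
  have h1 : (PreRat.ofNums (1 : M.Num) 1).DenPos := PreRat.denPos_ofNums zero_lt_one
  simp only [UnitInterval, PreRat.lt_iff (rat_denPos p) (rat_denPos q),
    PreRat.lt_iff (rat_denPos p) h1, PreRat.lt_iff h0 (rat_denPos q), PreRat.val_ofNums, map_zero,
    map_one, div_one]

theorem unitIntervalSub_iff {p' q' p q : M.Rat} : UnitIntervalSub p' q' p q ↔
    (p.1.val < 0 ∨ p.1.val ≤ p'.1.val) ∧ (1 < q.1.val ∨ q'.1.val ≤ q.1.val) := by
  have h0 : (PreRat.ofNums (0 : M.Num) 1).DenPos := PreRat.denPos_ofNums zero_lt_one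
  have h1 : (PreRat.ofNums (1 : M.Num) 1).DenPos := PreRat.denPos_ofNums zero_lt_one
  simp only [UnitIntervalSub, PreRat.le_iff (rat_denPos p) (rat_denPos p'),
    PreRat.lt_iff (rat_denPos p) h0, PreRat.lt_iff h1 (rat_denPos q),
    PreRat.le_iff (rat_denPos q') (rat_denPos q), PreRat.val_ofNums, map_zero,
    map_one, div_one]

theorem rat_lt_iff {p q : M.Rat} : p.1.Lt q.1 ↔ p.1.val < q.1.val :=
  PreRat.lt_iff (rat_denPos p) (rat_denPos q)

theorem rat_le_iff {p q : M.Rat} : p.1.Le q.1 ↔ p.1.val ≤ q.1.val :=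
  PreRat.le_iff (rat_denPos p) (rat_denPos q)

/-- The alternatives `r < 0`, `1 - a ≤ s + s` and `a ≤ s + s` in `DistBoxVal` reflect the cut with
`[0,1]`. An endpoint outside the unit interval may be changed freely without changing `U`, and
closure under shrinking has to survive this. -/
theorem isContinuous_of_distBox {F : Set M.Num} (hF : F ∈ M.sets) {a : Fr M}
    (ha : 0 ≤ a) (ha' : a ≤ 1)
    (h : ∀ b, b ∈ F ↔ ∃ p q r s : M.Rat, b = boxCode p q r s ∧
      DistBoxVal p.1.val q.1.val r.1.val s.1.val a) : IsContinuous F := by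
  have hbox : ∀ p q r s : M.Rat, boxCode p q r s ∈ F ↔
      DistBoxVal p.1.val q.1.val r.1.val s.1.val a := fun p q r s => by
    rw [h]
    constructor
    · rintro ⟨p', q', r', s', e, h⟩
      obtain ⟨⟨rfl, rfl⟩, rfl, rfl⟩ := boxCode_inj.1 e
      exact h
    · exact fun h => ⟨p, q, r, s, rfl, h⟩
  refine ⟨hF, fun b hb => ?_, fun p q r s r' s' h₁ h₂ => ?_, fun p q r s p' q' h₁ h₂ h₃ => ?_,
    fun p q r s r' s' h₁ h₂ h₃ h₄ => ?_⟩
  · obtain ⟨p, q, r, s, rfl, h₁, h₂, -⟩ := (h b).1 hb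
    exact ⟨p, q, r, s, unitInterval_iff.2 h₁, rat_lt_iff.2 h₂, rfl⟩
  · have key : ∀ p q r s r' s' : Fr M, DistBoxVal p q r s a → DistBoxVal p q r' s' a → r < s' := by
      rintro p q r s r' s' ⟨⟨h1, h2, h3⟩, -, h4, -, -⟩ ⟨-, -, -, h5, h6⟩
      rcases h4 with h4 | h4 | h4 <;> rcases h5 with h5 | h5 <;> rcases h6 with h6 | h6 <;> linarith
    rw [hbox] at h₁ h₂
    exact ⟨rat_lt_iff.2 (key _ _ _ _ _ _ h₁ h₂), rat_lt_iff.2 (key _ _ _ _ _ _ h₂ h₁)⟩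
  · rw [hbox] at h₁ ⊢
    rw [unitInterval_iff] at h₂
    rw [unitIntervalSub_iff] at h₃
    obtain ⟨⟨h1, h2, h3⟩, h0, h4, h5, h6⟩ := h₁
    obtain ⟨h7, h8⟩ := h₃
    refine ⟨h₂, h0, ?_, ?_, ?_⟩
    · by_contra! hc
      obtain ⟨c1, c2, c3⟩ := hc
      rcases h4 with h4 | h4 | h4
      · linarith
      · rcases h7 with h7 | h7 <;> linarith
      · rcases h8 with h8 | h8 <;> linarith
    · by_contra! hc
      rcases h5 with h5 | h5 <;> rcases h8 with h8 | h8 <;> linarith [hc.1, hc.2]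
    · by_contra! hc
      rcases h6 with h6 | h6 <;> rcases h7 with h7 | h7 <;> linarith [hc.1, hc.2]
  · rw [hbox] at h₁ ⊢
    rw [rat_lt_iff] at h₂
    rw [rat_le_iff] at h₃ h₄
    obtain ⟨h1, h0, h4, h5, h6⟩ := h₁
    refine ⟨h1, h₂, ?_, ?_, ?_⟩
    · rcases h4 with h4 | h4 | h4
      · exact .inl (by linarith)
      · exact .inr (.inl (by linarith))
      · exact .inr (.inr (by linarith))
    · exact h5.imp (by intro; linarith) (by intro; linarith)
    · exact h6.imp (by intro; linarith) (by intro; linarith)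

/-! ## Regular sequences -/

/-- A strict inequality of reals, witnessed at one index, becomes a uniform margin `η` at every
index up to an error in `eps i`. `exists_lt_of_forall` is the way back; estimates in between compare
terms at one index. -/
theorem Regular.forall_of_lt {a : M.Num → Fr M} (ha : Regular a) {β : Fr M}
    (h : ∃ k, a k + 2 * eps k < β) : ∃ η, 0 < η ∧ ∀ i, a i + η ≤ β + eps i := by
  obtain ⟨k, hk⟩ := h
  exact ⟨eps k, eps_pos k, fun i => by linarith [ha.le i k]⟩

theorem Regular.forall_of_gt {a : M.Num → Fr M} (ha : Regular a) {β : Fr M}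
    (h : ∃ k, β + 2 * eps k < a k) : ∃ η, 0 < η ∧ ∀ i, β + η ≤ a i + eps i := by
  obtain ⟨k, hk⟩ := h
  exact ⟨eps k, eps_pos k, fun i => by linarith [ha.le k i]⟩

theorem exists_mul_eps_lt (C : Fr M) {η : Fr M} (hη : 0 < η) : ∃ k, C * eps k < η := by
  have hC : 0 < |C| + 1 := by positivity
  obtain ⟨k, hk⟩ := exists_eps_lt (div_pos hη hC)
  rw [lt_div_iff₀ hC] at hk
  exact ⟨k, by nlinarith [eps_pos k, le_abs_self C]⟩

theorem exists_lt_of_forall {a : M.Num → Fr M} {β η : Fr M} (C : Fr M) (hη : 0 < η)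
    (h : ∀ i, a i + η ≤ β + C * eps i) : ∃ k, a k + 2 * eps k < β := by
  obtain ⟨k, hk⟩ := exists_mul_eps_lt (C + 2) hη
  exact ⟨k, by linarith [h k]⟩

theorem exists_gt_of_forall {a : M.Num → Fr M} {β η : Fr M} (C : Fr M) (hη : 0 < η)
    (h : ∀ i, β + η ≤ a i + C * eps i) : ∃ k, β + 2 * eps k < a k := by
  obtain ⟨k, hk⟩ := exists_mul_eps_lt (C + 2) hη
  exact ⟨k, by linarith [h k]⟩

/-! ## The gauge -/

section Gauge

variable (Θ : Set M.Num) [IsSet Θ]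

/-- The sequence of the functions `x ↦ |x - aₙ| / 2`, where `aₙ` is the approximation at stage
`n`. -/
def gauge : Set M.Num :=
  {w | ∃ b n, w = pair b n ∧ IsDistBox b (.ofNums (approx Θ n) (pow2 n))}

/-- Membership depends on the unique values of `approx` and `pow2`, so it and its negation can both
be expressed by a Σ⁰₁ search for these values. -/
theorem gauge_mem_sets : gauge Θ ∈ M.sets := by
  have h1 : DefSig (fun e : ℕ → M.Num => ∃ b n, e 0 = pair b n ∧
      IsDistBox b (.ofNums (approx Θ n) (pow2 n))) := by
    refine DefSig.of_iff (Q := fun e => ∃ b n c v : M.Num, c = approx Θ n ∧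
      (v = pow2 n ∧ e 0 = pair b n ∧ IsDistBox b (.ofNums c v))) fun e => ⟨?_, ?_⟩
    · rintro ⟨b, n, h, h'⟩
      exact ⟨b, n, _, _, rfl, rfl, h, h'⟩
    · rintro ⟨b, n, _, _, rfl, rfl, h, h'⟩
      exact ⟨b, n, h, h'⟩
  have h2 : DefSig (fun e : ℕ → M.Num => ¬ ∃ b n, e 0 = pair b n ∧
      IsDistBox b (.ofNums (approx Θ n) (pow2 n))) := by
    refine DefSig.of_iff (Q := fun e => (¬ ∃ b, b < e 0 + 1 ∧ ∃ n, n < e 0 + 1 ∧ e 0 = pair b n) ∨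
      ∃ b n c v : M.Num, c = approx Θ n ∧ (v = pow2 n ∧ e 0 = pair b n ∧
        ¬ IsDistBox b (.ofNums c v))) fun e => ⟨fun h => ?_, ?_⟩
    · by_cases hp : ∃ b n, e 0 = pair b n
      · obtain ⟨b, n, hw⟩ := hp
        exact .inr ⟨b, n, _, _, rfl, rfl, hw, fun h' => h ⟨b, n, hw, h'⟩⟩
      · exact .inl fun ⟨b, _, n, _, hw⟩ => hp ⟨b, n, hw⟩
    · rintro (h | ⟨b, n, _, _, rfl, rfl, hw, h⟩) ⟨b', n', hw', h'⟩
      · exact h ⟨b', by rw [hw']; exact lt_succ_iff.2 (left_le_pair _ _), n',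
          by rw [hw']; exact lt_succ_iff.2 (right_le_pair _ _), hw'⟩
      · obtain ⟨rfl, rfl⟩ := pair_inj.1 (hw.symm.trans hw')
        exact h h'
  exact (isSet_setOf (fun w => ∃ b n, w = pair b n ∧
    IsDistBox b (.ofNums (approx Θ n) (pow2 n)))).mem

theorem isSet_sect (Z : Set M.Num) [IsSet Z] (n : M.Num) : IsSet (sect Z n) :=
  isSet_setOf (fun m => pair m n ∈ Z)

variable {Θ}

theorem mem_sect_gauge {b n : M.Num} : b ∈ sect (gauge Θ) n ↔ ∃ p q r s : M.Rat,
    b = boxCode p q r s ∧ DistBoxVal p.1.val q.1.val r.1.val s.1.val (apx Θ n) := by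
  rw [← val_approx, ← isDistBox_iff (PreRat.denPos_ofNums (pow2_pos n))]
  constructor
  · rintro ⟨b', n', h, h'⟩
    obtain ⟨rfl, rfl⟩ := pair_inj.1 h
    exact h'
  · exact fun h => ⟨b, n, rfl, h⟩

theorem boxCode_mem_sect_gauge {p q r s : M.Rat} {n : M.Num} : boxCode p q r s ∈ sect (gauge Θ) n ↔
    DistBoxVal p.1.val q.1.val r.1.val s.1.val (apx Θ n) := by
  rw [mem_sect_gauge]
  constructor
  · rintro ⟨p', q', r', s', e, h⟩
    obtain ⟨⟨rfl, rfl⟩, rfl, rfl⟩ := boxCode_inj.1 e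
    exact h
  · exact fun h => ⟨p, q, r, s, rfl, h⟩

theorem isContinuous_sect_gauge (n : M.Num) : IsContinuous (sect (gauge Θ) n) := by
  have := IsSet.mk (gauge_mem_sets Θ)
  exact isContinuous_of_distBox (isSet_sect _ n).mem (apx_nonneg n) (apx_lt_one n).le
    fun _ => mem_sect_gauge

theorem inInterval_iff {x : Set M.Num} (hx : InUnit x) {p q : M.Rat} : InInterval x p q ↔
    (∃ k, p.1.val + 2 * eps k < rseq x k) ∧ ∃ k, rseq x k + 2 * eps k < q.1.val := by
  rw [InInterval, hx.1.const_lt_iff, hx.1.lt_const_iff]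
  exact and_iff_right hx

theorem isTotal_sect_gauge (n : M.Num) : IsTotal (sect (gauge Θ) n) := by
  intro x hx ε hε
  rw [ratPos_iff] at hε
  -- The interval has radius `3 * eps k`, since the strict order of reals needs more than `2 * eps
  -- k`. Halving the distance gives a `V` of length `3 * eps k`.
  obtain ⟨k, hk⟩ := exists_mul_eps_lt 3 hε
  obtain ⟨-, h0, h1⟩ := inUnit_iff.1 hx
  have hk0 := eps_pos k
  obtain ⟨p, hp⟩ := exists_rat (rseq x k - 3 * eps k)
  obtain ⟨q, hq⟩ := exists_rat (rseq x k + 3 * eps k)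
  have hint : InInterval x p q := (inInterval_iff hx).2 ⟨⟨k, by linarith⟩, ⟨k, by linarith⟩⟩
  have hu : p.1.val < q.1.val ∧ p.1.val < 1 ∧ 0 < q.1.val :=
    ⟨by linarith, by linarith [h1 k], by linarith [h0 k]⟩
  have key : ∀ r s : M.Rat, (s.1.sub r.1).Le ε.1 ↔ s.1.val - r.1.val ≤ ε.1.val := fun r s => by
    rw [PreRat.le_iff ((rat_denPos s).sub (rat_denPos r)) (rat_denPos ε),
      PreRat.val_sub (rat_denPos s) (rat_denPos r)]
  -- The midpoint `rseq x k` decides which endpoint of the interval is farther from the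
  -- approximation and hence gives the upper bound.
  rcases le_total (apx Θ n) (rseq x k) with h | h
  · obtain ⟨r, hr⟩ := exists_rat ((p.1.val - apx Θ n) / 2)
    obtain ⟨s, hs⟩ := exists_rat ((q.1.val - apx Θ n) / 2)
    exact ⟨p, q, r, s, boxCode_mem_sect_gauge.2 ⟨hu, by linarith [hu.1], .inr (.inl (by linarith)),
      .inl (by linarith), .inl (by linarith)⟩, hint, (key _ _).2 (by linarith)⟩
  · obtain ⟨r, hr⟩ := exists_rat ((apx Θ n - q.1.val) / 2)
    obtain ⟨s, hs⟩ := exists_rat ((apx Θ n - p.1.val) / 2)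
    exact ⟨p, q, r, s, boxCode_mem_sect_gauge.2 ⟨hu, by linarith [hu.1], .inr (.inr (by linarith)),
      .inl (by linarith), .inl (by linarith)⟩, hint, (key _ _).2 (by linarith)⟩

theorem isValue_sect_gauge {x y : Set M.Num} (hx : InUnit x) (hy : IsReal y) (n : M.Num)
    (h : Repr y fun k => |rseq x k - apx Θ n| / 2) : IsValue (sect (gauge Θ) n) x y := by
  refine ⟨hy, fun p q r s hbox hint => ?_⟩
  obtain ⟨hu, hrs, hr, hs, hs'⟩ := boxCode_mem_sect_gauge.1 hbox
  rw [inInterval_iff hx] at hint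
  obtain ⟨η, hη, hp⟩ := hx.1.regular.forall_of_gt hint.1
  obtain ⟨η', hη', hq⟩ := hx.1.regular.forall_of_lt hint.2
  obtain ⟨-, h0, h1⟩ := inUnit_iff.1 hx
  rw [realLe_iff (Repr.constReal (rat_denPos r)) h, realLe_iff h (Repr.constReal (rat_denPos s))]
  constructor <;> intro k
  · have e1 := le_abs_self (rseq x k - apx Θ n)
    have e2 := neg_abs_le (rseq x k - apx Θ n)
    have e3 := abs_nonneg (rseq x k - apx Θ n)
    have := eps_pos k
    rcases hr with hr | hr | hr <;> linarith [hp k, hq k]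
  · have := eps_pos k
    rcases abs_cases (rseq x k - apx Θ n) with ⟨e, -⟩ | ⟨e, -⟩ <;> rw [e]
    · rcases hs with hs | hs <;> linarith [hq k, h1 k]
    · rcases hs' with hs | hs <;> linarith [hp k, h0 k]

-- The map `x ↦ |x - a| / 2` is a contraction, so its terms form a regular sequence at the same
-- indices, with no shift.
variable (Θ) in
theorem exists_isValue_gauge {x : Set M.Num} (hx : InUnit x) (n : M.Num) :
    ∃ y, IsValue (sect (gauge Θ) n) x y ∧ IsReal y ∧ Repr y fun k => |rseq x k - apx Θ n| / 2 := by
  have := IsSet.mk hx.1.1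
  set a : PreRat M := .ofNums (approx Θ n) (pow2 n) with ha
  have had : a.DenPos := PreRat.denPos_ofNums (pow2_pos n)
  have hav : a.val = apx Θ n := val_approx n
  obtain ⟨y, hy, hr⟩ := exists_isReal_of_def (fun k => |rseq x k - apx Θ n| / 2)
    (fun i j hij => by
      have h1 := hx.1.regular i j hij
      have h2 := abs_abs_sub_abs_le_abs_sub (rseq x i - apx Θ n) (rseq x j - apx Θ n)
      rw [sub_sub_sub_cancel_right] at h2
      rw [← sub_div, abs_div, abs_two]
      linarith [abs_nonneg (rseq x i - rseq x j)])
    -- The absolute value is described without case distinction on signs: `q ≥ 0` and `2q = ±(z -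
    -- a)`.
    (fun k q => ∃ z : PreRat M, z.IsRat ∧ pair k z.code ∈ x ∧ (PreRat.ofNums 0 1).Le q ∧
      ((q.add q).Equiv (z.sub a) ∨ (q.add q).Equiv (a.sub z)))
    (fun t q => inferInstance) fun k q => by
      have key : ∀ z : M.Rat, ((PreRat.ofNums 0 1).Le q.1 ∧
          ((q.1.add q.1).Equiv (z.1.sub a) ∨ (q.1.add q.1).Equiv (a.sub z.1))) ↔
          q.1.val = |z.1.val - apx Θ n| / 2 := fun z => by
        have hq := rat_denPos q
        have hz := rat_denPos z
        rw [PreRat.le_iff (PreRat.denPos_ofNums zero_lt_one) hq,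
          PreRat.equiv_iff (hq.add hq) (hz.sub had), PreRat.equiv_iff (hq.add hq) (had.sub hz),
          PreRat.val_add hq hq, PreRat.val_sub hz had, PreRat.val_sub had hz, hav,
          PreRat.val_ofNums, map_zero, zero_div]
        constructor
        · rintro ⟨h0, h | h⟩
          · rw [abs_of_nonneg (by linarith)]; linarith
          · rw [abs_of_nonpos (by linarith)]; linarith
        · intro h
          refine ⟨by rw [h]; positivity, ?_⟩
          rcases abs_cases (z.1.val - apx Θ n) with ⟨e, -⟩ | ⟨e, -⟩ <;> rw [e] at h
          · exact .inl (by linarith)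
          · exact .inr (by linarith)
      constructor
      · rintro ⟨z, hz, hzx, h⟩
        rw [(key ⟨z, hz⟩).1 h, (hx.1.repr k ⟨z, hz⟩).1 hzx]
      · intro h
        obtain ⟨z, hz⟩ := exists_rat (rseq x k)
        exact ⟨z.1, z.2, (hx.1.repr k z).2 hz, (key z).2 (by rw [h, hz])⟩
  exact ⟨y, isValue_sect_gauge hx hy n hr, hy, hr⟩

/-- Values are unique only up to equality of reals. Both values lie in the closure of arbitrarily
short `V`, and comparing each at index `k` costs `2 * eps k`. -/
theorem abs_sub_le_of_isValue {x w : Set M.Num} (hx : InUnit x) {n : M.Num}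
    (hw : IsValue (sect (gauge Θ) n) x w) (k : M.Num) :
    |rseq w k - |rseq x k - apx Θ n| / 2| ≤ 4 * eps k := by
  obtain ⟨y, hy, hyr, hr⟩ := exists_isValue_gauge Θ hx n
  refine le_of_forall_eps 1 one_pos fun l => ?_
  obtain ⟨ε, hε⟩ := exists_rat (eps l)
  obtain ⟨p, q, r, s, hbox, hint, hrs⟩ := isTotal_sect_gauge (Θ := Θ) n x hx ε
    (ratPos_iff.2 (by rw [hε]; exact eps_pos l))
  rw [PreRat.le_iff ((rat_denPos s).sub (rat_denPos r)) (rat_denPos ε),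
    PreRat.val_sub (rat_denPos s) (rat_denPos r), hε] at hrs
  have h1 := hy.2 p q r s hbox hint
  have h2 := hw.2 p q r s hbox hint
  rw [realLe_iff (Repr.constReal (rat_denPos r)) hr,
    realLe_iff hr (Repr.constReal (rat_denPos s))] at h1
  rw [realLe_iff (Repr.constReal (rat_denPos r)) hw.1.repr,
    realLe_iff hw.1.repr (Repr.constReal (rat_denPos s))] at h2
  have := h1.1 k
  have := h1.2 k
  have := h2.1 k
  have := h2.2 k
  rw [abs_le]
  constructor <;> linarith

theorem isBaire1_gauge : IsBaire1 (gauge Θ) := by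
  refine ⟨gauge_mem_sets Θ, isContinuous_sect_gauge, isTotal_sect_gauge, fun x hx ε hε => ?_⟩
  obtain ⟨N, hN⟩ := exists_forall_apx_le (Θ := Θ) (ratPos_iff.1 hε)
  refine ⟨N, fun m n hm hn => ?_⟩
  obtain ⟨y, hy, -, hyr⟩ := exists_isValue_gauge Θ hx m
  obtain ⟨z, hz, -, hzr⟩ := exists_isValue_gauge Θ hx n
  refine ⟨y, z, hy, hz, (distLe_iff hyr hzr ε).2 fun k => ?_⟩
  have h1 := abs_abs_sub_abs_le_abs_sub (rseq x (k + 1) - apx Θ m) (rseq x (k + 1) - apx Θ n)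
  rw [sub_sub_sub_cancel_left] at h1
  have h2 : |apx Θ n - apx Θ m| ≤ ε.1.val := by
    rw [abs_le]
    constructor <;> linarith [hN m hm, hN n hn, apx_mono (Θ := Θ) hm, apx_mono (Θ := Θ) hn]
  rw [← sub_div, abs_div, abs_two]
  linarith [eps_pos k, abs_nonneg (|rseq x (k + 1) - apx Θ m| - |rseq x (k + 1) - apx Θ n|)]

theorem isSet_range_of_baire1Le {x : Set M.Num} (hx : InUnit x)
    (h : Baire1Le (gauge Θ) x (constReal (.ofNums 0 1))) : IsSet {k | ∃ m, pair k m ∈ Θ} := by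
  -- The constant is 2 · (4 + 1): 4 from comparing values, 1 from the regularity of `w`, doubled to
  -- undo the halving in the gauge.
  refine isSet_range_of_limit hx.1 10 fun ε hε => ?_
  obtain ⟨q, hq⟩ := exists_rat (ε / 2)
  obtain ⟨N, hN⟩ := h q ((realLt_iff repr_zero (Repr.constReal (rat_denPos q))).2 (by
    obtain ⟨k, hk⟩ := exists_mul_eps_lt 2 (half_pos hε)
    exact ⟨k, by rw [hq]; linarith⟩))
  refine ⟨N, fun m hm i => ?_⟩
  obtain ⟨w, hw, hlt⟩ := hN m hm
  obtain ⟨η, hη, h1⟩ := hw.1.regular.forall_of_lt ((hw.1.lt_const_iff q).1 hlt)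
  have h2 := (abs_le.1 (abs_sub_le_of_isValue hx hw i)).1
  have h3 := h1 i
  rw [hq] at h3
  rw [map_ofNat]
  linarith

/-- Fineness in terms of sequences: a rational lower bound `β` of `y` eventually lies below the
gauge values, with error `5 * eps i` from comparing values (4) and regularity (1). -/
theorem eventually_le_of_baire1Ge {x : Set M.Num} (hx : InUnit x) {y : Set M.Num}
    {b : M.Num → Fr M} (hb : Repr y b) {β : Fr M} (C : Fr M) (hβ : ∀ i, β ≤ b i + C * eps i)
    (h : Baire1Ge (gauge Θ) x y) {ε : Fr M} (hε : 0 < ε) :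
    ∃ N, ∀ m, N ≤ m → ∀ i, β ≤ |rseq x i - apx Θ m| / 2 + ε + 5 * eps i := by
  obtain ⟨q, hq⟩ := exists_rat (β - ε)
  obtain ⟨N, hN⟩ := h q ((realLt_iff (Repr.constReal (rat_denPos q)) hb).2
    (exists_gt_of_forall C hε fun i => by linarith [hβ i]))
  refine ⟨N, fun m hm i => ?_⟩
  obtain ⟨w, hw, hlt⟩ := hN m hm
  obtain ⟨η, hη, h1⟩ := hw.1.regular.forall_of_gt ((hw.1.const_lt_iff q).1 hlt)
  have h2 := (abs_le.1 (abs_sub_le_of_isValue hx hw i)).2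
  linarith [h1 i]

end Gauge

/-! ## Comparing members of a sequence of reals with fractions -/

/-- The `j`-th real of the sequence `P` is less than `b`. -/
def SectLt (P : Set M.Num) (j : M.Num) (b : PreRat M) : Prop :=
  ∃ k w : M.Num, ∃ z : PreRat M, w = pow2 k ∧ z.IsRat ∧ pair (pair k z.code) j ∈ P ∧
    (z.add (.ofNums (1 + 1) w)).Lt b

/-- The `j`-th real of the sequence `P` is greater than `b`. -/
def SectGt (P : Set M.Num) (j : M.Num) (b : PreRat M) : Prop :=
  ∃ k w : M.Num, ∃ z : PreRat M, w = pow2 k ∧ z.IsRat ∧ pair (pair k z.code) j ∈ P ∧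
    (b.add (.ofNums (1 + 1) w)).Lt z

section Definability

variable (P : Set M.Num) [IsSet P] (t : (ℕ → M.Num) → M.Num) (b : (ℕ → M.Num) → PreRat M)
  [DefTerm t] [DefRat b]

instance DefSig.sectLt : DefSig (fun e => SectLt P (t e) (b e)) := by
  unfold SectLt
  infer_instance

instance DefSig.sectGt : DefSig (fun e => SectGt P (t e) (b e)) := by
  unfold SectGt
  infer_instance

end Definability

theorem sectLt_iff {P : Set M.Num} {j : M.Num} (h : IsReal (sect P j)) {b : PreRat M}
    (hb : b.DenPos) : SectLt P j b ↔ ∃ k, rseq (sect P j) k + 2 * eps k < b.val := by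
  have key : ∀ (k : M.Num) (z : M.Rat), (z.1.add (.ofNums (1 + 1) (pow2 k))).Lt b ↔
      z.1.val + 2 * eps k < b.val := fun k z => by
    have hd : (PreRat.ofNums (1 + 1) (pow2 k)).DenPos := PreRat.denPos_ofNums (pow2_pos k)
    rw [PreRat.lt_iff ((rat_denPos z).add hd) hb, PreRat.val_add (rat_denPos z) hd, val_two_div]
    rfl
  constructor
  · rintro ⟨k, _, z, rfl, hz, hP, hlt⟩
    exact ⟨k, by rw [← (h.repr k ⟨z, hz⟩).1 hP]; exact (key k ⟨z, hz⟩).1 hlt⟩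
  · rintro ⟨k, hk⟩
    obtain ⟨z, hz⟩ := exists_rat (rseq (sect P j) k)
    exact ⟨k, _, z.1, rfl, z.2, (h.repr k z).2 hz, (key k z).2 (by rwa [hz])⟩

theorem sectGt_iff {P : Set M.Num} {j : M.Num} (h : IsReal (sect P j)) {b : PreRat M}
    (hb : b.DenPos) : SectGt P j b ↔ ∃ k, b.val + 2 * eps k < rseq (sect P j) k := by
  have key : ∀ (k : M.Num) (z : M.Rat), (b.add (.ofNums (1 + 1) (pow2 k))).Lt z.1 ↔
      b.val + 2 * eps k < z.1.val := fun k z => by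
    have hd : (PreRat.ofNums (1 + 1) (pow2 k)).DenPos := PreRat.denPos_ofNums (pow2_pos k)
    rw [PreRat.lt_iff (hb.add hd) (rat_denPos z), PreRat.val_add hb hd, val_two_div]
    rfl
  constructor
  · rintro ⟨k, _, z, rfl, hz, hP, hlt⟩
    exact ⟨k, by rw [← (h.repr k ⟨z, hz⟩).1 hP]; exact (key k ⟨z, hz⟩).1 hlt⟩
  · rintro ⟨k, hk⟩
    obtain ⟨z, hz⟩ := exists_rat (rseq (sect P j) k)
    exact ⟨k, _, z.1, rfl, z.2, (h.repr k z).2 hz, (key k z).2 (by rwa [hz])⟩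

/-! ## Partitions -/

section Partition

variable {P : Set M.Num} {ℓ : M.Num}

theorem IsTaggedPartition.real_node (hP : IsTaggedPartition P ℓ) {j : M.Num} (hj : j ≤ ℓ) :
    IsReal (sect P (j + j)) := hP.real _ (add_le_add hj hj)

theorem IsTaggedPartition.real_tag (hP : IsTaggedPartition P ℓ) {j : M.Num} (hj : j < ℓ) :
    IsReal (sect P (j + j + 1)) := by
  refine hP.real _ (le_trans ?_ (add_le_add (succ_le_iff.2 hj) (succ_le_iff.2 hj)))
  rw [show j + 1 + (j + 1) = j + j + 1 + 1 by ring]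
  exact le_self_add

theorem IsTaggedPartition.node_lt (hP : IsTaggedPartition P ℓ) {j : M.Num} (hj : j < ℓ) :
    ∃ k, rseq (sect P (j + j)) k + 2 * eps k < rseq (sect P (j + 1 + (j + 1))) k :=
  (realLt_iff (hP.real_node hj.le).repr (hP.real_node (succ_le_iff.2 hj)).repr).1 (hP.lt j hj)

theorem IsTaggedPartition.node_le_tag (hP : IsTaggedPartition P ℓ) {j : M.Num} (hj : j < ℓ)
    (k : M.Num) : rseq (sect P (j + j)) k ≤ rseq (sect P (j + j + 1)) k + 2 * eps k :=
  (realLe_iff (hP.real_node hj.le).repr (hP.real_tag hj).repr).1 (hP.le_tag j hj) k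

theorem IsTaggedPartition.tag_le_node (hP : IsTaggedPartition P ℓ) {j : M.Num} (hj : j < ℓ)
    (k : M.Num) : rseq (sect P (j + j + 1)) k ≤ rseq (sect P (j + 1 + (j + 1))) k + 2 * eps k :=
  (realLe_iff (hP.real_tag hj).repr (hP.real_node (succ_le_iff.2 hj)).repr).1 (hP.tag_le j hj) k

theorem IsTaggedPartition.abs_first_le (hP : IsTaggedPartition P ℓ) (k : M.Num) :
    |rseq (sect P (0 + 0)) k| ≤ 2 * eps k := by
  have := (realEq_iff (hP.real_node zero_le).repr repr_zero).1 hP.first k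
  rwa [sub_zero] at this

theorem IsTaggedPartition.abs_last_le (hP : IsTaggedPartition P ℓ) (k : M.Num) :
    |rseq (sect P (ℓ + ℓ)) k - 1| ≤ 2 * eps k :=
  (realEq_iff (hP.real_node le_rfl).repr repr_one).1 hP.last k

/-- Only neighbouring nodes are ordered by hypothesis. The Σ⁰₁ statement "node `j` is negative"
passes from `j + 1` to `j`, so its negation is proved upwards by induction from node 0. -/
theorem IsTaggedPartition.node_nonneg (hP : IsTaggedPartition P ℓ) {j : M.Num} (hj : j ≤ ℓ)
    (k : M.Num) : 0 ≤ rseq (sect P (j + j)) k + 2 * eps k := by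
  have := IsSet.mk hP.mem_sets
  have h0 : (PreRat.ofNums (0 : M.Num) 1).DenPos := PreRat.denPos_ofNums zero_lt_one
  have hv : (PreRat.ofNums (0 : M.Num) 1).val = 0 := by simp
  have key := induction_on_not (fun j => j ≤ ℓ ∧ SectLt P (j + j) (.ofNums 0 1)) j ?_ ?_
  · by_contra! hc
    exact key ⟨hj, (sectLt_iff (hP.real_node hj) h0).2 ⟨k, by rw [hv]; exact hc⟩⟩
  · rintro ⟨h, h'⟩
    obtain ⟨k, hk⟩ := (sectLt_iff (hP.real_node h) h0).1 h'
    rw [hv] at hk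
    linarith [(abs_le.1 (hP.abs_first_le k)).1]
  · rintro j hj ⟨h, h'⟩
    have hjl := succ_le_iff.1 h
    refine hj ⟨hjl.le, (sectLt_iff (hP.real_node hjl.le) h0).2 ?_⟩
    obtain ⟨η, hη, h1⟩ := (hP.real_node h).regular.forall_of_lt
      ((sectLt_iff (hP.real_node h) h0).1 h')
    obtain ⟨l, hl⟩ := hP.node_lt hjl
    refine exists_lt_of_forall 2 hη fun i => ?_
    linarith [h1 l, (hP.real_node hjl.le).regular.le i l, eps_pos l, eps_pos i]

/-- "Node `j` exceeds 1" is Σ⁰₁ and passes upwards, finally to the last node. -/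
theorem IsTaggedPartition.node_le_one (hP : IsTaggedPartition P ℓ) {j : M.Num} (hj : j ≤ ℓ)
    (k : M.Num) : rseq (sect P (j + j)) k ≤ 1 + 2 * eps k := by
  have := IsSet.mk hP.mem_sets
  have h0 : (PreRat.ofNums (1 : M.Num) 1).DenPos := PreRat.denPos_ofNums zero_lt_one
  have hv : (PreRat.ofNums (1 : M.Num) 1).val = 1 := by simp
  by_contra! hc
  obtain ⟨d, hd⟩ := exists_add_of_le hj
  have key := induction_on (fun d => ℓ < j + d ∨ SectGt P (j + d + (j + d)) (.ofNums 1 1)) d ?_ ?_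
  · rw [← hd] at key
    obtain ⟨k, hk⟩ := (sectGt_iff (hP.real_node le_rfl) h0).1 (key.resolve_left (lt_irrefl ℓ))
    rw [hv] at hk
    linarith [(abs_le.1 (hP.abs_last_le k)).2]
  · right
    rw [add_zero]
    exact (sectGt_iff (hP.real_node hj) h0).2 ⟨k, by rw [hv]; exact hc⟩
  · intro d ih
    rw [← add_assoc]
    by_cases hlt : j + d < ℓ
    · right
      have h := succ_le_iff.2 hlt
      obtain ⟨η, hη, h1⟩ := (hP.real_node hlt.le).regular.forall_of_gt
        ((sectGt_iff (hP.real_node hlt.le) h0).1 (ih.resolve_left (not_lt.2 hlt.le)))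
      obtain ⟨l, hl⟩ := hP.node_lt hlt
      refine (sectGt_iff (hP.real_node h) h0).2 (exists_gt_of_forall 2 hη fun i => ?_)
      linarith [h1 l, (hP.real_node h).regular.le l i, eps_pos l, eps_pos i]
    · exact .inl (lt_succ_iff.2 (not_lt.1 hlt))

theorem IsTaggedPartition.inUnit_tag (hP : IsTaggedPartition P ℓ) {j : M.Num} (hj : j < ℓ) :
    InUnit (tag P j) := by
  refine inUnit_iff.2 ⟨hP.real_tag hj, fun k => ?_, fun k => ?_⟩
  · by_contra! hc
    obtain ⟨η, hη, h1⟩ := (hP.real_tag hj).regular.forall_of_lt ⟨k, hc⟩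
    obtain ⟨i, hi⟩ := exists_lt_of_forall (a := rseq (sect P (j + j))) (β := 0) 3 hη fun i => by
      linarith [h1 i, hP.node_le_tag hj i]
    linarith [hP.node_nonneg hj.le i]
  · by_contra! hc
    obtain ⟨η, hη, h1⟩ := (hP.real_tag hj).regular.forall_of_gt ⟨k, hc⟩
    obtain ⟨i, hi⟩ := exists_gt_of_forall (a := rseq (sect P (j + 1 + (j + 1)))) (β := 1) 3 hη
      fun i => by linarith [h1 i, hP.tag_le_node hj i]
    linarith [hP.node_le_one (succ_le_iff.2 hj) i]

/-- If some approximation exceeds a partition point, then some approximation exceeds the next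
one. -/
theorem exists_node_succ_lt_apx {Θ : Set M.Num} [IsSet Θ] (hP : IsTaggedPartition P ℓ)
    (hfine : IsFine (gauge Θ) P ℓ) {j : M.Num} (hj : j < ℓ)
    (h : ∃ n k, rseq (sect P (j + j)) k + 2 * eps k < apx Θ n) :
    ∃ n k, rseq (sect P (j + 1 + (j + 1))) k + 2 * eps k < apx Θ n := by
  by_contra! hc
  obtain ⟨n, hn⟩ := h
  have hx := hP.real_node hj.le
  have hx' := hP.real_node (succ_le_iff.2 hj)
  have ht := hP.real_tag hj
  obtain ⟨η, hη, hlt⟩ := hx.regular.forall_of_lt hn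
  have key : ∀ (y : Set M.Num) (b : M.Num → Fr M), Repr y b →
      Baire1Ge (gauge Θ) (tag P j) y → ∀ l, (∀ i, |b l - b i| ≤ 2 * eps l + 2 * eps i) →
      ∃ N, ∀ m, N ≤ m → ∀ i, b l - 2 * eps l ≤
        |rseq (sect P (j + j + 1)) i - apx Θ m| / 2 + η / 100 + 5 * eps i :=
    fun y b hb hge l hl => eventually_le_of_baire1Ge (hP.inUnit_tag hj) hb 2
      (fun i => by linarith [(abs_le.1 (hl i)).2]) hge (by positivity)
  -- A generous constant: all errors at index `l` must be negligible against the margin `η` between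
  -- node `j` and the approximations.
  obtain ⟨l, hl⟩ := exists_mul_eps_lt 1000 hη
  have hsub : ∀ {a b : M.Num → Fr M}, Regular a → Regular b → ∀ k i,
      |(a (k + 1) - b (k + 1)) - (a (i + 1) - b (i + 1))| ≤ 2 * eps k + 2 * eps i := by
    intro a b ha hb k i
    have h1 := abs_le.1 (ha.abs_sub_le (k + 1) (i + 1))
    have h2 := abs_le.1 (hb.abs_sub_le (k + 1) (i + 1))
    have := eps_pos k
    have := eps_pos i
    rw [eps_succ, eps_succ] at h1 h2
    rw [abs_le]
    constructor <;> linarith [h1.1, h1.2, h2.1, h2.2]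
  obtain ⟨N₁, h₁⟩ := key _ _ (ht.repr.realSub hx.repr) (hfine j hj).1 l
    (hsub ht.regular hx.regular l)
  obtain ⟨N₂, h₂⟩ := key _ _ (hx'.repr.realSub ht.repr) (hfine j hj).2 l
    (hsub hx'.regular ht.regular l)
  set m := max n (max N₁ N₂) with hm
  have e₁ := h₁ m ((le_max_left _ _).trans (le_max_right _ _)) (l + 1)
  have e₂ := h₂ m ((le_max_right _ _).trans (le_max_right _ _)) (l + 1)
  have e₃ := hlt (l + 1)
  have e₄ := apx_mono (Θ := Θ) (le_max_left n (max N₁ N₂))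
  have e₅ := hc m (l + 1)
  have e₆ := eps_pos l
  rw [← hm] at e₄
  simp only [eps_succ] at e₁ e₂ e₃ e₅
  -- If the tag is at or above the approximation, left fineness `e₁` fails. If it is below, right
  -- fineness `e₂` with `e₅` makes their distance tiny, so `e₁` puts the approximation too near node
  -- `j`.
  rcases abs_cases (rseq (sect P (j + j + 1)) (l + 1) - apx Θ m) with ⟨e, h0⟩ | ⟨e, h0⟩ <;>
    rw [e] at e₁ e₂ <;> linarith

end Partition

/-! ### Existence of ranges -/

/-- Cousin's lemma for Baire 1 functions implies the existence of ranges of functions. -/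
theorem isSet_range (hCL : M.CousinBaire1) (Θ : Set M.Num) [IsSet Θ] :
    IsSet {k | ∃ m, pair k m ∈ Θ} := by
  by_contra hns
  obtain ⟨P, ℓ, hP, hfine⟩ := hCL (gauge Θ) isBaire1_gauge
    fun x hx h => hns (isSet_range_of_baire1Le hx h)
  have := IsSet.mk hP.mem_sets
  have key : ∀ {j : M.Num}, j ≤ ℓ → ((∃ n c v : M.Num, c = approx Θ n ∧ (v = pow2 n ∧
      SectLt P (j + j) (.ofNums c v))) ↔
      ∃ n k, rseq (sect P (j + j)) k + 2 * eps k < apx Θ n) := fun {j} hj => by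
    have : ∀ n, SectLt P (j + j) (.ofNums (approx Θ n) (pow2 n)) ↔
        ∃ k, rseq (sect P (j + j)) k + 2 * eps k < apx Θ n := fun n => by
      rw [sectLt_iff (hP.real_node hj) (PreRat.denPos_ofNums (pow2_pos n)), val_approx]
    constructor
    · rintro ⟨n, _, _, rfl, rfl, h⟩
      exact ⟨n, (this n).1 h⟩
    · rintro ⟨n, h⟩
      exact ⟨n, _, _, rfl, rfl, (this n).2 h⟩
  have h := induction_on (fun j => ℓ < j ∨ ∃ n c v : M.Num, c = approx Θ n ∧ (v = pow2 n ∧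
      SectLt P (j + j) (.ofNums c v))) ℓ ?_ ?_
  · obtain ⟨n, k, hk⟩ := (key le_rfl).1 (h.resolve_left (lt_irrefl ℓ))
    linarith [(abs_le.1 (hP.abs_last_le k)).1, apx_lt_one (Θ := Θ) n]
  · refine .inr ((key zero_le).2 ?_)
    -- If no approximation exceeds node 0, they all equal 0 and converge to that node, which would
    -- make the range a set.
    by_contra! hc
    refine hns (isSet_range_of_limit (hP.real_node zero_le) 2 fun ε hε => ⟨0, fun m _ i => ?_⟩)
    have h1 := hc m i
    have h2 := abs_le.1 (hP.abs_first_le i)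
    rw [map_ofNat, abs_le]
    constructor <;> linarith [apx_nonneg (Θ := Θ) m, h2.1, h2.2, eps_pos i]
  · intro j ih
    by_cases hj : j < ℓ
    · exact .inr ((key (succ_le_iff.2 hj)).2 (exists_node_succ_lt_apx hP hfine hj
        ((key hj.le).1 (ih.resolve_left (not_lt.2 hj.le)))))
    · exact .inl (lt_succ_iff.2 (not_lt.1 hj))

/-! ## Comprehension for `Σ⁰₁` formulas -/

theorem DefBdd.holds {φ : ArithFormula M.sets} (hφ : φ.IsBounded) :
    DefBdd (fun e => M.Holds φ e) :=
  ⟨φ.rename (Equiv.natSumNatEquivNat ∘ Sum.inl), hφ.rename _, fun _ => 0, fun e => by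
    rw [holds_rename, show mix e (fun _ => 0) ∘ Equiv.natSumNatEquivNat ∘ Sum.inl = e from
      funext fun i => by simp [mix]]⟩

theorem scons_zero_succ (e : ℕ → M.Num) : scons (e 0) (fun i => e (i + 1)) = e := by
  funext i
  cases i <;> rfl

/-- A block of existential quantifiers can be contracted to a single one. -/
theorem exists_defBdd_of_isSigma1 {φ : ArithFormula M.sets} (hφ : φ.IsSigma1) :
    ∃ R : M.Num → (ℕ → M.Num) → Prop, DefBdd (fun e => R (e 0) (fun i => e (i + 1))) ∧
      ∀ e, M.Holds φ e ↔ ∃ a, R a e := by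
  induction hφ with
  | bounded hφ =>
    have := DefBdd.holds hφ
    exact ⟨fun _ e => M.Holds _ e, DefBdd.rename _ _, fun e => ⟨fun h => ⟨0, h⟩, fun ⟨_, h⟩ => h⟩⟩
  | ex hφ ih =>
    obtain ⟨R, hR, h⟩ := ih
    let ρ : ℕ → ℕ := fun i => match i with
      | 0 => 0
      | 1 => 1
      | i + 2 => i + 3
    have h1 : DefBdd (fun e : ℕ → M.Num => R (e 0) (scons (e 1) (fun i => e (i + 3)))) := by
      refine (DefBdd.rename _ ρ (hP := hR)).of_iff (Q := _) fun e => ?_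
      rw [show scons (e 1) (fun i => e (i + 3)) = fun i => e (ρ (i + 1)) from
        funext fun i => by cases i <;> rfl]
    -- Two existential witnesses are replaced by one common bound `c`.
    refine ⟨fun c e => ∃ a, a < c + 1 ∧ ∃ b, b < c + 1 ∧ R b (scons a e), ?_, fun e => ?_⟩
    · have h2 : DefBdd (fun e : ℕ → M.Num => ∃ b, b < e 1 + 1 ∧
          R b (scons (e 0) (fun i => e (i + 2)))) :=
        DefBdd.bex (fun e => e 1 + 1) (fun b e => R b (scons (e 0) (fun i => e (i + 2))))
      exact DefBdd.bex (fun e => e 0 + 1)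
        (fun a e => ∃ b, b < e 0 + 1 ∧ R b (scons a (fun i => e (i + 1))))
    · simp only [Holds, h]
      constructor
      · rintro ⟨a, b, hab⟩
        exact ⟨max a b, a, lt_succ_iff.2 (le_max_left _ _), b, lt_succ_iff.2 (le_max_right _ _),
          hab⟩
      · rintro ⟨_, a, _, b, _, hab⟩
        exact ⟨a, b, hab⟩

/-- Substitution of numbers for all but the first `k` variables. -/
theorem exists_mix_comp_eq_ite (k : ℕ) (s p : ℕ → M.Num) : ∃ (p' : ℕ → M.Num) (ρ : ℕ → ℕ),
    ∀ e, mix e p' ∘ ρ = mix (fun i => if i < k then e i else s i) p := by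
  let q := Equiv.natSumNatEquivNat
  refine ⟨mix s p, q ∘ Sum.elim (fun i => if i < k then .inl i else .inr (q (.inl i)))
    (fun j => .inr (q (.inr j))) ∘ q.symm, fun e => ?_⟩
  funext i
  obtain ⟨j | j, rfl⟩ := q.surjective i
  · by_cases h : j < k <;> simp [mix, q, h]
  · simp [mix, q]

theorem DefBdd.subst (P : (ℕ → M.Num) → Prop) [hP : DefBdd P] (k : ℕ) (s : ℕ → M.Num) :
    DefBdd (fun e => P (fun i => if i < k then e i else s i)) := by
  obtain ⟨⟨φ, hφ, p, h⟩⟩ := hP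
  obtain ⟨p', ρ, hρ⟩ := exists_mix_comp_eq_ite k s p
  exact ⟨φ.rename ρ, hφ.rename _, p', fun e => by rw [holds_rename, hρ, h]⟩

theorem DefSig.subst (P : (ℕ → M.Num) → Prop) [hP : DefSig P] (k : ℕ) (s : ℕ → M.Num) :
    DefSig (fun e => P (fun i => if i < k then e i else s i)) := by
  obtain ⟨⟨φ, hφ, p, h⟩⟩ := hP
  obtain ⟨p', ρ, hρ⟩ := exists_mix_comp_eq_ite k s p
  exact ⟨φ.rename ρ, hφ.rename _, p', fun e => by rw [holds_rename, hρ, h]⟩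

/-- Cousin's lemma for Baire 1 functions implies `Σ⁰₁` comprehension. -/
theorem isSet_setOf_sigma1 (hCL : M.CousinBaire1) (P : M.Num → Prop)
    [DefSig (fun e => P (e 0))] : IsSet {n | P n} := by
  obtain ⟨φ, hφ, s, h⟩ := exists_holds_scons P
  obtain ⟨R, hR, h'⟩ := exists_defBdd_of_isSigma1 hφ
  have h1 : DefBdd (fun e : ℕ → M.Num => R (e 0) (scons (e 1) s)) := by
    refine (DefBdd.subst _ 2 (fun i => s (i - 2)) (hP := hR)).of_iff (Q := _) fun e => ?_
    rw [show scons (e 1) s = fun i => if i + 1 < 2 then e (i + 1) else s (i + 1 - 2) from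
      funext fun i => by cases i <;> simp [scons]]
    rfl
  have h2 : DefBdd (fun e : ℕ → M.Num => ∃ m, m < e 1 + 1 ∧ (e 1 = pair (e 0) m ∧
      R m (scons (e 0) s))) :=
    have := DefBdd.rename _ (fun i => i) (hP := h1)
    DefBdd.bex (fun e => e 1 + 1) (fun m e => e 1 = pair (e 0) m ∧ R m (scons (e 0) s))
  have h3 : DefBdd (fun e : ℕ → M.Num => ∃ n, n < e 0 + 1 ∧ ∃ m, m < e 0 + 1 ∧
      (e 0 = pair n m ∧ R m (scons n s))) :=
    DefBdd.bex (fun e => e 0 + 1)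
      (fun n e => ∃ m, m < e 0 + 1 ∧ (e 0 = pair n m ∧ R m (scons n s)))
  have h4 := isSet_setOf (fun w => ∃ n, n < w + 1 ∧ ∃ m, m < w + 1 ∧
      (w = pair n m ∧ R m (scons n s)))
  have h5 := isSet_range hCL {w | ∃ n, n < w + 1 ∧ ∃ m, m < w + 1 ∧
      (w = pair n m ∧ R m (scons n s))}
  convert h5 using 2
  ext n
  rw [← h n, h']
  constructor
  · rintro ⟨m, hm⟩
    exact ⟨m, n, lt_succ_iff.2 (left_le_pair n m), m, lt_succ_iff.2 (right_le_pair n m), rfl, hm⟩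
  · rintro ⟨m, n', _, m', _, hw, hm⟩
    obtain ⟨rfl, rfl⟩ := pair_inj.1 hw
    exact ⟨_, hm⟩

/-! ## Arithmetical comprehension -/

theorem exists_termVal_eq (t : NumTerm) :
    ∃ d, ∀ e e' : ℕ → M.Num, (∀ i < d, e i = e' i) → M.termVal e t = M.termVal e' t := by
  induction t with
  | var i => exact ⟨i + 1, fun e e' h => h i i.lt_succ_self⟩
  | zero => exact ⟨0, fun _ _ _ => rfl⟩
  | one => exact ⟨0, fun _ _ _ => rfl⟩
  | add s t hs ht | mul s t hs ht =>
    obtain ⟨d, hs⟩ := hs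
    obtain ⟨d', ht⟩ := ht
    refine ⟨max d d', fun e e' h => ?_⟩
    simp only [termVal, hs e e' fun i hi => h i (lt_max_of_lt_left hi),
      ht e e' fun i hi => h i (lt_max_of_lt_right hi)]

theorem exists_holds_iff (φ : ArithFormula M.sets) :
    ∃ d, ∀ e e' : ℕ → M.Num, (∀ i < d, e i = e' i) → (M.Holds φ e ↔ M.Holds φ e') := by
  induction φ with
  | eq s t | lt s t =>
    obtain ⟨d, hs⟩ := exists_termVal_eq (M := M) s
    obtain ⟨d', ht⟩ := exists_termVal_eq (M := M) t
    refine ⟨max d d', fun e e' h => ?_⟩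
    simp only [Holds, hs e e' fun i hi => h i (lt_max_of_lt_left hi),
      ht e e' fun i hi => h i (lt_max_of_lt_right hi)]
  | mem s X =>
    obtain ⟨d, hs⟩ := exists_termVal_eq (M := M) s
    exact ⟨d, fun e e' h => by simp only [Holds, hs e e' h]⟩
  | neg φ ih =>
    obtain ⟨d, ih⟩ := ih
    exact ⟨d, fun e e' h => not_congr (ih e e' h)⟩
  | and φ ψ hφ hψ | or φ ψ hφ hψ | imp φ ψ hφ hψ | iff φ ψ hφ hψ =>
    obtain ⟨d, hφ⟩ := hφ
    obtain ⟨d', hψ⟩ := hψ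
    refine ⟨max d d', fun e e' h => ?_⟩
    simp only [Holds, hφ e e' fun i hi => h i (lt_max_of_lt_left hi),
      hψ e e' fun i hi => h i (lt_max_of_lt_right hi)]
  | all φ ih | ex φ ih =>
    obtain ⟨d, ih⟩ := ih
    refine ⟨d, fun e e' h => ?_⟩
    have : ∀ a, M.Holds φ (scons a e) ↔ M.Holds φ (scons a e') := fun a =>
      ih _ _ fun i hi => by
        cases i with
        | zero => rfl
        | succ i => exact h i (i.lt_succ_self.trans hi)
    simp only [Holds, this]

/-- Definable predicates depend on finitely many variables. -/
theorem DefSig.exists_support (P : (ℕ → M.Num) → Prop) [hP : DefSig P] :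
    ∃ d, ∀ e e' : ℕ → M.Num, (∀ i < d, e i = e' i) → (P e ↔ P e') := by
  obtain ⟨⟨φ, _, p, h⟩⟩ := hP
  obtain ⟨d, hd⟩ := exists_holds_iff φ
  refine ⟨d, fun e e' hee => ?_⟩
  rw [← h, ← h]
  refine hd _ _ fun i hi => ?_
  obtain ⟨j | j, rfl⟩ := Equiv.natSumNatEquivNat.surjective i
  · have : j < d := lt_of_le_of_lt (by simp; omega) hi
    simp [mix, hee j this]
  · simp [mix]

/-- Under `Σ⁰₁` comprehension, the predicates which are `Σ⁰₁` in set parameters are closed under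
negation. -/
theorem DefSig.not (hCA : ∀ P : M.Num → Prop, DefSig (fun e => P (e 0)) → IsSet {n | P n})
    (P : (ℕ → M.Num) → Prop) [hP : DefSig P] : DefSig (fun e => ¬ P e) := by
  have key : ∀ (d : ℕ) (P : (ℕ → M.Num) → Prop), DefSig P →
      (∀ e e', (∀ i < d + 1, e i = e' i) → (P e ↔ P e')) → DefSig (fun e => ¬ P e) := by
    -- Induction on the number of variables. The first two are merged into one by pairing until one
    -- is left; then comprehension turns the predicate into a set, whose complement is Σ⁰₀ in that
    -- set.
    intro d
    induction d with
    | zero =>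
      intro P hP h
      have := hCA (fun n => P (fun _ => n)) (DefSig.rename P fun _ => 0)
      refine DefSig.of_iff (Q := fun e => e 0 ∉ {n | P (fun _ => n)}) fun e => not_congr ?_
      exact h _ _ fun i hi => by rw [Nat.lt_one_iff.1 hi]
    | succ d ih =>
      intro P hP h
      let P' : (ℕ → M.Num) → Prop := fun e =>
        ∃ a b : M.Num, e 0 = pair a b ∧ P (scons a (scons b (fun i => e (i + 1))))
      have h1 : DefSig P' := by
        have : DefSig (fun e : ℕ → M.Num => P (scons (e 1) (scons (e 0) (fun i => e (i + 3))))) := by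
          let ρ : ℕ → ℕ := fun i => match i with
            | 0 => 1
            | 1 => 0
            | i + 2 => i + 3
          refine (DefSig.rename P ρ).of_iff (Q := _) fun e => iff_of_eq (congrArg P ?_)
          funext i
          rcases i with _ | _ | i <;> rfl
        exact inferInstanceAs (DefSig fun e : ℕ → M.Num =>
          ∃ a b : M.Num, e 0 = pair a b ∧ P (scons a (scons b (fun i => e (i + 1)))))
      have h2 := ih P' h1 fun e e' hee => by
        have : ∀ a b, P (scons a (scons b (fun i => e (i + 1)))) ↔
            P (scons a (scons b (fun i => e' (i + 1)))) := fun a b => h _ _ fun i hi => by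
          rcases i with _ | _ | i
          exacts [rfl, rfl, hee (i + 1) (by omega)]
        simp only [P', this, hee 0 (by omega)]
      have h3 : DefSig (fun e : ℕ → M.Num => ¬ P' (scons (e 0) (fun i => e (i + 3)))) := by
        let ρ : ℕ → ℕ := fun i => match i with
          | 0 => 0
          | i + 1 => i + 3
        refine (DefSig.rename _ ρ (hP := h2)).of_iff (Q := _) fun e => ?_
        rw [show scons (e 0) (fun i => e (i + 3)) = fun i => e (ρ i) from
          funext fun i => by cases i <;> rfl]
      refine DefSig.of_iff (Q := fun e => ∃ c : M.Num, c = pair (e 0) (e 1) ∧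
        ¬ P' (scons c (fun i => e (i + 2)))) fun e => ?_
      have h4 : P' (scons (pair (e 0) (e 1)) (fun i => e (i + 2))) ↔ P e := by
        have he : scons (e 0) (scons (e 1) (fun i => e (i + 2))) = e := by
          funext i
          rcases i with _ | _ | i <;> rfl
        constructor
        · rintro ⟨a, b, hab, h⟩
          obtain ⟨rfl, rfl⟩ := pair_inj.1 hab
          exact he ▸ h
        · exact fun h => ⟨e 0, e 1, rfl, he.symm ▸ h⟩
      rw [← h4]
      exact ⟨fun h => ⟨_, rfl, h⟩, fun ⟨_, hc, h⟩ => hc ▸ h⟩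
  obtain ⟨d, hd⟩ := DefSig.exists_support P
  exact key d P hP fun e e' h => hd e e' fun i hi => h i (by omega)

/-- Cousin's lemma for Baire 1 functions implies arithmetical comprehension. -/
theorem modelsACA0_of_cousinBaire1 (hCL : M.CousinBaire1) : M.ModelsACA0 := by
  have hnot : ∀ P : (ℕ → M.Num) → Prop, DefSig P → DefSig (fun e => ¬ P e) := fun P _ =>
    DefSig.not (fun P _ => isSet_setOf_sigma1 hCL P) P
  have hex : ∀ φ : ArithFormula M.sets, DefSig (fun e => M.Holds φ e) →
      DefSig (fun e => ∃ a, M.Holds φ (scons a e)) := fun φ h => by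
    have : DefSig (fun e : ℕ → M.Num => M.Holds φ (scons (e 0) (fun i => e (i + 1)))) := by
      simpa only [scons_zero_succ] using h
    infer_instance
  have key : ∀ φ : ArithFormula M.sets, DefSig (fun e => M.Holds φ e) := fun φ => by
    induction φ with
    | eq s t => exact DefSig.of_bdd _ (hP := DefBdd.holds (.eq s t))
    | lt s t => exact DefSig.of_bdd _ (hP := DefBdd.holds (.lt s t))
    | mem s X => exact DefSig.of_bdd _ (hP := DefBdd.holds (.mem s X))
    | neg φ ih => exact hnot _ ih
    | and φ ψ hφ hψ => exact DefSig.and _ _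
    | or φ ψ hφ hψ => exact DefSig.or _ _
    | imp φ ψ hφ hψ =>
      have := hnot _ hφ
      exact DefSig.of_iff (Q := fun e => ¬ M.Holds φ e ∨ M.Holds ψ e) fun e => imp_iff_not_or
    | iff φ ψ hφ hψ =>
      have := hnot _ hφ
      have := hnot _ hψ
      exact DefSig.of_iff (Q := fun e => M.Holds φ e ∧ M.Holds ψ e ∨
        ¬ M.Holds φ e ∧ ¬ M.Holds ψ e) fun e => iff_iff_and_or_not_and_not
    | ex φ ih => exact hex φ ih
    | all φ ih =>
      refine (hnot _ (hex (.neg φ) (hnot _ ih))).of_iff (Q := _) fun e => ?_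
      simp [Holds]
  refine ⟨hM.out.basic, fun X hX h0 hs n => ?_, fun φ s => ?_⟩
  · have := IsSet.mk hX
    exact induction_on (fun n => n ∈ X) n h0 hs
  · have h := key φ
    have : DefSig (fun e : ℕ → M.Num => M.Holds φ (scons (e 0) s)) := by
      refine (DefSig.subst _ 1 (fun i => s (i - 1)) (hP := h)).of_iff (Q := _) fun e => ?_
      refine iff_of_eq (congrArg (M.Holds φ) ?_)
      funext i
      cases i <;> simp [scons]
    exact (isSet_setOf_sigma1 hCL fun n => M.Holds φ (scons n s)).mem

/-! ## Sequential completeness -/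

/-- Some member of the sequence `Z` of reals from `N` on is far from the `N`-th one, to
precision `k`. -/
def SectFar (Z : Set M.Num) (k N : M.Num) : Prop :=
  ∃ m v : M.Num, ∃ q r : PreRat M, N ≤ m ∧ v = pow2 k ∧ q.IsRat ∧ r.IsRat ∧
    pair (pair k q.code) N ∈ Z ∧ pair (pair k r.code) m ∈ Z ∧
    ((PreRat.ofNums 5 v).Lt (q.sub r) ∨ (PreRat.ofNums 5 v).Lt (r.sub q))

set_option synthInstance.maxSize 4096 in
instance DefSig.sectFar (Z : Set M.Num) [IsSet Z] (t s : (ℕ → M.Num) → M.Num) [DefTerm t]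
    [DefTerm s] : DefSig (fun e => SectFar Z (t e) (s e)) := by
  unfold SectFar
  infer_instance

theorem sectFar_iff {Z : Set M.Num} (hZ : ∀ n, IsReal (sect Z n)) {k N : M.Num} :
    SectFar Z k N ↔ ∃ m, N ≤ m ∧ 5 * eps k < |rseq (sect Z N) k - rseq (sect Z m) k| := by
  have key : ∀ q r : M.Rat, (PreRat.ofNums 5 (pow2 k)).Lt (q.1.sub r.1) ↔
      5 * eps k < q.1.val - r.1.val := fun q r => by
    rw [PreRat.lt_iff (PreRat.denPos_ofNums (pow2_pos k)) ((rat_denPos q).sub (rat_denPos r)),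
      PreRat.val_sub (rat_denPos q) (rat_denPos r), PreRat.val_ofNums, eps, mul_one_div,
      map_ofNat]
  simp only [lt_abs, neg_sub]
  constructor
  · rintro ⟨m, _, q, r, hm, rfl, hq, hr, hqZ, hrZ, h⟩
    refine ⟨m, hm, ?_⟩
    rw [← ((hZ N).repr k ⟨q, hq⟩).1 hqZ, ← ((hZ m).repr k ⟨r, hr⟩).1 hrZ]
    exact h.imp (key ⟨q, hq⟩ ⟨r, hr⟩).1 (key ⟨r, hr⟩ ⟨q, hq⟩).1
  · rintro ⟨m, hm, h⟩
    obtain ⟨q, hq⟩ := exists_rat (rseq (sect Z N) k)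
    obtain ⟨r, hr⟩ := exists_rat (rseq (sect Z m) k)
    rw [← hq, ← hr] at h
    exact ⟨m, _, q.1, r.1, hm, rfl, q.2, r.2, ((hZ N).repr k q).2 hq, ((hZ m).repr k r).2 hr,
      h.imp (key q r).2 (key r q).2⟩

/-- `Σ⁰₁` comprehension implies sequential completeness. -/
theorem seqComplete_of_sigma1 (hCA : ∀ P : M.Num → Prop, DefSig (fun e => P (e 0)) →
    IsSet {n | P n}) : M.SeqComplete := by
  intro Z hZ hZu hcau
  have := IsSet.mk hZ
  have hZr : ∀ n, IsReal (sect Z n) := fun n => (hZu n).1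
  -- Comprehension is used only for `T`. Relative to `T`, being a valid modulus at precision `k` is
  -- Σ⁰₀, so the least modulus `N k` can be found and the limit defined from it.
  let T : Set M.Num := {c | ∃ k N : M.Num, c = pair k N ∧ SectFar Z (k + 4) N}
  have hT : IsSet T := hCA (fun c => ∃ k N : M.Num, c = pair k N ∧ SectFar Z (k + 4) N)
    inferInstance
  have hTm : ∀ k N, pair k N ∉ T ↔ ∀ m, N ≤ m →
      |rseq (sect Z N) (k + 4) - rseq (sect Z m) (k + 4)| ≤ 5 * eps (k + 4) := fun k N => by
    have : pair k N ∈ T ↔ SectFar Z (k + 4) N := by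
      constructor
      · rintro ⟨k', N', hc, h⟩
        obtain ⟨rfl, rfl⟩ := pair_inj.1 hc
        exact h
      · exact fun h => ⟨k, N, rfl, h⟩
    rw [this, sectFar_iff hZr]
    push Not
    rfl
  have he4 : ∀ k : M.Num, eps (k + 4) = eps k / 16 := fun k => by
    rw [show k + 4 = k + 1 + 1 + 1 + 1 by ring]
    simp only [eps_succ]
    ring
  have hex : ∀ k, ∃ N, pair k N ∉ T ∧ ∀ N' < N, ¬ pair k N' ∉ T := fun k => by
    refine exists_least (fun N => pair k N ∉ T) ?_
    obtain ⟨ε, hε⟩ := exists_rat (eps (k + 4))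
    obtain ⟨N, hN⟩ := hcau ε (ratPos_iff.2 (by rw [hε]; exact eps_pos _))
    refine ⟨N, (hTm k N).2 fun m hm => ?_⟩
    have := (distLe_iff (hZr N).repr (hZr m).repr ε).1 (hN N m le_rfl hm) (k + 3)
    -- The factor 5 in `SectFar` arises here: `ε = eps (k + 4)`, plus `2 * eps (k + 3) = 4 * eps (k
    -- + 4)` from the definition of `≤` for reals.
    rw [show k + 3 + 1 = k + 4 by ring, hε] at this
    have h2 := eps_succ (k + 3)
    rw [show k + 3 + 1 = k + 4 by ring] at h2
    linarith
  choose N hN hNmin using hex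
  have hNd := fun k => (hTm k (N k)).1 (hN k)
  -- The shift by 4 leaves room: two moduli at `5/16` each and one regularity error of `1/16` give
  -- `11/16` of `eps k`.
  have hreg : Regular fun k => rseq (sect Z (N k)) (k + 4) := fun k l hkl => by
    have h1 := abs_le.1 (hNd k _ (le_max_left (N k) (N l)))
    have h2 := abs_le.1 (hNd l _ (le_max_right (N k) (N l)))
    have h3 := abs_le.1 ((hZr (max (N k) (N l))).regular (k + 4) (l + 4) (by gcongr))
    have h4 := eps_anti hkl
    have h5 := eps_pos k
    simp only [he4] at h1 h2 h3
    rw [abs_le]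
    constructor <;> linarith [h1.1, h1.2, h2.1, h2.2, h3.1, h3.2]
  obtain ⟨z, hz, hzr⟩ := exists_isReal_of_def _ hreg
    (fun k q => ∃ n : M.Num, pair k n ∉ T ∧ (∀ n', n' < n → ¬ pair k n' ∉ T) ∧
      pair (pair (k + 4) q.code) n ∈ Z) (fun t q _ _ => inferInstance) fun k q => by
    constructor
    · rintro ⟨n, h1, h2, h3⟩
      have : n = N k := le_antisymm (not_lt.1 fun h => h2 _ h (hN k))
        (not_lt.1 fun h => hNmin k _ h h1)
      subst this
      exact ((hZr (N k)).repr (k + 4) q).1 h3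
    · exact fun h => ⟨N k, hN k, hNmin k, ((hZr (N k)).repr (k + 4) q).2 h⟩
  have hzs := hz.repr.eq hzr
  refine ⟨z, inUnit_iff.2 ⟨hz, fun k => ?_, fun k => ?_⟩, fun ε hε => ?_⟩
  · have := (inUnit_iff.1 (hZu (N k))).2.1 (k + 4)
    rw [he4] at this
    rw [hzs]
    linarith [eps_pos k]
  · have := (inUnit_iff.1 (hZu (N k))).2.2 (k + 4)
    rw [he4] at this
    rw [hzs]
    linarith [eps_pos k]
  · obtain ⟨k, hk⟩ := exists_eps_lt (half_pos (ratPos_iff.1 hε))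
    refine ⟨N k, fun n hn => (distLe_iff (hZr n).repr hzr ε).2 fun i => ?_⟩
    have h1 := abs_le.1 ((hZr n).regular.abs_sub_le (i + 1) (k + 4))
    have h2 := abs_le.1 (hNd k n hn)
    have h3 := abs_le.1 (hreg.abs_sub_le k (i + 1))
    have h4 := eps_pos i
    have h5 := eps_pos k
    rw [eps_succ, he4] at h1
    rw [he4] at h2
    rw [eps_succ i] at h3
    rw [abs_le]
    constructor <;> linarith [h1.1, h1.2, h2.1, h2.2, h3.1, h3.2]

end L2Structure

end SOA

theorem mainTheorem2 (M : SOA.L2Structure.{u}) (hRCA : M.ModelsRCA0) (hCL : M.CousinBaire1) :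
    M.SeqComplete ∧ M.ModelsACA0 := by
  have : Fact M.ModelsRCA0 := ⟨hRCA⟩
  exact ⟨SOA.L2Structure.seqComplete_of_sigma1 fun P _ =>
    SOA.L2Structure.isSet_setOf_sigma1 hCL P, SOA.L2Structure.modelsACA0_of_cousinBaire1 hCL⟩
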